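/- Let $(\Omega,\mathfrak F,\mathbb P)$ be a probability space and let $\{T(x,t):(x,t)\in\mathbb S^2\times\mathbb Z\}$ be a real random field such that $(x,\omega)\mapsto T(x,t,\omega)$ is jointly measurable for each $t$, $\mathbb E[T(x,t)]=0$ and $\mathbb E|T(x,t)|^2<\infty$. Assume that $T$ is isotropic stationary: $\mathbb E[T(x,t)T(y,s)]=\mathbb E[T(gx,t+h)T(gy,s+h)]$ for all $x,y\in\mathbb S^2$, $g\in SO(3)$, $t,s,h\in\mathbb Z$. Let $Y_{\ell,m}$ ($\ell\ge 0$, $|m|\le\ell$) be the standard complex spherical harmonics, orthonormal for the surface measure $dx$, and for a field $X$ put $a_{\ell,m;X}(t)=\int_{\mathbb S^2}X(x,t)\overline{Y_{\ell,m}(x)}\,dx$; write $a_{\ell,m}=a_{\ell,m;T}$. In $L^2(\Omega;\mathbb C)$ let $$\mathcal M_{\ell,m;n}=\overline{\operatorname{span}}\{a_{\ell,m}(t):t\le n\},\qquad \mathcal M_{\ell,m;-\infty}=\bigcap_{n\in\mathbb Z}\mathcal M_{\ell,m;n},\qquad \sigma_\ell^2=\inf_{f\in\mathcal M_{\ell,m;n}}\mathbb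 E|a_{\ell,m}(n+1)-f|^2 ,$$ the last quantity not depending on $m$ and $n$. Assume that $\sigma_\ell^2>0$ and $\mathcal M_{\ell,m;-\infty}=\{0\}$ for all $\ell\ge 0$, $|m|\le\ell$. A spherical white noise with power spectrum $\{C_\ell\}$ is a jointly measurable (for each time), zero-mean, real field $Z$ on $\mathbb S^2\times\mathbb Z$ with finite second moments which, for each $t$, is isotropic with $\mathbb E[Z(x,t)Z(y,t)]=\sum_{\ell}\frac{2\ell+1}{4\pi}C_\ell P_\ell(\langle x,y\rangle)$, where $P_\ell$ are the Legendre polynomials and $\sum_\ell\frac{2\ell+1}{4\pi}C_\ell<\infty$, and such that $\mathbb E[a_{\ell,m;Z}(t)\overline{a_{\ell',m';Z}(s)}]=0$ for all $\ell,m,\ell',m'$ whenever $t\ne s$. A Wold decomposition of $T$ consists of real numbers $\psi_{\ell;j}$ ($\ell,j\ge 0$) and real fields $Z,V$ on $\mathbb S^2\times\mathbb Z$ ($V$ being zero-mean with finite second moments and jointly measurable for each time) such that $$T(x,t)=\sum_{j=0}^\infty\Psi_jZ(x,t-j)+V(x,t),\qquad \Psi_jZ(x,s)=\sum_{\ell=0}^\infty\sum_{m=-\ell}^{\ell}\psi_{\ell;j}\,a_{\ell,m;Z}(s)\,Y_{\ell,m}(x),\qquad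 V(x,t)=\sum_{\ell=0}^\infty\sum_{m=-\ell}^{\ell}a_{\ell,m;V}(t)\,Y_{\ell,m}(x),$$ all series converging in $L^2(\Omega)$ for every point and time and in $L^2(\mathbb S^2\times\Omega)$ for every time, where $\psi_{\ell;0}=1$ and $\sum_j\psi_{\ell;j}^2<\infty$ for all $\ell$; $Z$ is a spherical white noise with power spectrum $\{\sigma_\ell^2\}$; and, for all indices, $a_{\ell,m;Z}(t)\in\mathcal M_{\ell,m;t}$, $a_{\ell,m;V}(t)\in\mathcal M_{\ell,m;-\infty}$ and $\mathbb E[a_{\ell,m;Z}(t)\overline{a_{\ell',m';V}(s)}]=0$. Then $T$ has a Wold decomposition, and for every Wold decomposition $(\psi,Z,V)$ of $T$ the following hold. 1. For every $\epsilon>0$ there are integers $L,q\ge 0$ such that for all $x\in\mathbb S^2$, $t\in\mathbb Z$ $$\mathbb E\Big|T(x,t)-Z(x,t)-\sum_{j=1}^q\sum_{\ell=0}^L\sum_{m=-\ell}^{\ell}\psi_{\ell;j}\,a_{\ell,m;Z}(t-j)\,Y_{\ell,m}(x)\Big|^2\le\epsilon ,$$ and, for all $t\in\mathbb Z$, the squared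 norm in $L^2(\mathbb S^2\times\Omega)$ of the same difference is at most $\epsilon$. 2. For every $\epsilon>0$ there are integers $L,p\ge 0$ and real coefficients $\phi_{\ell;j}$ with $\sum_{j}\phi_{\ell;j}^2<\infty$ for every $\ell$ such that for all $x\in\mathbb S^2$, $t\in\mathbb Z$ $$\mathbb E\Big|T(x,t)-\sum_{j=1}^p\sum_{\ell=0}^L\sum_{m=-\ell}^{\ell}\phi_{\ell;j}\,a_{\ell,m}(t-j)\,Y_{\ell,m}(x)-Z(x,t)\Big|^2\le\epsilon ,$$ and, for all $t\in\mathbb Z$, the squared norm in $L^2(\mathbb S^2\times\Omega)$ of the same difference is at most $\epsilon$. -/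

import Mathlib

open MeasureTheory Filter Topology

noncomputable section

namespace SphereTime

/-- The unit sphere `S²` of the Euclidean space `ℝ³`. -/
abbrev S2 : Type := Metric.sphere (0 : EuclideanSpace ℝ (Fin 3)) 1

/-- The (unnormalised) surface measure `dx` of the sphere, of total mass `4π`. -/
def surface : Measure S2 := (volume : Measure (EuclideanSpace ℝ (Fin 3))).toSphere

instance : IsFiniteMeasure surface := by unfold surface; infer_instance

theorem norm_rotate (g : Matrix.specialOrthogonalGroup (Fin 3) ℝ)
    (x : EuclideanSpace ℝ (Fin 3)) :
    ‖WithLp.toLp 2 ((g : Matrix (Fin 3) (Fin 3) ℝ).mulVec x.ofLp)‖ = ‖x‖ := by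
  have hg := (Matrix.mem_orthogonalGroup_iff' (Fin 3) ℝ).1
    (Matrix.mem_specialOrthogonalGroup_iff.1 g.2).1
  have h : ∀ v : EuclideanSpace ℝ (Fin 3), ‖v‖ ^ 2 = v.ofLp ⬝ᵥ v.ofLp := fun v => by
    rw [EuclideanSpace.real_norm_sq_eq]
    simp [dotProduct, pow_two]
  rw [← sq_eq_sq₀ (norm_nonneg _) (norm_nonneg _), h, h, Matrix.dotProduct_mulVec,
    Matrix.vecMul_mulVec]
  have h2 : (g : Matrix (Fin 3) (Fin 3) ℝ).transpose * (g : Matrix (Fin 3) (Fin 3) ℝ) = 1 := by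
    simpa [Matrix.star_eq_conjTranspose] using hg
  rw [h2, Matrix.vecMul_one]

/-- The action of a rotation `g ∈ SO(3)` on the sphere. -/
def rotate (g : Matrix.specialOrthogonalGroup (Fin 3) ℝ) (x : S2) : S2 :=
  ⟨WithLp.toLp 2 ((g : Matrix (Fin 3) (Fin 3) ℝ).mulVec (x : EuclideanSpace ℝ (Fin 3)).ofLp), by
    rw [mem_sphere_zero_iff_norm, norm_rotate]
    exact mem_sphere_zero_iff_norm.1 x.2⟩

/-- The Legendre polynomial `P_ℓ`, by Rodrigues' formula. -/
def legendre (l : ℕ) : Polynomial ℝ :=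
  Polynomial.C (1 / (2 ^ l * (l.factorial : ℝ))) *
    Polynomial.derivative^[l] ((Polynomial.X ^ 2 - 1) ^ l)

/-- The standard spherical harmonic `Y_{ℓ,k}` of order `0 ≤ k ≤ ℓ`, in Cartesian coordinates:
`(x₁ + i x₂)^k = sin(θ)^k e^{ikφ}` and `x₃ = cos θ`, so that
`(-1)^k (x₁ + i x₂)^k P_ℓ^{(k)}(x₃)` is the associated Legendre function times `e^{ikφ}`. -/
def sphericalHarmonicNonneg (l k : ℕ) (x : S2) : ℂ :=
  (-1) ^ k *
    (Real.sqrt ((2 * (l : ℝ) + 1) / (4 * Real.pi) *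
      (((l - k).factorial : ℝ) / ((l + k).factorial : ℝ))) : ℂ) *
    (((x : EuclideanSpace ℝ (Fin 3)) 0 : ℂ) +
      Complex.I * ((x : EuclideanSpace ℝ (Fin 3)) 1 : ℂ)) ^ k *
    (((Polynomial.derivative^[k] (legendre l)).eval
      ((x : EuclideanSpace ℝ (Fin 3)) 2) : ℝ) : ℂ)

/-- The standard complex spherical harmonics `Y_{ℓ,m}`, `-ℓ ≤ m ≤ ℓ`, with
`Y_{ℓ,-m} = (-1)^m conj Y_{ℓ,m}`. They are only used for `-ℓ ≤ m ≤ ℓ`. -/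
def sphericalHarmonic (l : ℕ) (m : ℤ) (x : S2) : ℂ :=
  if 0 ≤ m then sphericalHarmonicNonneg l m.natAbs x
  else (-1) ^ m.natAbs * (starRingEnd ℂ) (sphericalHarmonicNonneg l m.natAbs x)

/-- The orders `-ℓ, …, ℓ` of the spherical harmonics of degree `ℓ`. -/
def orders (l : ℕ) : Finset ℤ := Finset.Icc (-(l : ℤ)) (l : ℤ)

/-- The second absolute moment `∫ |f|² dμ`, with values in `[0, ∞]`. -/
def meanSq {α : Type*} [MeasurableSpace α] (μ : Measure α) (f : α → ℂ) : ENNReal :=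
  ∫⁻ a, ‖f a‖ₑ ^ 2 ∂μ

variable {Ω : Type*} [MeasurableSpace Ω]

/-- The harmonic coefficients `a_{ℓ,m}(t) = ∫_{S²} X(x,t) conj Y_{ℓ,m}(x) dx` of a field. -/
def coeff (X : S2 → ℤ → Ω → ℝ) (l : ℕ) (m : ℤ) (t : ℤ) (ω : Ω) : ℂ :=
  ∫ x, (X x t ω : ℂ) * (starRingEnd ℂ) (sphericalHarmonic l m x) ∂surface

/-- `∑_{ℓ=0}^{L} ∑_{m=-ℓ}^{ℓ} c_ℓ a_{ℓ,m;X}(t) Y_{ℓ,m}(x)`. -/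
def bandLimited (c : ℕ → ℝ) (X : S2 → ℤ → Ω → ℝ) (L : ℕ) (x : S2) (t : ℤ) (ω : Ω) : ℂ :=
  ∑ l ∈ Finset.range (L + 1), ∑ m ∈ orders l,
    (c l : ℂ) * coeff X l m t ω * sphericalHarmonic l m x

/-- Convergence of complex-valued space-time fields in `L²(Ω)` for every `(x,t)`, and in
`L²(S² × Ω)` for every `t`. -/
def ConvergesTo (P : Measure Ω) (S : ℕ → S2 → ℤ → Ω → ℂ) (F : S2 → ℤ → Ω → ℂ) : Prop :=
  (∀ x t, Tendsto (fun n => meanSq P (fun ω => S n x t ω - F x t ω)) atTop (𝓝 0)) ∧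
  (∀ t, Tendsto (fun n => meanSq (surface.prod P)
    (fun z => S n z.1 t z.2 - F z.1 t z.2)) atTop (𝓝 0))

/-- The field `E` is bounded by `ε` in mean square at every `(x,t)`, and its squared norm in
`L²(S² × Ω)` is bounded by `ε` at every `t`. -/
def BoundedBy (P : Measure Ω) (ε : ℝ) (E : S2 → ℤ → Ω → ℂ) : Prop :=
  (∀ x t, meanSq P (E x t) ≤ ENNReal.ofReal ε) ∧
  (∀ t, meanSq (surface.prod P) (fun z => E z.1 t z.2) ≤ ENNReal.ofReal ε)

/-- A zero-mean real space-time spherical random field with finite second moments; for each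
time it is jointly measurable in space and chance. -/
structure IsSecondOrderField (P : Measure Ω) (X : S2 → ℤ → Ω → ℝ) : Prop where
  measurable : ∀ t, Measurable (fun z : S2 × Ω => X z.1 t z.2)
  memLp : ∀ x t, MemLp (X x t) 2 P
  mean_zero : ∀ x t, ∫ ω, X x t ω ∂P = 0

/-- Isotropic stationary space-time random fields. -/
structure IsIsotropicStationary (P : Measure Ω) (X : S2 → ℤ → Ω → ℝ) : Prop
    extends IsSecondOrderField P X where
  invariant : ∀ (g : Matrix.specialOrthogonalGroup (Fin 3) ℝ) (x y : S2) (t s h : ℤ),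
    ∫ ω, X x t ω * X y s ω ∂P = ∫ ω, X (rotate g x) (t + h) ω * X (rotate g y) (s + h) ω ∂P

/-- Spherical white noise with angular power spectrum `C`: for each time a zero-mean isotropic
field with covariance kernel `∑ (2ℓ+1)/(4π) C_ℓ P_ℓ(⟨x,y⟩)`, with coefficients at different
times uncorrelated. -/
structure IsSphericalWhiteNoise (P : Measure Ω) (C : ℕ → ℝ) (Z : S2 → ℤ → Ω → ℝ) : Prop
    extends IsSecondOrderField P Z where
  isotropic : ∀ (g : Matrix.specialOrthogonalGroup (Fin 3) ℝ) (x y : S2) (t : ℤ),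
    ∫ ω, Z x t ω * Z y t ω ∂P = ∫ ω, Z (rotate g x) t ω * Z (rotate g y) t ω ∂P
  summable : Summable (fun l : ℕ => (2 * (l : ℝ) + 1) / (4 * Real.pi) * C l)
  covariance : ∀ (x y : S2) (t : ℤ),
    HasSum (fun l : ℕ => (2 * (l : ℝ) + 1) / (4 * Real.pi) * C l *
        (legendre l).eval
          (inner ℝ (x : EuclideanSpace ℝ (Fin 3)) (y : EuclideanSpace ℝ (Fin 3))))
      (∫ ω, Z x t ω * Z y t ω ∂P)
  uncorrelated : ∀ t s : ℤ, t ≠ s → ∀ l l' : ℕ, ∀ m ∈ orders l, ∀ m' ∈ orders l',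
    ∫ ω, coeff Z l m t ω * (starRingEnd ℂ) (coeff Z l' m' s ω) ∂P = 0

/-- `M_{ℓ,m;n}`, the closed linear span in `L²(Ω; ℂ)` of the `a_{ℓ,m}(t)` with `t ≤ n`. -/
def past (P : Measure Ω) (X : S2 → ℤ → Ω → ℝ) (l : ℕ) (m n : ℤ) : Submodule ℂ (Lp ℂ 2 P) :=
  (Submodule.span ℂ
    {f : Lp ℂ 2 P | ∃ t : ℤ, t ≤ n ∧ (f : Ω → ℂ) =ᵐ[P] coeff X l m t}).topologicalClosure

/-- `M_{ℓ,m;-∞}`, the intersection of all the `M_{ℓ,m;n}`. -/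
def remotePast (P : Measure Ω) (X : S2 → ℤ → Ω → ℝ) (l : ℕ) (m : ℤ) :
    Submodule ℂ (Lp ℂ 2 P) :=
  ⨅ n : ℤ, past P X l m n

/-- The one-step mean squared prediction error
`inf { E|a_{ℓ,m}(n+1) - f|² : f ∈ M_{ℓ,m;n} }`. -/
def predictionError (P : Measure Ω) (X : S2 → ℤ → Ω → ℝ) (l : ℕ) (m n : ℤ) : ℝ :=
  ⨅ f : past P X l m n, ∫ ω, ‖coeff X l m (n + 1) ω - (f : Lp ℂ 2 P) ω‖ ^ 2 ∂P

/-- `σ_ℓ²`. For an isotropic stationary field the prediction error depends neither on the order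
`m` nor on the time `n`; it is read off at `m = 0` and `n = 0`. -/
def innovationVariance (P : Measure Ω) (X : S2 → ℤ → Ω → ℝ) (l : ℕ) : ℝ :=
  predictionError P X l 0 0

/-- The Wold decomposition `T(x,t) = ∑_{j ≥ 0} Ψ_j Z(x,t-j) + V(x,t)`, where
`Ψ_j Z(x,s) = ∑_{ℓ,m} ψ_{ℓ;j} a_{ℓ,m;Z}(s) Y_{ℓ,m}(x)`. Here `psi l j` is `ψ_{ℓ;j}`. -/
structure IsWoldDecomposition (P : Measure Ω) (T : S2 → ℤ → Ω → ℝ) (psi : ℕ → ℕ → ℝ)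
    (Z V : S2 → ℤ → Ω → ℝ) : Prop where
  psi_zero : ∀ l, psi l 0 = 1
  psi_summable : ∀ l, Summable (fun j => psi l j ^ 2)
  noise : IsSphericalWhiteNoise P (innovationVariance P T) Z
  noise_mem : ∀ l, ∀ m ∈ orders l, ∀ t : ℤ,
    ∃ f ∈ past P T l m t, (f : Ω → ℂ) =ᵐ[P] coeff Z l m t
  remainder : IsSecondOrderField P V
  remainder_expansion :
    ConvergesTo P (fun L x t ω => bandLimited (fun _ => 1) V L x t ω) (fun x t ω => (V x t ω : ℂ))
  remainder_mem : ∀ l, ∀ m ∈ orders l, ∀ t : ℤ,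
    ∃ f ∈ remotePast P T l m, (f : Ω → ℂ) =ᵐ[P] coeff V l m t
  orthogonal : ∀ l l' : ℕ, ∀ m ∈ orders l, ∀ m' ∈ orders l', ∀ t s : ℤ,
    ∫ ω, coeff Z l m t ω * (starRingEnd ℂ) (coeff V l' m' s ω) ∂P = 0
  expansion : ∃ PsiZ : ℕ → S2 → ℤ → Ω → ℂ,
    (∀ j t, Measurable (fun z : S2 × Ω => PsiZ j z.1 t z.2)) ∧
    (∀ j, ConvergesTo P (fun L x t ω => bandLimited (fun l => psi l j) Z L x t ω) (PsiZ j)) ∧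
    ConvergesTo P
      (fun J x t ω => (∑ j ∈ Finset.range (J + 1), PsiZ j x (t - (j : ℤ)) ω) + (V x t ω : ℂ))
      (fun x t ω => (T x t ω : ℂ))

end SphereTime

end

/-! By isotropy the covariance kernel of `T` between two times is invariant under joint rotations,
so spherical harmonics are its eigenfunctions (`exists_eigenvalue_of_invariant_kernel`). Hence
coefficients with different `(ℓ, m)` are uncorrelated at all times, and those with the same `(ℓ, m)`
have a real covariance `γ_ℓ(t - s)` that does not depend on `m`
(`IsIsotropicStationary.exists_gram`). The field splits into orthogonal scalar stationary sequences,
and all sequences of one degree share their Wold theory.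

For one degree, minimise the norm of `∑ u_j a(t - j)` over finitely supported real weights with `u_0
= 1`. The norm depends on `γ_ℓ` only, so one minimising sequence of weights serves all `m` and `t`,
and by the parallelogram law the averages converge, uniformly in `m` and `t`, to the innovations
(`exists_isInnovation`). Peeling off innovations one by one leaves a residual that is pushed into
the remote past, which is zero (`IsInnovationOf.tendsto_wold`). A one-sided moving average over
orthogonal elements of the past with leading coefficient one must be the innovation expansion
(`IsInnovationOf.unique`). Since `V` has coefficients in the zero remote past, every Wold
decomposition has the same coefficients `ψ` and a noise with the innovations as coefficients
(`IsWoldDecomposition.eq_innovation`).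

The return to the sphere rests on the addition formula: the squares `|Y_{ℓ,m}(x)|²` of one degree
add up to `(2ℓ+1)/(4π)` at every `x`, so a harmonic series with orthogonal coefficients of squared
norm at most `B_ℓ` has squared norm at most `∑ (2ℓ+1)/(4π) B_ℓ`, whatever `x`
(`norm_harmonicSum_sq_le`). For the variances of `T` this sum is finite, and dominated convergence
over degrees (`tendsto_tsum_weighted`, `exists_boundedBy`) turns errors that vanish degree by degree
into bounds uniform in `x` and `t`. In the first approximation these errors are Wold residuals, in
the second the errors of the minimising weights; a degree left out contributes at most its variance.

No continuity of the covariance is assumed. An isotropic field nevertheless equals its harmonic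
series in mean square at every point, because the error of a partial sum is the same at all points
and Parseval's identity computes its integral (`tendsto_harmonicSum_of_isotropic`). -/

open MeasureTheory Filter Topology

noncomputable section

/-! ### Legendre polynomials on `[-1, 1]`: orthogonality, norms, derivatives -/

namespace SphereTime

open Polynomial

/-- The integral of a real polynomial over `[-1, 1]`. -/
def polyInt (p : ℝ[X]) : ℝ := ∫ x in (-1 : ℝ)..1, p.eval x

theorem polyInt_add (p q : ℝ[X]) : polyInt (p + q) = polyInt p + polyInt q := by
  simp only [polyInt, eval_add]
  exact intervalIntegral.integral_add (p.continuous.intervalIntegrable _ _)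
    (q.continuous.intervalIntegrable _ _)

theorem polyInt_C_mul (c : ℝ) (p : ℝ[X]) : polyInt (C c * p) = c * polyInt p := by
  simp [polyInt]

theorem polyInt_neg (p : ℝ[X]) : polyInt (-p) = -polyInt p := by
  simp [polyInt]

theorem polyInt_derivative (p : ℝ[X]) :
    polyInt (derivative p) = p.eval 1 - p.eval (-1) :=
  intervalIntegral.integral_eq_sub_of_hasDerivAt (fun x _ => p.hasDerivAt x)
    ((derivative p).continuous.intervalIntegrable _ _)

theorem polyInt_derivative_mul (p q : ℝ[X]) (h1 : p.eval 1 = 0) (h2 : p.eval (-1) = 0) :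
    polyInt (derivative p * q) = -polyInt (p * derivative q) := by
  have h := polyInt_derivative (p * q)
  rw [derivative_mul, polyInt_add] at h
  simp [h1, h2] at h
  linarith

/-- The polynomial `(X² - 1)^ℓ` of Rodrigues' formula. -/
def rodrigues (l : ℕ) : ℝ[X] := (X ^ 2 - 1) ^ l

/-- Both endpoints are zeros of multiplicity `l`, so fewer than `l` derivatives leave a factor `X ^
2 - 1`. This removes the boundary terms in `polyInt_iterate_mul`. -/
theorem eval_iterate_derivative_rodrigues (l n : ℕ) (h : n < l) (x : ℝ) (hx : x ^ 2 = 1) :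
    (derivative^[n] (rodrigues l)).eval x = 0 := by
  have h1 : (X ^ 2 - 1 : ℝ[X]) ∣ derivative^[n] (rodrigues l) :=
    (dvd_pow_self _ (by omega)).trans (pow_sub_dvd_iterate_derivative_pow (X ^ 2 - 1 : ℝ[X]) l n)
  obtain ⟨q, hq⟩ := h1
  rw [hq]
  simp [hx]

theorem natDegree_rodrigues (l : ℕ) : (rodrigues l).natDegree = 2 * l := by
  rw [rodrigues, natDegree_pow, show (X ^ 2 - 1 : ℝ[X]) = X ^ 2 - C 1 by simp,
    natDegree_X_pow_sub_C]
  ring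

theorem monic_rodrigues (l : ℕ) : (rodrigues l).Monic := by
  refine Monic.pow ?_ l
  simpa using monic_X_pow_sub_C (1 : ℝ) (two_ne_zero)

theorem polyInt_iterate_mul (l n : ℕ) (h : n ≤ l) (q : ℝ[X]) :
    polyInt (derivative^[l] (rodrigues l) * q) =
      (-1) ^ n * polyInt (derivative^[l - n] (rodrigues l) * derivative^[n] q) := by
  induction n with
  | zero => simp
  | succ n ih =>
    rw [ih (by omega), show l - n = (l - (n + 1)) + 1 by omega, Function.iterate_succ_apply',
      polyInt_derivative_mul _ _ (eval_iterate_derivative_rodrigues l _ (by omega) 1 (by norm_num))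
      (eval_iterate_derivative_rodrigues l _ (by omega) (-1) (by norm_num)),
      Function.iterate_succ_apply' _ n]
    ring

/-- Integrating the derivative of `X * (X ^ 2 - 1) ^ (l + 1)`, which vanishes at both ends, gives
`(2l + 3) I_{l+1} = -(2l + 2) I_l` for the integrals `I_l`; the formula follows by induction. -/
theorem polyInt_rodrigues (l : ℕ) : (-1) ^ l * polyInt (rodrigues l) * ((2 * l + 1).factorial : ℝ)
    = 2 ^ (2 * l + 1) * (l.factorial : ℝ) ^ 2 := by
  induction l with
  | zero =>
    simp [rodrigues, polyInt]
    norm_num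
  | succ l ih =>
    have h := polyInt_derivative (X * rodrigues (l + 1))
    have e : derivative (X * rodrigues (l + 1)) =
        C (2 * l + 3 : ℝ) * rodrigues (l + 1) + C (2 * l + 2 : ℝ) * rodrigues l := by
      simp only [rodrigues, derivative_mul, derivative_X, derivative_pow,
        derivative_sub, derivative_one]
      simp only [map_add, map_mul, C_ofNat, map_natCast, Nat.add_sub_cancel, Nat.cast_add,
        Nat.cast_one, map_one, Nat.cast_ofNat]
      ring
    have z1 : (rodrigues (l + 1)).eval 1 = 0 := by simp [rodrigues]
    have z2 : (rodrigues (l + 1)).eval (-1) = 0 := by simp [rodrigues]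
    rw [e, polyInt_add, polyInt_C_mul, polyInt_C_mul, eval_mul, eval_mul, z1, z2] at h
    have h3 : ((2 * (l + 1) + 1).factorial : ℝ) = (2 * l + 3) * (2 * l + 2) *
        ((2 * l + 1).factorial : ℝ) := by
      rw [show 2 * (l + 1) + 1 = (2 * l + 1) + 1 + 1 by ring, Nat.factorial_succ,
        Nat.factorial_succ]
      push_cast
      ring
    have h4 : ((l + 1).factorial : ℝ) = (l + 1) * (l.factorial : ℝ) := by
      rw [Nat.factorial_succ]; push_cast; ring
    rw [h3, h4]
    have h5 : (2 * l + 3) * polyInt (rodrigues (l + 1)) = - ((2 * l + 2) * polyInt (rodrigues l)) :=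
      by linarith
    calc _ = (-1) ^ (l + 1) * ((2 * l + 3) * polyInt (rodrigues (l + 1))) *
          ((2 * l + 2) * ((2 * l + 1).factorial : ℝ)) := by ring
      _ = ((-1) ^ l * polyInt (rodrigues l) * ((2 * l + 1).factorial : ℝ)) * (2 * l + 2) ^ 2 := by
          rw [h5]; ring
      _ = _ := by rw [ih]; ring

theorem iterate_derivative_rodrigues_two_mul (l : ℕ) :
    derivative^[2 * l] (rodrigues l) = C ((2 * l).factorial : ℝ) := by
  have h : (derivative^[2 * l] (rodrigues l)).natDegree ≤ 0 := by
    refine (natDegree_iterate_derivative _ _).trans ?_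
    rw [natDegree_rodrigues]; omega
  rw [eq_C_of_natDegree_le_zero h, coeff_iterate_derivative]
  have := monic_rodrigues l
  rw [Monic, leadingCoeff, natDegree_rodrigues] at this
  simp [this, Nat.descFactorial_self]

theorem legendre_eq (l : ℕ) :
    legendre l = C (1 / (2 ^ l * (l.factorial : ℝ))) * derivative^[l] (rodrigues l) := rfl

/-- Moving all `l` derivatives to the other factor leaves the `2l`-th derivative of a monic
polynomial of degree `2l`, a constant, times the integral of `polyInt_rodrigues`. -/
theorem polyInt_legendre_mul_self (l : ℕ) :
    polyInt (legendre l * legendre l) = 2 / (2 * l + 1) := by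
  rw [legendre_eq, mul_assoc, polyInt_C_mul, polyInt_iterate_mul l l le_rfl, Nat.sub_self,
    iterate_derivative_C_mul, ← Function.iterate_add_apply, ← two_mul,
    iterate_derivative_rodrigues_two_mul, Function.iterate_zero_apply, ← C_mul, mul_comm (rodrigues l),
    polyInt_C_mul]
  have h := polyInt_rodrigues l
  rw [Nat.factorial_succ] at h
  push_cast at h
  have h1 : ((2 * l).factorial : ℝ) ≠ 0 := by positivity
  have h2 : (l.factorial : ℝ) ≠ 0 := by positivity
  have h3 : (2 * (l : ℝ) + 1) ≠ 0 := by positivity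
  field_simp
  rw [pow_succ, pow_mul' (2 : ℝ)] at h
  linarith

/-- After `l` integrations by parts the other factor carries `l + l' > 2l'` derivatives, more than
its degree. -/
theorem polyInt_legendre_mul_of_lt {l l' : ℕ} (h : l' < l) :
    polyInt (legendre l * legendre l') = 0 := by
  rw [legendre_eq l, mul_assoc, polyInt_C_mul, polyInt_iterate_mul l l le_rfl, legendre_eq l',
    iterate_derivative_C_mul, ← Function.iterate_add_apply,
    iterate_derivative_eq_zero (p := rodrigues l') (x := l + l')
      (by rw [natDegree_rodrigues]; omega)]
  simp [polyInt]

theorem polyInt_legendre_mul_of_ne {l l' : ℕ} (h : l ≠ l') :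
    polyInt (legendre l * legendre l') = 0 := by
  rcases lt_or_gt_of_ne h with h | h
  · rw [mul_comm, polyInt_legendre_mul_of_lt h]
  · exact polyInt_legendre_mul_of_lt h

/-- The differential equation of the derivatives of `(X² - 1)^ℓ`. -/
theorem rodrigues_ode (l n : ℕ) :
    (X ^ 2 - 1) * derivative^[n + 2] (rodrigues l) +
      C (2 * (n + 1 - l) : ℝ) * X * derivative^[n + 1] (rodrigues l) +
      C ((n + 1) * (n - 2 * l) : ℝ) * derivative^[n] (rodrigues l) = 0 := by
  induction n with
  | zero =>
    -- The case `n = 0` is the derivative of this first-order equation; each further case is the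
    -- derivative of the preceding one.
    have h : (X ^ 2 - 1) * derivative (rodrigues l) = C (2 * l : ℝ) * X * rodrigues l := by
      rcases l with _ | l
      · simp [rodrigues]
      · simp only [rodrigues, derivative_pow, derivative_sub, derivative_one, derivative_X]
        simp
        ring
    have h2 := congrArg derivative h
    simp only [derivative_mul, derivative_sub, derivative_X_pow, derivative_one, derivative_C,
      derivative_X] at h2
    simp only [Function.iterate_succ_apply', Function.iterate_zero_apply]
    simp only [map_mul, map_sub, map_add, map_one, C_ofNat, map_natCast, CharP.cast_eq_zero,
      map_zero] at h2 ⊢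
    push_cast at h2 ⊢
    linear_combination h2
  | succ n ih =>
    have h2 := congrArg derivative ih
    simp only [derivative_mul, derivative_add, derivative_sub, derivative_X_pow, derivative_one,
      derivative_C, derivative_X, derivative_zero, ← Function.iterate_succ_apply'] at h2
    simp only [map_mul, map_sub, map_add, map_one, C_ofNat, map_natCast,
      Nat.cast_add, Nat.cast_one] at h2 ⊢
    push_cast at h2 ⊢
    linear_combination h2

/-- This is `rodrigues_ode` at `n = l + k`, where the last coefficient becomes `(l + k + 1) (k -
l)`. -/
theorem legendre_ode (l k : ℕ) :
    (1 - X ^ 2) * derivative^[k + 2] (legendre l) -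
      C (2 * (k + 1) : ℝ) * X * derivative^[k + 1] (legendre l) =
      -(C ((l - k) * (l + k + 1) : ℝ) * derivative^[k] (legendre l)) := by
  have h := rodrigues_ode l (l + k)
  simp only [legendre_eq, iterate_derivative_C_mul, ← Function.iterate_add_apply]
  rw [show k + 2 + l = l + k + 2 by ring, show k + 1 + l = l + k + 1 by ring, add_comm k l]
  simp only [map_mul, map_sub, map_add, map_one, C_ofNat, map_natCast,
      Nat.cast_add] at h ⊢
  linear_combination - C (1 / (2 ^ l * (l.factorial : ℝ))) * h

/-- The inner product of associated Legendre functions of the same order. -/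
def assocInt (l l' k : ℕ) : ℝ :=
  polyInt ((1 - X ^ 2) ^ k * (derivative^[k] (legendre l) * derivative^[k] (legendre l')))

/-- By `legendre_ode` in divergence form, differentiating `(1 - X ^ 2) ^ (k + 1)` times the
derivative of order `k + 1` gives back the weight and the derivative of order `k`. The weight
vanishes at the ends, so one integration by parts lowers the order, and everything reduces to `k =
0`. -/
theorem assocInt_succ (l l' k : ℕ) :
    assocInt l l' (k + 1) = (l - k) * (l + k + 1) * assocInt l l' k := by
  have h := polyInt_derivative_mul ((1 - X ^ 2) ^ (k + 1) * derivative^[k + 1] (legendre l))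
    (derivative^[k] (legendre l')) (by simp) (by simp)
  rw [← Function.iterate_succ_apply' derivative k] at h
  have e : derivative ((1 - X ^ 2) ^ (k + 1) * derivative^[k + 1] (legendre l)) =
      (1 - X ^ 2) ^ k * (-(C ((l - k) * (l + k + 1) : ℝ) * derivative^[k] (legendre l))) := by
    rw [← legendre_ode, derivative_mul, ← Function.iterate_succ_apply' derivative, derivative_pow]
    simp only [map_add, map_mul, C_ofNat, map_natCast, Nat.add_sub_cancel, Nat.cast_add,
      Nat.cast_one, map_one, derivative_sub, derivative_one, derivative_X_pow]
    ring
  rw [e] at h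
  rw [assocInt, assocInt, ← polyInt_C_mul]
  calc _ = polyInt ((1 - X ^ 2) ^ (k + 1) * derivative^[k + 1] (legendre l) *
        derivative^[k + 1] (legendre l')) := by rw [mul_assoc]
    _ = - polyInt _ := by rw [h, neg_neg]
    _ = _ := by rw [← polyInt_neg]; congr 1; ring

theorem assocInt_of_ne {l l' : ℕ} (h : l ≠ l') (k : ℕ) : assocInt l l' k = 0 := by
  induction k with
  | zero => simpa [assocInt] using polyInt_legendre_mul_of_ne h
  | succ k ih => rw [assocInt_succ, ih, mul_zero]

theorem assocInt_self (l k : ℕ) (h : k ≤ l) :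
    assocInt l l k = 2 / (2 * l + 1) * ((l + k).factorial / (l - k).factorial) := by
  induction k with
  | zero =>
    have : (l.factorial : ℝ) ≠ 0 := by positivity
    simpa [assocInt, this] using polyInt_legendre_mul_self l
  | succ k ih =>
    rw [assocInt_succ, ih (by omega), ← add_assoc, Nat.factorial_succ,
      show l - k = (l - (k + 1)) + 1 by omega, Nat.factorial_succ]
    have h1 : ((l - (k + 1) : ℕ) : ℝ) = l - k - 1 := by
      rw [Nat.cast_sub h]; push_cast; ring
    have h2 : ((l - (k + 1)).factorial : ℝ) ≠ 0 := by positivity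
    have h3 : (l : ℝ) - k ≠ 0 := by
      have : (k : ℝ) + 1 ≤ l := by exact_mod_cast h
      intro h0; linarith
    push_cast
    rw [h1, show (l : ℝ) - k - 1 + 1 = l - k by ring]
    field_simp

/-- In Leibniz' rule for `(X - 1) ^ l * (X + 1) ^ l`, only the term with all `l` derivatives on the
first factor survives at `1`. -/
theorem legendre_eval_one (l : ℕ) : (legendre l).eval 1 = 1 := by
  have e : rodrigues l = (X - C 1) ^ l * (X + C 1) ^ l := by
    rw [rodrigues, ← mul_pow]; congr 1; simp; ring
  rw [legendre_eq, e, iterate_derivative_mul, eval_mul, eval_finsetSum,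
    Finset.sum_eq_single 0]
  · rw [Nat.sub_zero, iterate_derivative_X_sub_pow_self]
    simp
    have : (l.factorial : ℝ) ≠ 0 := by positivity
    field_simp
    norm_num
  · intro k hk h0
    rw [iterate_derivative_X_sub_pow]
    have : l - (l - k) ≠ 0 := by
      have := Finset.mem_range.1 hk
      omega
    simp [this]
  · simp

theorem natDegree_iterate_derivative_legendre (l k : ℕ) :
    (derivative^[k] (legendre l)).natDegree ≤ l - k := by
  rw [legendre_eq, iterate_derivative_C_mul, ← Function.iterate_add_apply]
  refine (natDegree_C_mul_le _ _).trans ((natDegree_iterate_derivative _ _).trans ?_)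
  rw [natDegree_rodrigues]; omega

theorem coeff_iterate_derivative_legendre (l k : ℕ) (h : k ≤ l) :
    (derivative^[k] (legendre l)).coeff (l - k) ≠ 0 := by
  rw [legendre_eq, iterate_derivative_C_mul, ← Function.iterate_add_apply, coeff_C_mul,
    coeff_iterate_derivative, show l - k + (k + l) = 2 * l by omega]
  have := monic_rodrigues l
  rw [Monic, leadingCoeff, natDegree_rodrigues] at this
  rw [this]
  have h2 : (2 * l).descFactorial (k + l) ≠ 0 := by
    rw [Ne, Nat.descFactorial_eq_zero_iff_lt]; omega
  have h3 : (l.factorial : ℝ) ≠ 0 := by positivity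
  simp [h2, h3]

/-- The `i`-th polynomial of the family has degree exactly `i`, so the family is triangular and
leading terms can be removed one after another. -/
theorem mem_span_iterate_derivative_legendre (k n : ℕ) (p : ℝ[X]) (hp : p.natDegree ≤ n) :
    p ∈ Submodule.span ℝ {q : ℝ[X] | ∃ i ≤ n, q = derivative^[k] (legendre (k + i))} := by
  induction n generalizing p with
  | zero =>
    have h1 := natDegree_iterate_derivative_legendre (k + 0) k
    have h2 := coeff_iterate_derivative_legendre (k + 0) k (by omega)
    simp only [add_zero, le_refl, tsub_eq_zero_of_le] at h1 h2
    set q := derivative^[k] (legendre k) with hq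
    have : p = (p.coeff 0 / q.coeff 0) • q := by
      rw [eq_C_of_natDegree_le_zero h1, eq_C_of_natDegree_le_zero hp, smul_C]
      simp [h2]
    rw [this]
    exact Submodule.smul_mem _ _ (Submodule.subset_span ⟨0, le_rfl, by simp [hq]⟩)
  | succ n ih =>
    have h1 := natDegree_iterate_derivative_legendre (k + (n + 1)) k
    have h2 := coeff_iterate_derivative_legendre (k + (n + 1)) k (by omega)
    rw [show k + (n + 1) - k = n + 1 by omega] at h1 h2
    set q := derivative^[k] (legendre (k + (n + 1))) with hq
    have hd : (p - (p.coeff (n + 1) / q.coeff (n + 1)) • q).natDegree ≤ n := by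
      rw [natDegree_le_iff_coeff_eq_zero]
      intro N hN
      rcases (show n + 1 = N ∨ n + 1 < N by omega) with h | hN'
      · rw [← h]; simp [h2]
      · have e1 := coeff_eq_zero_of_natDegree_lt (lt_of_le_of_lt hp hN')
        have e2 := coeff_eq_zero_of_natDegree_lt (lt_of_le_of_lt h1 hN')
        simp [e1, e2]
    have h3 := ih _ hd
    have h4 : Submodule.span ℝ {q : ℝ[X] | ∃ i ≤ n, q = derivative^[k] (legendre (k + i))} ≤
        Submodule.span ℝ {q : ℝ[X] | ∃ i ≤ n + 1, q = derivative^[k] (legendre (k + i))} :=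
      Submodule.span_mono fun q ⟨i, hi, e⟩ => ⟨i, by omega, e⟩
    have h5 := Submodule.add_mem _ (h4 h3) (Submodule.smul_mem _ (p.coeff (n + 1) / q.coeff (n + 1))
      (Submodule.subset_span (show q ∈ {q : ℝ[X] | ∃ i ≤ n + 1, q = derivative^[k] (legendre (k + i))}
        from ⟨n + 1, le_rfl, hq⟩)))
    simpa using h5

end SphereTime

/-! ### Rotations of the sphere and coordinates adapted to the vertical axis -/

namespace SphereTime

/-- The rotation `g` as a linear isometry of the Euclidean space. -/
def rotationIsometry (g : Matrix.specialOrthogonalGroup (Fin 3) ℝ) :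
    EuclideanSpace ℝ (Fin 3) ≃ₗᵢ[ℝ] EuclideanSpace ℝ (Fin 3) :=
  LinearIsometry.toLinearIsometryEquiv
    { toLinearMap := Matrix.toEuclideanLin (g : Matrix (Fin 3) (Fin 3) ℝ)
      norm_map' := norm_rotate g } rfl

theorem coe_rotate (g : Matrix.specialOrthogonalGroup (Fin 3) ℝ) (x : S2) :
    (rotate g x : EuclideanSpace ℝ (Fin 3)) = rotationIsometry g x := rfl

theorem continuous_rotate (g : Matrix.specialOrthogonalGroup (Fin 3) ℝ) :
    Continuous (rotate g) :=
  Continuous.subtype_mk ((rotationIsometry g).continuous.comp continuous_subtype_val) _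

theorem inner_rotate (g : Matrix.specialOrthogonalGroup (Fin 3) ℝ) (x y : S2) :
    inner ℝ (rotate g x : EuclideanSpace ℝ (Fin 3)) (rotate g y : EuclideanSpace ℝ (Fin 3)) =
      inner ℝ (x : EuclideanSpace ℝ (Fin 3)) (y : EuclideanSpace ℝ (Fin 3)) := by
  rw [coe_rotate, coe_rotate, LinearIsometryEquiv.inner_map_map]

theorem rotate_rotate (g h : Matrix.specialOrthogonalGroup (Fin 3) ℝ) (x : S2) :
    rotate g (rotate h x) = rotate (g * h) x := by
  apply Subtype.ext
  simp [rotate, Matrix.mulVec_mulVec]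

theorem rotate_one (x : S2) : rotate 1 x = x := by
  apply Subtype.ext
  simp [rotate]

-- `toSphere` measures a set through the volume of the cone over it. A rotation carries cones to
-- cones and, being a linear isometry, preserves volume.
open scoped Pointwise in
theorem measurePreserving_rotate (g : Matrix.specialOrthogonalGroup (Fin 3) ℝ) :
    MeasurePreserving (rotate g) surface surface := by
  refine ⟨(continuous_rotate g).measurable, ?_⟩
  ext s hs
  rw [Measure.map_apply (continuous_rotate g).measurable hs, surface,
    Measure.toSphere_apply' _ ((continuous_rotate g).measurable hs), Measure.toSphere_apply' _ hs]
  congr 1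
  have h := (rotationIsometry g).measurePreserving.measure_preimage_equiv
    (f := (rotationIsometry g).toMeasurableEquiv)
    (Set.Ioo (0 : ℝ) 1 • ((fun x : S2 => (x : EuclideanSpace ℝ (Fin 3))) '' s))
  rw [← h]
  congr 1
  ext v
  simp only [Set.mem_smul, Set.mem_image, Set.mem_preimage]
  constructor
  · rintro ⟨r, hr, _, ⟨x, hx, rfl⟩, rfl⟩
    refine ⟨r, hr, _, ⟨rotate g x, hx, rfl⟩, ?_⟩
    rw [coe_rotate]
    exact ((rotationIsometry g).map_smul r _).symm
  · rintro ⟨r, hr, _, ⟨x, hx, rfl⟩, e⟩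
    refine ⟨r, hr, _, ⟨rotate g⁻¹ x, ?_, rfl⟩, ?_⟩
    · rw [rotate_rotate, mul_inv_cancel, rotate_one]
      exact hx
    · apply (rotationIsometry g).injective
      rw [(rotationIsometry g).map_smul, ← coe_rotate, rotate_rotate, mul_inv_cancel, rotate_one]
      exact e

theorem integral_rotate {F : Type*} [NormedAddCommGroup F] [NormedSpace ℝ F]
    (g : Matrix.specialOrthogonalGroup (Fin 3) ℝ) (f : S2 → F)
    (hf : AEStronglyMeasurable f surface) :
    ∫ x, f (rotate g x) ∂surface = ∫ x, f x ∂surface := by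
  have h := integral_map (measurePreserving_rotate g).measurable.aemeasurable (f := f)
    (by rwa [(measurePreserving_rotate g).map_eq])
  rw [← h, (measurePreserving_rotate g).map_eq]

/-- The north pole. -/
def northPole : S2 := ⟨WithLp.toLp 2 ![0, 0, 1], by
  simp [EuclideanSpace.norm_eq, Fin.sum_univ_three]⟩

/-- The rotation of angle `φ` about the vertical axis. -/
def axisRotation (φ : ℝ) : Matrix.specialOrthogonalGroup (Fin 3) ℝ :=
  ⟨!![Real.cos φ, -Real.sin φ, 0; Real.sin φ, Real.cos φ, 0; 0, 0, 1], by
    rw [Matrix.mem_specialOrthogonalGroup_iff, Matrix.mem_orthogonalGroup_iff]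
    have h := Real.cos_sq_add_sin_sq φ
    constructor
    · ext i j
      fin_cases i <;> fin_cases j <;>
        simp [Matrix.mul_apply, Fin.sum_univ_three] <;> linarith
    · simp [Matrix.det_fin_three]; linarith⟩

theorem axisRotation_northPole (φ : ℝ) : rotate (axisRotation φ) northPole = northPole := by
  apply Subtype.ext
  ext i
  fin_cases i <;>
    simp [rotate, axisRotation, northPole]

/-- The complex coordinate `x₁ + i x₂`. -/
def planar (x : S2) : ℂ :=
  ((x : EuclideanSpace ℝ (Fin 3)) 0 : ℂ) + Complex.I * ((x : EuclideanSpace ℝ (Fin 3)) 1 : ℂ)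

/-- The vertical coordinate. -/
def height (x : S2) : ℝ := (x : EuclideanSpace ℝ (Fin 3)) 2

theorem continuous_planar : Continuous planar := by unfold planar; fun_prop

theorem continuous_height : Continuous height := by unfold height; fun_prop

theorem planar_axisRotation (φ : ℝ) (x : S2) :
    planar (rotate (axisRotation φ) x) = Complex.exp (φ * Complex.I) * planar x := by
  simp [planar, rotate, axisRotation, dotProduct, Fin.sum_univ_three,
    Complex.exp_mul_I]
  linear_combination (-Complex.sin φ * ((x : EuclideanSpace ℝ (Fin 3)) 1 : ℂ)) * Complex.I_sq

theorem height_axisRotation (φ : ℝ) (x : S2) :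
    height (rotate (axisRotation φ) x) = height x := by
  simp [height, rotate, axisRotation, dotProduct, Fin.sum_univ_three]

theorem coord_sq_sum (x : S2) : (x : EuclideanSpace ℝ (Fin 3)) 0 ^ 2 +
    (x : EuclideanSpace ℝ (Fin 3)) 1 ^ 2 + (x : EuclideanSpace ℝ (Fin 3)) 2 ^ 2 = 1 := by
  have h := EuclideanSpace.real_norm_sq_eq (x : EuclideanSpace ℝ (Fin 3))
  rw [mem_sphere_zero_iff_norm.1 x.2, Fin.sum_univ_three] at h
  linarith

theorem planar_mul_conj (x : S2) :
    planar x * (starRingEnd ℂ) (planar x) = ((1 - height x ^ 2 : ℝ) : ℂ) := by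
  have h := coord_sq_sum x
  rw [Complex.mul_conj, planar, height, mul_comm Complex.I, Complex.normSq_add_mul_I]
  congr 1
  linarith

theorem inner_northPole (x : S2) :
    inner ℝ (northPole : EuclideanSpace ℝ (Fin 3)) (x : EuclideanSpace ℝ (Fin 3)) = height x := by
  simp [northPole, height, PiLp.inner_apply, Fin.sum_univ_three]

/-- Rotations act transitively. -/
theorem exists_rotate_eq_northPole (x : S2) :
    ∃ g : Matrix.specialOrthogonalGroup (Fin 3) ℝ, rotate g x = northPole := by
  set a := (x : EuclideanSpace ℝ (Fin 3)) 0 with ha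
  set b := (x : EuclideanSpace ℝ (Fin 3)) 1 with hb
  set c := (x : EuclideanSpace ℝ (Fin 3)) 2 with hc
  have h : a ^ 2 + b ^ 2 + c ^ 2 = 1 := coord_sq_sum x
  by_cases hr : a ^ 2 + b ^ 2 = 0
  · have ha0 : a = 0 := by nlinarith [sq_nonneg a, sq_nonneg b]
    have hb0 : b = 0 := by nlinarith [sq_nonneg a, sq_nonneg b]
    have hc2 : c * c = 1 := by nlinarith
    -- On the axis `c = ±1`, and `diag(1, c, c)` has determinant `c ^ 2 = 1`.
    refine ⟨⟨!![1, 0, 0; 0, c, 0; 0, 0, c], ?_⟩, ?_⟩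
    · rw [Matrix.mem_specialOrthogonalGroup_iff, Matrix.mem_orthogonalGroup_iff]
      constructor
      · ext i j
        fin_cases i <;> fin_cases j <;>
          simp [Matrix.mul_apply, Fin.sum_univ_three, hc2]
      · simp [Matrix.det_fin_three, hc2]
    · apply Subtype.ext
      ext i
      fin_cases i <;>
        simp [rotate, northPole, dotProduct, Fin.sum_univ_three, ← ha, ← hb, ← hc,
          ha0, hb0, hc2]
  · set r := Real.sqrt (a ^ 2 + b ^ 2) with hrdef
    have hr2 : r ^ 2 = a ^ 2 + b ^ 2 := Real.sq_sqrt (by positivity)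
    have hr0 : r ≠ 0 := by
      intro h0
      rw [h0] at hr2
      exact hr (by linarith)
    -- The rows form a positively oriented orthonormal frame whose last vector is `x` itself, so `x`
    -- goes to the third basis vector; `r` is the distance from `x` to the axis.
    refine ⟨⟨!![a * c / r, b * c / r, -r; -b / r, a / r, 0; a, b, c], ?_⟩, ?_⟩
    · rw [Matrix.mem_specialOrthogonalGroup_iff, Matrix.mem_orthogonalGroup_iff]
      have hc2 : c ^ 2 = 1 - r ^ 2 := by linarith
      have hb2 : b ^ 2 = r ^ 2 - a ^ 2 := by linarith
      constructor
      · ext i j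
        fin_cases i <;> fin_cases j <;>
          simp [Matrix.mul_apply, Fin.sum_univ_three] <;>
          field_simp <;> ring_nf <;> (try simp only [hc2, hb2]) <;> ring
      · simp [Matrix.det_fin_three]
        field_simp
        ring_nf
        have hc4 : c ^ 2 = 1 - r ^ 2 := hc2
        simp only [hc2, hb2]
        ring
    · apply Subtype.ext
      ext i
      fin_cases i <;>
        simp [rotate, northPole, dotProduct, Fin.sum_univ_three, ← ha, ← hb, ← hc]
      · field_simp
        rw [hr2]
        ring
      · field_simp
        ring
      · linarith

end SphereTime

/-! ### Integrals of polynomials in the height -/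

namespace SphereTime

/-- Both sides are the integral of `x 2 ^ n * exp (-‖x‖ ^ 2)` over the whole space, in polar and in
Cartesian coordinates. The radial exponent is `n` from homogeneity plus `2` from the density of the
radius. -/
theorem integral_height_pow_mul_radial (n : ℕ) :
    (∫ x, height x ^ n ∂surface) *
        ∫ r in Set.Ioi (0 : ℝ), r ^ (n + 2) * Real.exp (-r ^ 2) =
      Real.pi * ∫ t : ℝ, t ^ n * Real.exp (-t ^ 2) := by
  set F : EuclideanSpace ℝ (Fin 3) → ℝ := fun x => x 2 ^ n * Real.exp (-‖x‖ ^ 2) with hF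
  have h1 : ∫ x, F x = Real.pi * ∫ t : ℝ, t ^ n * Real.exp (-t ^ 2) := by
    have hg : ∫ t : ℝ, Real.exp (-t ^ 2) = Real.sqrt Real.pi := by
      simpa using integral_gaussian 1
    have hp := (PiLp.volume_preserving_ofLp (Fin 3)).integral_comp
      (MeasurableEquiv.toLp 2 (Fin 3 → ℝ)).symm.measurableEmbedding
      (fun y : Fin 3 → ℝ => ∏ i, (![fun t => Real.exp (-t ^ 2), fun t => Real.exp (-t ^ 2),
        fun t => t ^ n * Real.exp (-t ^ 2)] i : ℝ → ℝ) (y i))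
    rw [integral_fintype_prod_volume_eq_prod] at hp
    simp only [Fin.prod_univ_three, Matrix.cons_val_zero, Matrix.cons_val_one,
      Matrix.cons_val_two, Matrix.tail_cons, Matrix.head_cons, hg] at hp
    rw [Real.mul_self_sqrt Real.pi_nonneg] at hp
    rw [← hp]
    congr 1
    ext x
    rw [hF]
    simp only
    rw [EuclideanSpace.real_norm_sq_eq, Fin.sum_univ_three,
      show -(x.ofLp 0 ^ 2 + x.ofLp 1 ^ 2 + x.ofLp 2 ^ 2) =
        -x.ofLp 0 ^ 2 + -x.ofLp 1 ^ 2 + -x.ofLp 2 ^ 2 by ring, Real.exp_add, Real.exp_add]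
    ring
  rw [← h1]
  symm
  calc ∫ x, F x = ∫ x : ({(0)}ᶜ : Set (EuclideanSpace ℝ (Fin 3))), F x
          ∂(volume.comap Subtype.val) := by
        rw [integral_subtype_comap (measurableSet_singleton _).compl F,
          restrict_compl_singleton]
    _ = ∫ z : S2 × Set.Ioi (0 : ℝ), height z.1 ^ n * ((z.2 : ℝ) ^ n * Real.exp (-(z.2 : ℝ) ^ 2))
          ∂(surface.prod (.volumeIoiPow
            (Module.finrank ℝ (EuclideanSpace ℝ (Fin 3)) - 1))) := by
        rw [surface, ← (volume : Measure (EuclideanSpace ℝ (Fin 3)))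
          |>.measurePreserving_homeomorphUnitSphereProd.integral_comp
          (Homeomorph.measurableEmbedding _)]
        refine integral_congr_ae (Eventually.of_forall fun x => ?_)
        have hx : ‖(x : EuclideanSpace ℝ (Fin 3))‖ ≠ 0 := norm_ne_zero_iff.2 x.2
        simp only [hF, height, homeomorphUnitSphereProd_apply_fst_coe,
          homeomorphUnitSphereProd_apply_snd_coe]
        rw [← mul_assoc, ← mul_pow]
        congr 2
        simp
        field_simp
    _ = _ := by
        rw [integral_prod_mul (fun x : S2 => height x ^ n)
          (fun r : Set.Ioi (0 : ℝ) => (r : ℝ) ^ n * Real.exp (-(r : ℝ) ^ 2))]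
        congr 1
        simp only [Measure.volumeIoiPow, ENNReal.ofReal, finrank_euclideanSpace_fin]
        rw [integral_withDensity_eq_integral_smul,
          integral_subtype_comap measurableSet_Ioi fun a : ℝ => Real.toNNReal (a ^ (3 - 1)) •
            (a ^ n * Real.exp (-a ^ 2)), setIntegral_congr_fun measurableSet_Ioi fun x hx => ?_]
        · rw [NNReal.smul_def, Real.coe_toNNReal _ (pow_nonneg (Set.mem_Ioi.1 hx).le _), smul_eq_mul]
          ring
        · exact (measurable_subtype_coe.pow_const _).real_toNNReal

theorem integral_Ioi_pow_mul_exp_neg_sq (n : ℕ) :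
    ∫ r in Set.Ioi (0 : ℝ), r ^ n * Real.exp (-r ^ 2) =
      1 / 2 * Real.Gamma (((n : ℝ) + 1) / 2) := by
  have h := integral_rpow_mul_exp_neg_rpow (p := 2) (q := n) (by norm_num)
    (by have : (0 : ℝ) ≤ n := n.cast_nonneg; linarith)
  simpa using h

/-- For even `n` both Gaussian integrals are Gamma values, and `Γ(s + 1) = s Γ(s)` gives their
quotient; for odd `n` both sides vanish by symmetry. -/
theorem integral_height_pow (n : ℕ) :
    ∫ x, height x ^ n ∂surface = 2 * Real.pi * ∫ t in (-1 : ℝ)..1, t ^ n := by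
  have h := integral_height_pow_mul_radial n
  have hpos : 0 < Real.Gamma (((n : ℝ) + 1) / 2) := Real.Gamma_pos_of_pos (by positivity)
  rw [integral_Ioi_pow_mul_exp_neg_sq] at h
  have hG : Real.Gamma ((((n + 2 : ℕ) : ℝ) + 1) / 2) =
      ((n : ℝ) + 1) / 2 * Real.Gamma (((n : ℝ) + 1) / 2) := by
    rw [← Real.Gamma_add_one (by positivity)]
    congr 1
    push_cast
    ring
  rw [hG] at h
  rcases Nat.even_or_odd n with hn | hn
  · have hA : ∫ t : ℝ, t ^ n * Real.exp (-t ^ 2) = Real.Gamma (((n : ℝ) + 1) / 2) := by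
      have h2 := integral_comp_abs (f := fun t : ℝ => t ^ n * Real.exp (-t ^ 2))
      simp only [hn.pow_abs, sq_abs] at h2
      rw [h2, integral_Ioi_pow_mul_exp_neg_sq]
      ring
    rw [hA] at h
    rw [integral_pow, hn.add_one.neg_one_pow, one_pow]
    have hn1 : (n : ℝ) + 1 ≠ 0 := by positivity
    field_simp at h ⊢
    linarith
  · have hA : ∫ t : ℝ, t ^ n * Real.exp (-t ^ 2) = 0 := by
      have h2 := integral_neg_eq_self (fun t : ℝ => t ^ n * Real.exp (-t ^ 2)) volume
      simp only [hn.neg_pow, neg_sq, neg_mul, integral_neg] at h2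
      linarith
    rw [hA, mul_zero] at h
    rw [integral_pow, hn.add_one.neg_one_pow]
    have hn1 : (n : ℝ) + 1 ≠ 0 := by positivity
    have := (mul_eq_zero.1 h).resolve_right (by positivity)
    simp [this]

/-- Archimedes' theorem for polynomials in the height. -/
theorem integral_eval_height (p : Polynomial ℝ) :
    ∫ x, p.eval (height x) ∂surface = 2 * Real.pi * polyInt p := by
  induction p using Polynomial.induction_on' with
  | add p q hp hq =>
    simp only [Polynomial.eval_add, polyInt_add, mul_add, ← hp, ← hq]
    exact integral_add
      ((p.continuous.comp continuous_height).integrable_of_hasCompactSupport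
        (HasCompactSupport.of_compactSpace _))
      ((q.continuous.comp continuous_height).integrable_of_hasCompactSupport
        (HasCompactSupport.of_compactSpace _))
  | monomial n a =>
    simp only [Polynomial.eval_monomial, polyInt, integral_const_mul, integral_height_pow,
      intervalIntegral.integral_const_mul]
    ring

end SphereTime

/-! ### Spherical harmonics: symmetries and orthonormality -/

namespace SphereTime

open scoped ComplexConjugate

/-- The normalising constant of the spherical harmonics. -/
def harmonicConst (l k : ℕ) : ℝ :=
  Real.sqrt ((2 * (l : ℝ) + 1) / (4 * Real.pi) *
    (((l - k).factorial : ℝ) / ((l + k).factorial : ℝ)))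

theorem harmonicConst_pos (l k : ℕ) : 0 < harmonicConst l k := by
  have := Real.pi_pos
  exact Real.sqrt_pos.2 (by positivity)

theorem harmonicConst_sq (l k : ℕ) : harmonicConst l k * harmonicConst l k =
    (2 * (l : ℝ) + 1) / (4 * Real.pi) * (((l - k).factorial : ℝ) / ((l + k).factorial : ℝ)) := by
  have := Real.pi_pos
  exact Real.mul_self_sqrt (by positivity)

theorem sphericalHarmonicNonneg_eq (l k : ℕ) (x : S2) :
    sphericalHarmonicNonneg l k x = (-1) ^ k * (harmonicConst l k : ℂ) * planar x ^ k *
      (((Polynomial.derivative^[k] (legendre l)).eval (height x) : ℝ) : ℂ) := rfl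

theorem mem_orders {l : ℕ} {m : ℤ} : m ∈ orders l ↔ m.natAbs ≤ l := by
  rw [orders, Finset.mem_Icc]; omega

theorem neg_mem_orders {l : ℕ} {m : ℤ} (h : m ∈ orders l) : -m ∈ orders l := by
  rw [mem_orders] at *; omega

theorem zero_mem_orders (l : ℕ) : (0 : ℤ) ∈ orders l := by simp [mem_orders]

theorem continuous_sphericalHarmonicNonneg (l k : ℕ) :
    Continuous (sphericalHarmonicNonneg l k) := by
  have h : sphericalHarmonicNonneg l k = fun x => (-1) ^ k * (harmonicConst l k : ℂ) *
      planar x ^ k *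
      (((Polynomial.derivative^[k] (legendre l)).eval (height x) : ℝ) : ℂ) := rfl
  rw [h]
  exact (continuous_const.mul (continuous_planar.pow k)).mul
    (Complex.continuous_ofReal.comp ((Polynomial.continuous _).comp continuous_height))

theorem continuous_sphericalHarmonic (l : ℕ) (m : ℤ) : Continuous (sphericalHarmonic l m) := by
  unfold sphericalHarmonic
  split_ifs
  · exact continuous_sphericalHarmonicNonneg l _
  · exact continuous_const.mul (Complex.continuous_conj.comp
      (continuous_sphericalHarmonicNonneg l _))

theorem sphericalHarmonic_natCast (l k : ℕ) (x : S2) :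
    sphericalHarmonic l k x = sphericalHarmonicNonneg l k x := by
  simp [sphericalHarmonic]

theorem conj_sphericalHarmonicNonneg_zero (l : ℕ) (x : S2) :
    conj (sphericalHarmonicNonneg l 0 x) = sphericalHarmonicNonneg l 0 x := by
  rw [sphericalHarmonicNonneg_eq]
  simp

theorem conj_sphericalHarmonic (l : ℕ) (m : ℤ) (x : S2) :
    conj (sphericalHarmonic l m x) = (-1) ^ m.natAbs * sphericalHarmonic l (-m) x := by
  have h1 : ((-1 : ℂ) ^ m.natAbs) * (-1) ^ m.natAbs = 1 := by
    rw [← mul_pow]; simp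
  rcases lt_trichotomy m 0 with h | h | h
  · rw [sphericalHarmonic, sphericalHarmonic, if_neg (by omega), if_pos (by omega)]
    simp
  · subst h
    simp [sphericalHarmonic, conj_sphericalHarmonicNonneg_zero]
  · rw [sphericalHarmonic, sphericalHarmonic, if_pos (by omega), if_neg (by omega), Int.natAbs_neg,
      ← mul_assoc, h1, one_mul]

theorem sphericalHarmonicNonneg_axisRotation (l k : ℕ) (φ : ℝ) (x : S2) :
    sphericalHarmonicNonneg l k (rotate (axisRotation φ) x) =
      Complex.exp ((k * φ : ℝ) * Complex.I) * sphericalHarmonicNonneg l k x := by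
  rw [sphericalHarmonicNonneg_eq, sphericalHarmonicNonneg_eq, planar_axisRotation,
    height_axisRotation, mul_pow, ← Complex.exp_nat_mul]
  push_cast
  rw [mul_assoc (k : ℂ)]
  ring

theorem sphericalHarmonic_axisRotation (l : ℕ) (m : ℤ) (φ : ℝ) (x : S2) :
    sphericalHarmonic l m (rotate (axisRotation φ) x) =
      Complex.exp ((m * φ : ℝ) * Complex.I) * sphericalHarmonic l m x := by
  unfold sphericalHarmonic
  split_ifs with h
  · rw [sphericalHarmonicNonneg_axisRotation]
    congr 4
    rw [← Int.cast_natCast (R := ℝ), Int.natAbs_of_nonneg h]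
  · rw [sphericalHarmonicNonneg_axisRotation, map_mul, ← Complex.exp_conj]
    have e : ((m.natAbs : ℕ) : ℝ) = -(m : ℝ) := by
      rw [← Int.cast_natCast (R := ℝ), Int.ofNat_natAbs_of_nonpos (by omega)]
      push_cast; ring
    rw [e]
    simp
    ring

theorem integrable_of_continuous {F : Type*} [NormedAddCommGroup F] {f : S2 → F}
    (hf : Continuous f) : Integrable f surface :=
  hf.integrable_of_hasCompactSupport (HasCompactSupport.of_compactSpace _)

/-- By invariance of the surface measure the integral is its own negative. A function that picks up
`e ^ (i n φ)` with `n ≠ 0` is covered by the angle `π / n`. -/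
theorem integral_eq_zero_of_axisRotation {f : S2 → ℂ} (hf : AEStronglyMeasurable f surface) (φ : ℝ)
    (h : ∀ x, f (rotate (axisRotation φ) x) = -f x) : ∫ x, f x ∂surface = 0 := by
  have h1 := integral_rotate (axisRotation φ) f hf
  simp only [h, integral_neg] at h1
  exact self_eq_neg.1 h1.symm

theorem exp_int_mul_pi_div {n : ℤ} (h : n ≠ 0) :
    Complex.exp ((n * (Real.pi / n) : ℝ) * Complex.I) = -1 := by
  have : (n : ℝ) ≠ 0 := by exact_mod_cast h
  rw [mul_div_cancel₀ _ this, Complex.exp_pi_mul_I]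

/-- The phases cancel and `planar_mul_conj` turns the modulus into `1 - height ^ 2`. What remains is
a polynomial in the height, within reach of `integral_eval_height`. -/
theorem sphericalHarmonic_mul_conj_same_order (l l' : ℕ) (m : ℤ) (x : S2) :
    sphericalHarmonic l m x * conj (sphericalHarmonic l' m x) =
      ((harmonicConst l m.natAbs * harmonicConst l' m.natAbs *
        Polynomial.eval (height x) ((1 - Polynomial.X ^ 2) ^ m.natAbs *
          (Polynomial.derivative^[m.natAbs] (legendre l) *
            Polynomial.derivative^[m.natAbs] (legendre l'))) : ℝ) : ℂ) := by
  have key : ∀ k, sphericalHarmonicNonneg l k x * conj (sphericalHarmonicNonneg l' k x) =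
      ((harmonicConst l k * harmonicConst l' k *
        Polynomial.eval (height x) ((1 - Polynomial.X ^ 2) ^ k *
          (Polynomial.derivative^[k] (legendre l) *
            Polynomial.derivative^[k] (legendre l'))) : ℝ) : ℂ) := by
    intro k
    have h1 : ((-1 : ℂ) ^ k) * (-1) ^ k = 1 := by
      rw [← mul_pow]; simp
    have h := planar_mul_conj x
    simp only [sphericalHarmonicNonneg_eq, map_mul, map_pow, map_neg, map_one, Complex.conj_ofReal,
      Polynomial.eval_mul, Polynomial.eval_pow, Polynomial.eval_sub, Polynomial.eval_one,
      Polynomial.eval_X, Complex.ofReal_mul, Complex.ofReal_pow]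
    rw [← h, mul_pow]
    linear_combination (harmonicConst l k * harmonicConst l' k * (planar x ^ k *
      conj (planar x) ^ k * ((((Polynomial.derivative^[k] (legendre l)).eval (height x) : ℝ) : ℂ) *
      (((Polynomial.derivative^[k] (legendre l')).eval (height x) : ℝ) : ℂ)))) * h1
  unfold sphericalHarmonic
  split_ifs with h
  · exact key _
  · have h1 : ((-1 : ℂ) ^ m.natAbs) * (-1) ^ m.natAbs = 1 := by
      rw [← mul_pow]; simp
    rw [← Complex.conj_ofReal, ← key, map_mul, map_mul]
    simp only [map_pow, map_neg, map_one, Complex.conj_conj]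
    linear_combination (conj (sphericalHarmonicNonneg l m.natAbs x) *
      sphericalHarmonicNonneg l' m.natAbs x) * h1

/-- The spherical harmonics are orthonormal. -/
theorem integral_sphericalHarmonic_mul_conj {l l' : ℕ} {m m' : ℤ} (hm : m ∈ orders l) :
    ∫ x, sphericalHarmonic l m x * conj (sphericalHarmonic l' m' x) ∂surface =
      if l = l' ∧ m = m' then 1 else 0 := by
  by_cases h : m = m'
  · subst h
    simp only [sphericalHarmonic_mul_conj_same_order, and_true]
    rw [integral_complex_ofReal, integral_const_mul, integral_eval_height]
    change ((_ * (_ * assocInt l l' m.natAbs) : ℝ) : ℂ) = _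
    split_ifs with hl
    · subst hl
      rw [assocInt_self _ _ (mem_orders.1 hm), harmonicConst_sq]
      have h1 : ((l - m.natAbs).factorial : ℝ) ≠ 0 := by positivity
      have h2 : ((l + m.natAbs).factorial : ℝ) ≠ 0 := by positivity
      have := Real.pi_ne_zero
      rw [← Complex.ofReal_one]
      congr 1
      field_simp
      norm_num
    · rw [assocInt_of_ne hl]
      simp
  · rw [if_neg (fun hh => h hh.2)]
    -- The product picks up the phase `e ^ (i (m - m') φ)`, which is `-1` at this angle.
    refine integral_eq_zero_of_axisRotation (Continuous.aestronglyMeasurable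
      ((continuous_sphericalHarmonic l m).mul
        (Complex.continuous_conj.comp (continuous_sphericalHarmonic l' m'))))
      (Real.pi / (m - m' : ℤ)) fun x => ?_
    rw [sphericalHarmonic_axisRotation, sphericalHarmonic_axisRotation, map_mul, ← Complex.exp_conj]
    have e := exp_int_mul_pi_div (sub_ne_zero.2 h)
    generalize Real.pi / ((m - m' : ℤ) : ℝ) = φ at e
    have e2 : Complex.exp ((m * φ : ℝ) * Complex.I) *
        Complex.exp (conj ((m' * φ : ℝ) * Complex.I)) = -1 := by
      rw [← e, ← Complex.exp_add]
      congr 1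
      simp
      ring
    linear_combination (sphericalHarmonic l m x * conj (sphericalHarmonic l' m' x)) * e2

end SphereTime

/-! ### Harmonics as polynomials, rotation invariance and the addition formula -/

namespace SphereTime

open scoped ComplexConjugate

/-- The span of the spherical harmonics of degree at most `L`. -/
def harmonicSpan (L : ℕ) : Submodule ℂ (S2 → ℂ) :=
  Submodule.span ℂ {f | ∃ l ≤ L, ∃ m ∈ orders l, f = sphericalHarmonic l m}

/-- The affine functions on the sphere. -/
def affineSpan : Submodule ℂ (S2 → ℂ) :=
  Submodule.span ℂ {1, planar, fun x => conj (planar x), fun x => (height x : ℂ)}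

theorem sphericalHarmonic_mem_harmonicSpan {L l : ℕ} {m : ℤ} (hl : l ≤ L) (hm : m ∈ orders l) :
    sphericalHarmonic l m ∈ harmonicSpan L :=
  Submodule.subset_span ⟨l, hl, m, hm, rfl⟩

theorem conj_mem_harmonicSpan {L : ℕ} {f : S2 → ℂ} (hf : f ∈ harmonicSpan L) :
    (fun x => conj (f x)) ∈ harmonicSpan L := by
  induction hf using Submodule.span_induction with
  | mem f hf =>
    obtain ⟨l, hl, m, hm, rfl⟩ := hf
    have : (fun x => conj (sphericalHarmonic l m x)) =
        ((-1 : ℂ) ^ m.natAbs) • sphericalHarmonic l (-m) := by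
      ext x
      rw [conj_sphericalHarmonic]
      rfl
    rw [this]
    exact Submodule.smul_mem _ _ (sphericalHarmonic_mem_harmonicSpan hl (neg_mem_orders hm))
  | zero =>
    convert (harmonicSpan L).zero_mem using 1
    ext x
    simp
  | add f g _ _ hf hg =>
    convert (harmonicSpan L).add_mem hf hg using 1
    ext x
    simp
  | smul c f _ hf =>
    convert (harmonicSpan L).smul_mem (conj c) hf using 1
    ext x
    simp

/-- A harmonic of order `k` is a multiple of `planar ^ k` times the `k`-th derivative of a Legendre
polynomial, and by `mem_span_iterate_derivative_legendre` these derivatives span the polynomials in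
the height, degree by degree. -/
theorem planar_pow_mul_eval_mem {L k : ℕ} {p : Polynomial ℝ} (h : k + p.natDegree ≤ L) :
    (fun x => planar x ^ k * ((p.eval (height x) : ℝ) : ℂ)) ∈ harmonicSpan L := by
  have hp := mem_span_iterate_derivative_legendre k p.natDegree p le_rfl
  have key : ∀ q ∈ Submodule.span ℝ {q : Polynomial ℝ | ∃ i ≤ p.natDegree,
      q = Polynomial.derivative^[k] (legendre (k + i))},
      (fun x => planar x ^ k * ((q.eval (height x) : ℝ) : ℂ)) ∈ harmonicSpan L := by
    intro q hq
    induction hq using Submodule.span_induction with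
    | mem q hq =>
      obtain ⟨i, hi, rfl⟩ := hq
      have hc : (harmonicConst (k + i) k : ℂ) ≠ 0 := by
        exact_mod_cast (harmonicConst_pos _ _).ne'
      have : (fun x => planar x ^ k *
          (((Polynomial.derivative^[k] (legendre (k + i))).eval (height x) : ℝ) : ℂ)) =
          ((-1 : ℂ) ^ k * (harmonicConst (k + i) k : ℂ))⁻¹ • sphericalHarmonic (k + i) k := by
        ext x
        have h1 : ((-1 : ℂ) ^ k) ≠ 0 := by simp
        rw [Pi.smul_apply, sphericalHarmonic_natCast, sphericalHarmonicNonneg_eq, smul_eq_mul]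
        field_simp
      rw [this]
      exact Submodule.smul_mem _ _ (sphericalHarmonic_mem_harmonicSpan (by omega)
        (by rw [mem_orders]; simp))
    | zero =>
      convert (harmonicSpan L).zero_mem using 1
      ext x
      simp
    | add f g _ _ hf hg =>
      convert (harmonicSpan L).add_mem hf hg using 1
      ext x
      simp [mul_add]
    | smul c f _ hf =>
      convert (harmonicSpan L).smul_mem (c : ℂ) hf using 1
      ext x
      simp
      ring
  exact key p hp

theorem planar_pow_mul_height_pow_mem {L k c : ℕ} (h : k + c ≤ L) :
    (fun x => planar x ^ k * (height x : ℂ) ^ c) ∈ harmonicSpan L := by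
  have := planar_pow_mul_eval_mem (L := L) (k := k) (p := Polynomial.X ^ c) (by simpa using h)
  simpa using this

theorem conj_planar_pow_mul_height_pow_mem {L k c : ℕ} (h : k + c ≤ L) :
    (fun x => conj (planar x) ^ k * (height x : ℂ) ^ c) ∈ harmonicSpan L := by
  have := conj_mem_harmonicSpan (planar_pow_mul_height_pow_mem h)
  simpa using this

/-- Monomials in the reduced coordinates. -/
def reducedSpan (L : ℕ) : Submodule ℂ (S2 → ℂ) :=
  Submodule.span ℂ {f | ∃ k c : ℕ, k + c ≤ L ∧ ((f = fun x => planar x ^ k * (height x : ℂ) ^ c) ∨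
    (f = fun x => conj (planar x) ^ k * (height x : ℂ) ^ c))}

theorem reducedSpan_le_harmonicSpan (L : ℕ) : reducedSpan L ≤ harmonicSpan L := by
  refine Submodule.span_le.2 ?_
  rintro f ⟨k, c, h, rfl | rfl⟩
  · exact planar_pow_mul_height_pow_mem h
  · exact conj_planar_pow_mul_height_pow_mem h

/-- Mixed products are removed by `planar * conj planar = 1 - height ^ 2`, which does not raise the
degree. -/
theorem reducedSpan_mul_affineSpan_le (L : ℕ) :
    reducedSpan L * affineSpan ≤ reducedSpan (L + 1) := by
  rw [reducedSpan, affineSpan, Submodule.span_mul_span, Submodule.span_le]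
  have hw : ∀ k c, k + c ≤ L + 1 → (fun x : S2 => planar x ^ k * (height x : ℂ) ^ c) ∈
      reducedSpan (L + 1) := fun k c h => Submodule.subset_span ⟨k, c, h, Or.inl rfl⟩
  have hc : ∀ k c, k + c ≤ L + 1 → (fun x : S2 => conj (planar x) ^ k * (height x : ℂ) ^ c) ∈
      reducedSpan (L + 1) := fun k c h => Submodule.subset_span ⟨k, c, h, Or.inr rfl⟩
  have e : ∀ x, planar x * conj (planar x) = 1 - (height x : ℂ) ^ 2 := fun x => by
    rw [planar_mul_conj]; push_cast; ring
  rintro _ ⟨f, ⟨k, c, h, hf⟩, g, hg, rfl⟩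
  simp only [Set.mem_insert_iff, Set.mem_singleton_iff] at hg
  change f * g ∈ reducedSpan (L + 1)
  rcases hf with rfl | rfl <;> rcases hg with rfl | rfl | rfl | rfl
  · simpa using hw k c (by omega)
  · convert hw (k + 1) c (by omega) using 1
    ext x
    simp only [Pi.mul_apply]
    ring
  · rcases k with _ | k
    · convert hc 1 c (by omega) using 1
      ext x
      simp only [Pi.mul_apply]
      ring
    · convert Submodule.sub_mem _ (hw k c (by omega)) (hw k (c + 2) (by omega)) using 1
      ext x
      simp only [Pi.mul_apply, Pi.sub_apply]
      linear_combination (planar x ^ k * (height x : ℂ) ^ c) * e x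
  · convert hw k (c + 1) (by omega) using 1
    ext x
    simp only [Pi.mul_apply]
    ring
  · simpa using hc k c (by omega)
  · rcases k with _ | k
    · convert hw 1 c (by omega) using 1
      ext x
      simp only [Pi.mul_apply]
      ring
    · convert Submodule.sub_mem _ (hc k c (by omega)) (hc k (c + 2) (by omega)) using 1
      ext x
      simp only [Pi.mul_apply, Pi.sub_apply]
      linear_combination (conj (planar x) ^ k * (height x : ℂ) ^ c) * e x
  · convert hc (k + 1) c (by omega) using 1
    ext x
    simp only [Pi.mul_apply]
    ring
  · convert hc k (c + 1) (by omega) using 1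
    ext x
    simp only [Pi.mul_apply]
    ring

theorem affineSpan_pow_le_reducedSpan (L : ℕ) : affineSpan ^ L ≤ reducedSpan L := by
  induction L with
  | zero =>
    rw [pow_zero, Submodule.one_le]
    exact Submodule.subset_span ⟨0, 0, le_rfl, Or.inl (by ext; simp)⟩
  | succ L ih =>
    rw [pow_succ]
    exact (mul_le_mul' ih le_rfl).trans (reducedSpan_mul_affineSpan_le L)

theorem one_mem_affineSpan : (1 : S2 → ℂ) ∈ affineSpan :=
  Submodule.subset_span (by simp)

theorem planar_mem_affineSpan : planar ∈ affineSpan :=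
  Submodule.subset_span (by simp)

theorem conj_planar_mem_affineSpan : (fun x => conj (planar x)) ∈ affineSpan :=
  Submodule.subset_span (by simp)

theorem height_mem_affineSpan : (fun x => (height x : ℂ)) ∈ affineSpan :=
  Submodule.subset_span (by simp)

theorem coord_mem_affineSpan (i : Fin 3) :
    (fun x : S2 => ((x : EuclideanSpace ℝ (Fin 3)) i : ℂ)) ∈ affineSpan := by
  fin_cases i
  · convert affineSpan.smul_mem (1 / 2 : ℂ)
      (affineSpan.add_mem planar_mem_affineSpan conj_planar_mem_affineSpan) using 1
    ext x
    simp [planar]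
    ring
  · convert affineSpan.smul_mem (-Complex.I / 2 : ℂ)
      (affineSpan.sub_mem planar_mem_affineSpan conj_planar_mem_affineSpan) using 1
    ext x
    simp [planar]
    linear_combination ((x : EuclideanSpace ℝ (Fin 3)) 1 : ℂ) * Complex.I_sq
  · exact height_mem_affineSpan

theorem affineSpan_pow_mono {a b : ℕ} (h : a ≤ b) : affineSpan ^ a ≤ affineSpan ^ b :=
  pow_le_pow_right' (Submodule.one_le.2 one_mem_affineSpan) h

/-- Powers of the affine functions are visibly stable under rotations and multiply well; the
explicit harmonics show neither. One inclusion is the reduction of monomials, the other counts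
degrees in `planar ^ k` times a derivative of order `k`. -/
theorem harmonicSpan_eq (L : ℕ) : harmonicSpan L = affineSpan ^ L := by
  refine le_antisymm (Submodule.span_le.2 ?_)
    ((affineSpan_pow_le_reducedSpan L).trans (reducedSpan_le_harmonicSpan L))
  have key : ∀ l ≤ L, ∀ k ≤ l, ∀ w ∈ affineSpan,
      (fun x => w x ^ k * (((Polynomial.derivative^[k] (legendre l)).eval (height x) : ℝ) : ℂ)) ∈
        affineSpan ^ L := by
    intro l hl k hk w hw
    set p := Polynomial.derivative^[k] (legendre l) with hp
    have h1 : (fun x => w x ^ k * ((p.eval (height x) : ℝ) : ℂ)) =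
        ∑ i ∈ Finset.range (p.natDegree + 1), (p.coeff i : ℂ) •
          (w ^ k * (fun x : S2 => (height x : ℂ)) ^ i) := by
      ext x
      rw [Polynomial.eval_eq_sum_range, Finset.sum_apply]
      push_cast
      rw [Finset.mul_sum]
      refine Finset.sum_congr rfl fun i _ => ?_
      simp
      ring
    rw [h1]
    refine Submodule.sum_mem _ fun i hi => Submodule.smul_mem _ _ ?_
    have hd := natDegree_iterate_derivative_legendre l k
    rw [← hp] at hd
    have hi' := Finset.mem_range.1 hi
    refine affineSpan_pow_mono (show k + i ≤ L by omega) ?_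
    rw [pow_add]
    exact Submodule.mul_mem_mul (Submodule.pow_mem_pow _ hw k)
      (Submodule.pow_mem_pow _ height_mem_affineSpan i)
  rintro f ⟨l, hl, m, hm, rfl⟩
  rw [SetLike.mem_coe]
  rcases le_or_gt 0 m with h | h
  · convert Submodule.smul_mem _ ((-1 : ℂ) ^ m.natAbs * (harmonicConst l m.natAbs : ℂ))
      (key l hl _ (mem_orders.1 hm) _ planar_mem_affineSpan) using 1
    ext x
    rw [sphericalHarmonic, if_pos h, sphericalHarmonicNonneg_eq, Pi.smul_apply, smul_eq_mul]
    ring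
  · convert Submodule.smul_mem _ ((harmonicConst l m.natAbs : ℂ))
      (key l hl _ (mem_orders.1 hm) _ conj_planar_mem_affineSpan) using 1
    ext x
    have h1 : ((-1 : ℂ) ^ m.natAbs) * (-1) ^ m.natAbs = 1 := by
      rw [← mul_pow]; simp
    rw [sphericalHarmonic, if_neg (not_le.2 h), sphericalHarmonicNonneg_eq, Pi.smul_apply,
      smul_eq_mul]
    simp only [map_mul, map_pow, map_neg, map_one, Complex.conj_ofReal]
    rw [← mul_assoc, ← mul_assoc, ← mul_assoc, h1]
    ring

theorem comp_rotate_mem_affineSpan (g : Matrix.specialOrthogonalGroup (Fin 3) ℝ) {f : S2 → ℂ}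
    (hf : f ∈ affineSpan) : (fun x => f (rotate g x)) ∈ affineSpan := by
  have hc : ∀ i : Fin 3, (fun x : S2 => ((rotate g x : EuclideanSpace ℝ (Fin 3)) i : ℂ)) ∈
      affineSpan := by
    intro i
    convert Submodule.sum_mem affineSpan (t := Finset.univ) fun (j : Fin 3) _ =>
      affineSpan.smul_mem ((g : Matrix (Fin 3) (Fin 3) ℝ) i j : ℂ) (coord_mem_affineSpan j) using 1
    ext x
    simp [rotate, Matrix.mulVec, dotProduct]
  have hp : (fun x => planar (rotate g x)) ∈ affineSpan := by
    convert affineSpan.add_mem (hc 0) (affineSpan.smul_mem Complex.I (hc 1)) using 1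
    ext x
    simp [planar]
  have hq : (fun x => conj (planar (rotate g x))) ∈ affineSpan := by
    convert affineSpan.add_mem (hc 0) (affineSpan.smul_mem (-Complex.I) (hc 1)) using 1
    ext x
    simp [planar]
  induction hf using Submodule.span_induction with
  | mem f hf =>
    rcases hf with rfl | rfl | rfl | rfl
    · exact one_mem_affineSpan
    · exact hp
    · exact hq
    · exact hc 2
  | zero => exact affineSpan.zero_mem
  | add f h _ _ hf hh => exact affineSpan.add_mem hf hh
  | smul c f _ hf => exact affineSpan.smul_mem c hf

/-- Composition with a rotation is an algebra homomorphism that preserves the affine functions,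
hence also their powers. -/
theorem comp_rotate_mem_harmonicSpan (g : Matrix.specialOrthogonalGroup (Fin 3) ℝ) {L : ℕ}
    {f : S2 → ℂ} (hf : f ∈ harmonicSpan L) : (fun x => f (rotate g x)) ∈ harmonicSpan L := by
  rw [harmonicSpan_eq] at *
  let φ : (S2 → ℂ) →ₐ[ℂ] (S2 → ℂ) :=
    { toFun := fun f x => f (rotate g x)
      map_one' := rfl
      map_mul' := fun _ _ => rfl
      map_zero' := rfl
      map_add' := fun _ _ => rfl
      commutes' := fun _ => rfl }
  have h1 : affineSpan.map φ.toLinearMap ≤ affineSpan := by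
    rintro _ ⟨f, hf, rfl⟩
    exact comp_rotate_mem_affineSpan g hf
  have h2 : (affineSpan ^ L).map φ.toLinearMap ≤ affineSpan ^ L := by
    rw [Submodule.map_pow]
    exact pow_le_pow_left' h1 L
  exact h2 ⟨f, hf, rfl⟩

/-- By linearity, orthonormality on the generators suffices. Continuity is carried through the
induction because additivity of the integrals needs it. -/
theorem eq_sum_of_mem_harmonicSpan {L : ℕ} {f : S2 → ℂ} (hf : f ∈ harmonicSpan L) (y : S2) :
    f y = ∑ l ∈ Finset.range (L + 1), ∑ m ∈ orders l,
      (∫ x, f x * conj (sphericalHarmonic l m x) ∂surface) * sphericalHarmonic l m y ∧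
      Continuous f := by
  have hY : ∀ l m, Continuous fun x => conj (sphericalHarmonic l m x) := fun l m =>
    Complex.continuous_conj.comp (continuous_sphericalHarmonic l m)
  induction hf using Submodule.span_induction with
  | mem f hf =>
    obtain ⟨l, hl, m, hm, rfl⟩ := hf
    refine ⟨?_, continuous_sphericalHarmonic l m⟩
    simp_rw [integral_sphericalHarmonic_mul_conj hm]
    rw [Finset.sum_eq_single l, Finset.sum_eq_single m]
    · simp
    · intro m' _ h
      simp [Ne.symm h]
    · exact fun h => absurd hm h
    · intro l' _ h
      simp [Ne.symm h]
    · intro h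
      exact absurd (Finset.mem_range.2 (by omega)) h
  | zero => exact ⟨by simp, continuous_const⟩
  | add f g _ _ hf hg =>
    refine ⟨?_, hf.2.add hg.2⟩
    have : ∀ l m, ∫ x, (f + g) x * conj (sphericalHarmonic l m x) ∂surface =
        (∫ x, f x * conj (sphericalHarmonic l m x) ∂surface) +
        ∫ x, g x * conj (sphericalHarmonic l m x) ∂surface := by
      intro l m
      have h1 : Integrable (fun x => f x * conj (sphericalHarmonic l m x)) surface :=
        integrable_of_continuous (hf.2.mul (hY l m))
      have h2 : Integrable (fun x => g x * conj (sphericalHarmonic l m x)) surface :=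
        integrable_of_continuous (hg.2.mul (hY l m))
      rw [← integral_add h1 h2]
      simp [add_mul]
    simp_rw [this, add_mul, Finset.sum_add_distrib, Pi.add_apply]
    rw [← hf.1, ← hg.1]
  | smul c f _ hf =>
    refine ⟨?_, hf.2.const_smul c⟩
    have : ∀ l m, ∫ x, (c • f) x * conj (sphericalHarmonic l m x) ∂surface =
        c * ∫ x, f x * conj (sphericalHarmonic l m x) ∂surface := by
      intro l m
      rw [← integral_const_mul]
      simp [mul_assoc]
    simp_rw [this, mul_assoc, ← Finset.mul_sum, Pi.smul_apply, smul_eq_mul]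
    rw [← hf.1]

/-- The reproducing kernel of the harmonics of degree at most `L` is rotation invariant. -/
theorem sum_harmonic_kernel_rotate (g : Matrix.specialOrthogonalGroup (Fin 3) ℝ) (L : ℕ)
    (x y : S2) :
    ∑ l ∈ Finset.range (L + 1), ∑ m ∈ orders l,
      sphericalHarmonic l m (rotate g x) * conj (sphericalHarmonic l m (rotate g y)) =
    ∑ l ∈ Finset.range (L + 1), ∑ m ∈ orders l,
      sphericalHarmonic l m x * conj (sphericalHarmonic l m y) := by
  have hYc : ∀ l m, Continuous fun x => conj (sphericalHarmonic l m x) := fun l m =>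
    Complex.continuous_conj.comp (continuous_sphericalHarmonic l m)
  -- The conjugate of the rotated kernel as a function of its second point. It lies in `harmonicSpan
  -- L`, hence is determined by its coefficients, which turn out to be those of the unrotated
  -- kernel.
  set r : S2 → ℂ := fun z => ∑ l ∈ Finset.range (L + 1), ∑ m ∈ orders l,
    conj (sphericalHarmonic l m (rotate g x)) * sphericalHarmonic l m (rotate g z) with hr
  have hrmem : r ∈ harmonicSpan L := by
    have : r = ∑ l ∈ Finset.range (L + 1), ∑ m ∈ orders l,
        conj (sphericalHarmonic l m (rotate g x)) •
          (fun z => sphericalHarmonic l m (rotate g z)) := by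
      ext z
      simp [hr, Finset.sum_apply]
    rw [this]
    refine Submodule.sum_mem _ fun l hl => Submodule.sum_mem _ fun m hm => Submodule.smul_mem _ _ ?_
    exact comp_rotate_mem_harmonicSpan g
      (sphericalHarmonic_mem_harmonicSpan (by have := Finset.mem_range.1 hl; omega) hm)
  have hcoef : ∀ l ∈ Finset.range (L + 1), ∀ m ∈ orders l,
      ∫ z, r z * conj (sphericalHarmonic l m z) ∂surface = conj (sphericalHarmonic l m x) := by
    intro l hl m hm
    have hmem := comp_rotate_mem_harmonicSpan g⁻¹
      (sphericalHarmonic_mem_harmonicSpan (L := L) (by have := Finset.mem_range.1 hl; omega) hm)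
    -- The value of the harmonic at `x` is the value of its composition with `g⁻¹` at `rotate g x`.
    -- Expanding the latter gives the integral of `r` term by term, after a change of variables by
    -- `g`.
    have h1 := (eq_sum_of_mem_harmonicSpan hmem (rotate g x)).1
    rw [rotate_rotate, inv_mul_cancel, rotate_one] at h1
    rw [h1, map_sum]
    simp only [hr, Finset.sum_mul]
    have hint : ∀ l' m', Continuous fun z : S2 => conj (sphericalHarmonic l' m' (rotate g x)) *
        sphericalHarmonic l' m' (rotate g z) * conj (sphericalHarmonic l m z) := fun l' m' =>
      (continuous_const.mul ((continuous_sphericalHarmonic l' m').comp (continuous_rotate g))).mul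
        (hYc l m)
    rw [integral_finsetSum _ fun l' _ => integrable_of_continuous
      (continuous_finsetSum _ fun m' _ => hint l' m')]
    refine Finset.sum_congr rfl fun l' _ => ?_
    rw [integral_finsetSum _ fun m' _ => integrable_of_continuous (hint l' m'), map_sum]
    refine Finset.sum_congr rfl fun m' _ => ?_
    rw [map_mul, ← integral_conj, mul_comm, ← integral_const_mul]
    have h2 := integral_rotate g (fun z => conj (sphericalHarmonic l' m' (rotate g x)) *
      (conj (sphericalHarmonic l m (rotate g⁻¹ z) * conj (sphericalHarmonic l' m' z))))
      (Continuous.aestronglyMeasurable (continuous_const.mul (Complex.continuous_conj.comp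
        (((continuous_sphericalHarmonic l m).comp (continuous_rotate _)).mul (hYc l' m')))))
    rw [← h2]
    refine integral_congr_ae (Eventually.of_forall fun z => ?_)
    simp only [rotate_rotate, inv_mul_cancel, rotate_one, map_mul, Complex.conj_conj]
    ring
  have hfin := congrArg conj (eq_sum_of_mem_harmonicSpan hrmem y).1
  rw [hr] at hfin
  simp only [map_sum, map_mul, Complex.conj_conj] at hfin
  rw [hfin]
  refine Finset.sum_congr rfl fun l hl => Finset.sum_congr rfl fun m hm => ?_
  rw [hcoef l hl m hm, Complex.conj_conj]

/-- A single degree is the difference of two consecutive cumulated kernels. -/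
theorem harmonic_kernel_rotate (g : Matrix.specialOrthogonalGroup (Fin 3) ℝ) (l : ℕ) (x y : S2) :
    ∑ m ∈ orders l,
      sphericalHarmonic l m (rotate g x) * conj (sphericalHarmonic l m (rotate g y)) =
    ∑ m ∈ orders l, sphericalHarmonic l m x * conj (sphericalHarmonic l m y) := by
  have h := sum_harmonic_kernel_rotate g l x y
  rcases l with _ | l
  · simpa using h
  · rw [Finset.sum_range_succ, Finset.sum_range_succ _ (l + 1), sum_harmonic_kernel_rotate] at h
    exact add_left_cancel h

theorem planar_northPole : planar northPole = 0 := by simp [planar, northPole]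

theorem height_northPole : height northPole = 1 := by simp [height, northPole]

theorem sphericalHarmonic_northPole_of_ne {l : ℕ} {m : ℤ} (h : m ≠ 0) :
    sphericalHarmonic l m northPole = 0 := by
  have : m.natAbs ≠ 0 := by omega
  unfold sphericalHarmonic
  split_ifs <;> simp [sphericalHarmonicNonneg_eq, planar_northPole, this]

theorem sphericalHarmonic_zero (l : ℕ) (x : S2) :
    sphericalHarmonic l 0 x = ((harmonicConst l 0 * (legendre l).eval (height x) : ℝ) : ℂ) := by
  simp [sphericalHarmonic, sphericalHarmonicNonneg_eq]

theorem harmonicConst_zero_sq (l : ℕ) :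
    harmonicConst l 0 * harmonicConst l 0 = (2 * (l : ℝ) + 1) / (4 * Real.pi) := by
  have : (l.factorial : ℝ) ≠ 0 := by positivity
  rw [harmonicConst_sq]
  simp [this]

/-- The addition formula. -/
theorem addition_formula (l : ℕ) (x y : S2) :
    ∑ m ∈ orders l, sphericalHarmonic l m x * conj (sphericalHarmonic l m y) =
      (((2 * (l : ℝ) + 1) / (4 * Real.pi) * (legendre l).eval
        (inner ℝ (x : EuclideanSpace ℝ (Fin 3)) (y : EuclideanSpace ℝ (Fin 3))) : ℝ) : ℂ) := by
  -- Both sides are rotation invariant, and at the north pole only the order `0` survives.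
  obtain ⟨g, hg⟩ := exists_rotate_eq_northPole x
  rw [← harmonic_kernel_rotate g, hg, Finset.sum_eq_single 0, ← inner_rotate g, hg,
    inner_northPole, sphericalHarmonic_zero, sphericalHarmonic_zero, height_northPole,
    legendre_eval_one, Complex.conj_ofReal, ← Complex.ofReal_mul, ← harmonicConst_zero_sq]
  · congr 1
    ring
  · intro m _ h
    rw [sphericalHarmonic_northPole_of_ne h, zero_mul]
  · exact fun h => absurd (zero_mem_orders l) h

end SphereTime

/-! ### Completeness, Parseval's identity and rotation-invariant kernels -/

namespace SphereTime

open scoped ComplexConjugate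

/-- The indices of the spherical harmonics. -/
abbrev HarmonicIndex : Type := (l : ℕ) × {m : ℤ // m ∈ orders l}

/-- The spherical harmonics as elements of `L²`. -/
def harmonicLp (i : HarmonicIndex) : Lp ℂ 2 surface :=
  ContinuousMap.toLp 2 surface ℂ ⟨sphericalHarmonic i.1 i.2, continuous_sphericalHarmonic _ _⟩

theorem orthonormal_harmonicLp : Orthonormal ℂ harmonicLp := by
  classical
  rw [orthonormal_iff_ite]
  rintro ⟨l, m, hm⟩ ⟨l', m', hm'⟩
  rw [harmonicLp, harmonicLp, ContinuousMap.inner_toLp]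
  have h := integral_sphericalHarmonic_mul_conj (l' := l) (m' := m) hm'
  simp only [ContinuousMap.coe_mk]
  rw [h]
  refine if_congr ?_ rfl rfl
  constructor
  · rintro ⟨rfl, rfl⟩
    rfl
  · intro h
    cases h
    exact ⟨rfl, rfl⟩

theorem harmonicSpan_mono {a b : ℕ} (h : a ≤ b) : harmonicSpan a ≤ harmonicSpan b :=
  Submodule.span_mono fun _ ⟨l, hl, hf⟩ => ⟨l, hl.trans h, hf⟩

/-- The algebra of restrictions of polynomials to the sphere. -/
def harmonicAlgebra : StarSubalgebra ℂ C(S2, ℂ) where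
  carrier := {f | ∃ L, (f : S2 → ℂ) ∈ harmonicSpan L}
  mul_mem' := by
    rintro f g ⟨a, ha⟩ ⟨b, hb⟩
    refine ⟨a + b, ?_⟩
    rw [harmonicSpan_eq] at *
    rw [pow_add]
    exact Submodule.mul_mem_mul ha hb
  add_mem' := by
    rintro f g ⟨a, ha⟩ ⟨b, hb⟩
    exact ⟨a + b, Submodule.add_mem _ (harmonicSpan_mono (by omega) ha)
      (harmonicSpan_mono (by omega) hb)⟩
  algebraMap_mem' := by
    intro c
    refine ⟨1, ?_⟩
    rw [harmonicSpan_eq, pow_one]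
    convert affineSpan.smul_mem c one_mem_affineSpan using 1
    ext x
    simp
  star_mem' := by
    rintro f ⟨a, ha⟩
    exact ⟨a, conj_mem_harmonicSpan ha⟩

theorem harmonicAlgebra_separatesPoints : harmonicAlgebra.SeparatesPoints := by
  intro x y hxy
  by_contra hcon
  push Not at hcon
  apply hxy
  apply Subtype.ext
  ext i
  have hmem : (⟨fun x : S2 => ((x : EuclideanSpace ℝ (Fin 3)) i : ℂ), by fun_prop⟩ : C(S2, ℂ)) ∈
      harmonicAlgebra := by
    refine ⟨1, ?_⟩
    rw [harmonicSpan_eq, pow_one]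
    exact coord_mem_affineSpan i
  have := hcon _ ⟨_, hmem, rfl⟩
  simpa using this

theorem toLp_mem_span_of_mem_harmonicAlgebra {f : C(S2, ℂ)} (hf : f ∈ harmonicAlgebra) :
    ContinuousMap.toLp 2 surface ℂ f ∈ Submodule.span ℂ (Set.range harmonicLp) := by
  obtain ⟨L, hL⟩ := hf
  have : f = ∑ l ∈ Finset.range (L + 1), ∑ m ∈ orders l,
      (∫ x, f x * conj (sphericalHarmonic l m x) ∂surface) •
        (⟨sphericalHarmonic l m, continuous_sphericalHarmonic l m⟩ : C(S2, ℂ)) := by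
    ext y
    rw [(eq_sum_of_mem_harmonicSpan hL y).1]
    simp
  rw [this, map_sum]
  refine Submodule.sum_mem _ fun l _ => ?_
  rw [map_sum]
  refine Submodule.sum_mem _ fun m hm => ?_
  rw [map_smul]
  exact Submodule.smul_mem _ _ (Submodule.subset_span ⟨⟨l, m, hm⟩, rfl⟩)

/-- By Stone–Weierstrass the polynomial functions are uniformly dense among continuous functions,
and those are dense in `L²`. -/
theorem topologicalClosure_span_harmonicLp :
    (Submodule.span ℂ (Set.range harmonicLp)).topologicalClosure = ⊤ := by
  have hA := ContinuousMap.starSubalgebra_topologicalClosure_eq_top_of_separatesPoints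
    harmonicAlgebra harmonicAlgebra_separatesPoints
  have hd : Dense (harmonicAlgebra : Set C(S2, ℂ)) := by
    rw [dense_iff_closure_eq]
    have := congrArg (fun A : StarSubalgebra ℂ C(S2, ℂ) => (A : Set C(S2, ℂ))) hA
    simpa using this
  have hd2 : Dense ((ContinuousMap.toLp 2 surface ℂ : C(S2, ℂ) →L[ℂ] Lp ℂ 2 surface) ''
      (harmonicAlgebra : Set C(S2, ℂ))) :=
    (ContinuousMap.toLp_denseRange ℂ surface ℂ (by norm_num)).dense_image
      (ContinuousLinearMap.continuous _) hd
  rw [← Submodule.dense_iff_topologicalClosure_eq_top]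
  refine hd2.mono ?_
  rintro _ ⟨f, hf, rfl⟩
  exact toLp_mem_span_of_mem_harmonicAlgebra hf

theorem meanSq_eq_eLpNorm_sq {α : Type*} [MeasurableSpace α] (μ : Measure α) (f : α → ℂ) :
    meanSq μ f = eLpNorm f 2 μ ^ 2 := by
  have h := eLpNorm_nnreal_pow_eq_lintegral (p := 2) (f := f) (μ := μ) (by norm_num)
  rw [meanSq]
  simpa using h.symm

/-- Parseval's identity for the spherical harmonics. -/
theorem parseval_sphericalHarmonic {f : S2 → ℂ} (hf : MemLp f 2 surface) :
    ∑' l, ∑ m ∈ orders l, ‖∫ x, f x * conj (sphericalHarmonic l m x) ∂surface‖ₑ ^ 2 =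
      ∫⁻ x, ‖f x‖ₑ ^ 2 ∂surface := by
  have hb : ∀ i, (HilbertBasis.mk orthonormal_harmonicLp
      topologicalClosure_span_harmonicLp.ge) i = harmonicLp i := fun i => by
    rw [HilbertBasis.coe_mk]
  have hs := (HilbertBasis.mk orthonormal_harmonicLp
    topologicalClosure_span_harmonicLp.ge).hasSum_inner_mul_inner (hf.toLp f) (hf.toLp f)
  simp_rw [hb] at hs
  have hc : ∀ i : HarmonicIndex, inner ℂ (harmonicLp i) (hf.toLp f) =
      ∫ x, f x * conj (sphericalHarmonic i.1 i.2 x) ∂surface := by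
    intro i
    rw [L2.inner_def]
    refine integral_congr_ae ?_
    filter_upwards [hf.coeFn_toLp, ContinuousMap.coeFn_toLp (p := 2) surface (𝕜 := ℂ)
      (⟨sphericalHarmonic i.1 i.2, continuous_sphericalHarmonic _ _⟩ : C(S2, ℂ))] with x h1 h2
    rw [h1, harmonicLp, h2]
    simp [RCLike.inner_apply]
  have hterm : ∀ i : HarmonicIndex, inner ℂ (hf.toLp f) (harmonicLp i) *
      inner ℂ (harmonicLp i) (hf.toLp f) =
      ((‖∫ x, f x * conj (sphericalHarmonic i.1 i.2 x) ∂surface‖ ^ 2 : ℝ) : ℂ) := by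
    intro i
    rw [← inner_conj_symm (hf.toLp f), hc, ← Complex.normSq_eq_conj_mul_self,
      Complex.normSq_eq_norm_sq]
  simp_rw [hterm] at hs
  rw [inner_self_eq_norm_sq_to_K] at hs
  have hs' : HasSum (fun i : HarmonicIndex =>
      ‖∫ x, f x * conj (sphericalHarmonic i.1 i.2 x) ∂surface‖ ^ 2) (‖hf.toLp f‖ ^ 2) := by
    have e : ((‖hf.toLp f‖ : ℝ) : ℂ) ^ 2 = ((‖hf.toLp f‖ ^ 2 : ℝ) : ℂ) :=
      (Complex.ofReal_pow _ _).symm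
    exact Complex.hasSum_ofReal.1 (e ▸ hs)
  have h1 : ENNReal.ofReal (‖hf.toLp f‖ ^ 2) = ∫⁻ x, ‖f x‖ₑ ^ 2 ∂surface := by
    rw [ENNReal.ofReal_pow (norm_nonneg _), ofReal_norm, Lp.enorm_toLp]
    exact (meanSq_eq_eLpNorm_sq surface f).symm
  rw [← h1, ← hs'.tsum_eq, ENNReal.ofReal_tsum_of_nonneg (fun _ => by positivity) hs'.summable,
    ENNReal.tsum_sigma']
  refine tsum_congr fun l => ?_
  rw [tsum_fintype, ← Finset.sum_coe_sort]
  refine Finset.sum_congr rfl fun m _ => ?_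
  rw [ENNReal.ofReal_pow (norm_nonneg _), ofReal_norm]

theorem coeff_eq_zero_of_sum_sphericalHarmonic_eq_zero {l : ℕ} {c : ℤ → ℂ}
    (h : ∀ z, ∑ m ∈ orders l, c m * sphericalHarmonic l m z = 0) {m : ℤ} (hm : m ∈ orders l) :
    c m = 0 := by
  have h1 : ∫ z, (∑ m' ∈ orders l, c m' * sphericalHarmonic l m' z) *
      conj (sphericalHarmonic l m z) ∂surface = 0 := by simp [h]
  simp_rw [Finset.sum_mul, mul_assoc] at h1
  have hint : ∀ m', Integrable (fun z => c m' * (sphericalHarmonic l m' z *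
      conj (sphericalHarmonic l m z))) surface := fun m' =>
    integrable_of_continuous (continuous_const.mul ((continuous_sphericalHarmonic l m').mul
      (Complex.continuous_conj.comp (continuous_sphericalHarmonic l m))))
  rw [integral_finsetSum _ fun m' _ => hint m'] at h1
  simp_rw [integral_const_mul] at h1
  rw [Finset.sum_congr rfl fun m' hm' => by rw [integral_sphericalHarmonic_mul_conj hm']] at h1
  simpa [hm] using h1

/-- Spherical harmonics are eigenfunctions of rotation-invariant kernels. -/
theorem exists_eigenvalue_of_invariant_kernel {K : S2 → S2 → ℝ} {C : ℝ}
    (hmeas : ∀ x, Measurable (K x)) (hC : ∀ x y, |K x y| ≤ C)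
    (hinv : ∀ (g : Matrix.specialOrthogonalGroup (Fin 3) ℝ) x y,
      K (rotate g x) (rotate g y) = K x y) (l : ℕ) :
    ∃ lam : ℝ, ∀ m ∈ orders l, ∀ x,
      ∫ y, (K x y : ℂ) * conj (sphericalHarmonic l m y) ∂surface =
        lam * conj (sphericalHarmonic l m x) := by
  have hYc : ∀ m, Continuous fun x => conj (sphericalHarmonic l m x) := fun m =>
    Complex.continuous_conj.comp (continuous_sphericalHarmonic l m)
  have hKm : ∀ x, AEStronglyMeasurable (fun y => (K x y : ℂ)) surface := fun x =>
    (Complex.measurable_ofReal.comp (hmeas x)).aestronglyMeasurable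
  have hint : ∀ x m, Integrable (fun y => (K x y : ℂ) * conj (sphericalHarmonic l m y)) surface :=
    fun x m => (integrable_of_continuous (hYc m)).bdd_mul (c := C) (hKm x)
      (Eventually.of_forall fun y => by simpa using hC x y)
  -- The eigenvalue is read off at the north pole. There the kernel is invariant about the vertical
  -- axis, so nonzero orders give zero on both sides and the order `0` fixes a single real number
  -- for the whole degree.
  set lam : ℝ := ∫ y, K northPole y * (legendre l).eval (height y) ∂surface with hlam
  have hN : ∀ m ∈ orders l, ∫ y, (K northPole y : ℂ) * conj (sphericalHarmonic l m y) ∂surface =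
        lam * conj (sphericalHarmonic l m northPole) := by
    intro m hm
    by_cases h0 : m = 0
    · subst h0
      simp_rw [sphericalHarmonic_zero, Complex.conj_ofReal, height_northPole, legendre_eval_one,
        ← Complex.ofReal_mul]
      rw [integral_complex_ofReal, mul_one, hlam, ← integral_mul_const]
      congr 2
      ext y
      ring
    · rw [sphericalHarmonic_northPole_of_ne h0, map_zero, mul_zero]
      refine integral_eq_zero_of_axisRotation (hint _ m).1 (Real.pi / m) fun y => ?_
      have h1 := hinv (axisRotation (Real.pi / m)) northPole y
      rw [axisRotation_northPole] at h1
      rw [h1, sphericalHarmonic_axisRotation, exp_int_mul_pi_div h0]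
      simp
  refine ⟨lam, fun m hm x => ?_⟩
  -- For general `x` the identity is summed over `m` against the harmonics at a point `z`. The
  -- addition kernel that appears is rotation invariant, so `x` moves to the pole; independence of
  -- the harmonics then separates the orders.
  rw [← sub_eq_zero]
  refine coeff_eq_zero_of_sum_sphericalHarmonic_eq_zero (l := l) (c := fun m =>
    ∫ y, (K x y : ℂ) * conj (sphericalHarmonic l m y) ∂surface -
        lam * conj (sphericalHarmonic l m x)) (fun z => ?_) hm
  obtain ⟨g, hg⟩ := exists_rotate_eq_northPole x
  have hG : ∀ x z, ∑ m ∈ orders l, (∫ y, (K x y : ℂ) * conj (sphericalHarmonic l m y) ∂surface) *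
      sphericalHarmonic l m z = ∫ y, (K x y : ℂ) * ∑ m ∈ orders l, sphericalHarmonic l m z *
        conj (sphericalHarmonic l m y) ∂surface := by
    intro x z
    simp_rw [Finset.mul_sum]
    rw [integral_finsetSum]
    · refine Finset.sum_congr rfl fun m _ => ?_
      rw [mul_comm, ← integral_const_mul]
      congr 1
      ext y
      ring
    · intro m _
      convert (hint x m).const_mul (sphericalHarmonic l m z) using 1
      ext y
      ring
  have h1 : ∑ m ∈ orders l, (∫ y, (K x y : ℂ) * conj (sphericalHarmonic l m y) ∂surface) *
      sphericalHarmonic l m z = lam * ∑ m ∈ orders l, sphericalHarmonic l m z *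
        conj (sphericalHarmonic l m x) := by
    rw [hG, ← harmonic_kernel_rotate g l z x, hg]
    have h2 := hG northPole (rotate g z)
    rw [← integral_rotate g, ← hg] at h2
    · simp_rw [harmonic_kernel_rotate g, hinv g] at h2
      rw [← h2, Finset.mul_sum]
      refine Finset.sum_congr rfl fun m hm => ?_
      rw [hg, hN m hm]
      ring
    · exact (hKm _).mul (Continuous.aestronglyMeasurable
        (continuous_finsetSum _ fun m _ => continuous_const.mul (hYc m)))
  simp_rw [sub_mul, Finset.sum_sub_distrib]
  rw [h1, Finset.mul_sum, sub_eq_zero]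
  refine Finset.sum_congr rfl fun m _ => ?_
  ring

end SphereTime

/-! ### Innovations and the Wold expansion of sequences in an inner product space -/

namespace SphereTime

open scoped ComplexConjugate InnerProductSpace

section Abstract

variable {H : Type*} [NormedAddCommGroup H] [InnerProductSpace ℂ H]

/-- The one-sided moving average of a sequence with real weights `u`. -/
def lagSum (a : ℤ → H) (t : ℤ) (u : ℕ →₀ ℝ) : H := u.sum fun j c => (c : ℂ) • a (t - j)

theorem lagSum_add (a : ℤ → H) (t : ℤ) (u v : ℕ →₀ ℝ) :
    lagSum a t (u + v) = lagSum a t u + lagSum a t v :=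
  Finsupp.sum_add_index' (by simp) (by simp [add_smul])

theorem lagSum_smul (a : ℤ → H) (t : ℤ) (c : ℝ) (u : ℕ →₀ ℝ) :
    lagSum a t (c • u) = (c : ℂ) • lagSum a t u := by
  rw [lagSum, Finsupp.sum_smul_index' (by simp), lagSum, Finsupp.smul_sum]
  simp [mul_smul]

theorem lagSum_single (a : ℤ → H) (t : ℤ) (j : ℕ) :
    lagSum a t (Finsupp.single j 1) = a (t - j) := by
  simp [lagSum]

/-- The covariance of two moving averages. -/
def lagCov (γ : ℤ → ℝ) (u v : ℕ →₀ ℝ) (h : ℤ) : ℝ :=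
  u.sum fun i c => v.sum fun j d => c * d * γ (h + i - j)

/-- Only the weights and the lag enter the right side: the same weights act alike on all sequences
with covariance `γ` and at all times. -/
theorem inner_lagSum {a : ℤ → H} {γ : ℤ → ℝ} (hγ : ∀ s t, ⟪a s, a t⟫_ℂ = (γ (t - s) : ℂ))
    (s t : ℤ) (u v : ℕ →₀ ℝ) :
    ⟪lagSum a s u, lagSum a t v⟫_ℂ = (lagCov γ u v (t - s) : ℂ) := by
  simp only [lagSum, lagCov, Finsupp.sum, sum_inner, inner_sum, inner_smul_left, inner_smul_right,
    hγ, Complex.conj_ofReal]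
  push_cast
  simp_rw [Finset.mul_sum]
  rw [Finset.sum_comm]
  refine Finset.sum_congr rfl fun i _ => Finset.sum_congr rfl fun j _ => ?_
  rw [show t - j - (s - i) = t - s + i - j by ring]
  ring

theorem norm_lagSum_sq {a : ℤ → H} {γ : ℤ → ℝ} (hγ : ∀ s t, ⟪a s, a t⟫_ℂ = (γ (t - s) : ℂ))
    (t : ℤ) (u : ℕ →₀ ℝ) : ‖lagSum a t u‖ ^ 2 = lagCov γ u u 0 := by
  rw [← inner_self_eq_norm_sq (𝕜 := ℂ), inner_lagSum hγ, sub_self]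
  rfl

/-- Innovations `Z` of a family of sequences with a common real covariance, obtained as limits
of moving averages with common real weights. -/
structure IsInnovation {ι : Type*} (a : ι → ℤ → H) (u : ℕ → ℕ →₀ ℝ) (Z : ι → ℤ → H) (σ2 : ℝ)
    (ρ : ℤ → ℝ) : Prop where
  weight_zero : ∀ k, u k 0 = 1
  tendsto : ∀ i t, Tendsto (fun k => lagSum (a i) t (u k)) atTop (𝓝 (Z i t))
  uniform : ∀ ε : ℝ, 0 < ε → ∃ K, ∀ k ≥ K, ∀ i t, ‖lagSum (a i) t (u k) - Z i t‖ ≤ ε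
  orthogonal : ∀ i s t, s < t → ⟪a i s, Z i t⟫_ℂ = 0
  norm_sq : ∀ i t, ‖Z i t‖ ^ 2 = σ2
  inner_eq : ∀ i s t, ⟪Z i s, a i t⟫_ℂ = (ρ (t - s) : ℂ)

/-- A nonnegative quadratic in `τ` that vanishes at `0` has no linear term. Since `τ` is real, only
the real part is controlled. -/
theorem re_inner_eq_zero_of_norm_le {z w : H}
    (h : ∀ τ : ℝ, ‖z‖ ^ 2 ≤ ‖z + (τ : ℂ) • w‖ ^ 2) : (⟪w, z⟫_ℂ).re = 0 := by
  have h1 : ∀ τ : ℝ, 0 ≤ ‖w‖ ^ 2 * (τ * τ) + (2 * (⟪w, z⟫_ℂ).re) * τ + 0 := by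
    intro τ
    have h2 := h τ
    rw [norm_add_sq (𝕜 := ℂ), inner_smul_right, norm_smul, Complex.norm_real, mul_pow,
      Real.norm_eq_abs, sq_abs, ← inner_conj_symm z w] at h2
    have h3 : RCLike.re ((τ : ℂ) * conj ⟪w, z⟫_ℂ) = τ * (⟪w, z⟫_ℂ).re := by
      simp [-inner_conj_symm]
    rw [h3] at h2
    nlinarith
  have h2 := discrim_le_zero h1
  rw [discrim] at h2
  nlinarith [sq_nonneg (⟪w, z⟫_ℂ).re]

/-- Minimise the common squared norm `Q u` under `u 0 = 1`. The parallelogram law makes a minimising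
sequence Cauchy at a rate free of `i` and `t`, and minimality gives a vanishing real part of the
inner product with the strict past. The imaginary part vanishes because `γ` and the weights are
real. -/
theorem exists_isInnovation [CompleteSpace H] {ι : Type*} [Nonempty ι] (a : ι → ℤ → H) (γ : ℤ → ℝ)
    (hγ : ∀ i s t, ⟪a i s, a i t⟫_ℂ = (γ (t - s) : ℂ)) :
    ∃ u Z σ2 ρ, IsInnovation a u Z σ2 ρ := by
  obtain ⟨i0⟩ := ‹Nonempty ι›
  set Q : (ℕ →₀ ℝ) → ℝ := fun u => lagCov γ u u 0 with hQ
  have hn : ∀ i t u, ‖lagSum (a i) t u‖ ^ 2 = Q u := fun i t u => norm_lagSum_sq (hγ i) t u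
  set S : Set ℝ := Q '' {u | u 0 = 1} with hS
  have hne : S.Nonempty := ⟨_, Finsupp.single 0 1, by simp, rfl⟩
  have hbdd : BddBelow S := ⟨0, by
    rintro _ ⟨u, _, rfl⟩
    rw [← hn i0 0]
    positivity⟩
  obtain ⟨q, -, hq, hqS⟩ := exists_seq_tendsto_sInf hne hbdd
  choose u hu0 huq using hqS
  simp only [Set.mem_ofPred_eq] at hu0
  have hle : ∀ v : ℕ →₀ ℝ, v 0 = 1 → sInf S ≤ Q v := fun v hv => csInf_le hbdd ⟨v, hv, rfl⟩
  -- The midpoint of two admissible weights is admissible, so its squared norm is at least `sInf S`.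
  have hdist : ∀ i t k n, ‖lagSum (a i) t (u k) - lagSum (a i) t (u n)‖ ^ 2 ≤
      2 * (q k - sInf S) + 2 * (q n - sInf S) := by
    intro i t k n
    have h1 := parallelogram_law_with_norm ℂ (lagSum (a i) t (u k)) (lagSum (a i) t (u n))
    have h2 : ‖lagSum (a i) t (u k) + lagSum (a i) t (u n)‖ ^ 2 = 4 * Q ((1 / 2 : ℝ) • (u k + u n)) := by
      rw [← hn i t, lagSum_smul, lagSum_add, norm_smul, mul_pow, Complex.norm_real]
      norm_num
      ring
    have h3 := hle ((1 / 2 : ℝ) • (u k + u n)) (by simp [hu0]; norm_num)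
    have h4 := hn i t (u k)
    have h5 := hn i t (u n)
    rw [huq] at h4 h5
    nlinarith
  have huni : ∀ ε : ℝ, 0 < ε → ∃ K, ∀ k ≥ K, ∀ n ≥ K, ∀ i t,
      ‖lagSum (a i) t (u k) - lagSum (a i) t (u n)‖ < ε := by
    intro ε hε
    have h1 : ∀ᶠ k in atTop, q k < sInf S + ε ^ 2 / 4 :=
      hq.eventually_lt_const (by have : 0 < ε ^ 2 := by positivity
                                 linarith)
    obtain ⟨K, hK⟩ := eventually_atTop.1 h1
    refine ⟨K, fun k hk n hn i t => ?_⟩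
    refine lt_of_pow_lt_pow_left₀ 2 hε.le ((hdist i t k n).trans_lt ?_)
    have := hK k hk
    have := hK n hn
    linarith
  have hlim : ∀ i t, ∃ z, Tendsto (fun k => lagSum (a i) t (u k)) atTop (𝓝 z) := by
    intro i t
    refine cauchySeq_tendsto_of_complete (Metric.cauchySeq_iff.2 fun ε hε => ?_)
    obtain ⟨K, hK⟩ := huni ε hε
    exact ⟨K, fun k hk n hn => by rw [dist_eq_norm]; exact hK k hk n hn i t⟩
  choose Z hZ using hlim
  have hinner : ∀ i s t, Tendsto (fun k => ((lagCov γ (u k) (Finsupp.single 0 1) (t - s) : ℝ) : ℂ))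
      atTop (𝓝 ⟪Z i s, a i t⟫_ℂ) := by
    intro i s t
    have h1 := (hZ i s).inner (𝕜 := ℂ) (tendsto_const_nhds (x := a i t))
    refine h1.congr fun k => ?_
    rw [← inner_lagSum (hγ i), lagSum_single]
    simp
  have hre : ∀ i s t, Tendsto (fun k => lagCov γ (u k) (Finsupp.single 0 1) (t - s))
      atTop (𝓝 (⟪Z i s, a i t⟫_ℂ).re) := fun i s t =>
    (Complex.continuous_re.tendsto _).comp (hinner i s t)
  have him : ∀ i s t, (⟪Z i s, a i t⟫_ℂ).im = 0 := fun i s t => by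
    have := (Complex.continuous_im.tendsto _).comp (hinner i s t)
    simp only [Function.comp_def, Complex.ofReal_im] at this
    exact (tendsto_nhds_unique this tendsto_const_nhds)
  have hσ : ∀ i t, ‖Z i t‖ ^ 2 = sInf S := by
    intro i t
    refine tendsto_nhds_unique ((hZ i t).norm.pow 2) (hq.congr fun k => ?_)
    rw [hn, huq]
  refine ⟨u, Z, sInf S, fun h => (⟪Z i0 0, a i0 h⟫_ℂ).re, hu0, hZ, ?_, ?_, hσ, ?_⟩
  · intro ε hε
    obtain ⟨K, hK⟩ := huni ε hε
    refine ⟨K, fun k hk i t => ?_⟩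
    refine le_of_tendsto (((tendsto_const_nhds (x := lagSum (a i) t (u k))).sub (hZ i t)).norm)
      (eventually_atTop.2 ⟨K, fun n hn => (hK k hk n hn i t).le⟩)
  · intro i s t hst
    have h1 : (⟪a i s, Z i t⟫_ℂ).re = 0 := by
      refine re_inner_eq_zero_of_norm_le fun τ => ?_
      rw [hσ]
      refine ge_of_tendsto' ((((hZ i t).add
        (tendsto_const_nhds (x := (τ : ℂ) • a i s))).norm).pow 2) fun k => ?_
      -- Adding a multiple of a strictly earlier value changes a weight of nonzero index, so the
      -- constraint at `0` is kept.
      have h2 : lagSum (a i) t (u k) + (τ : ℂ) • a i s =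
          lagSum (a i) t (u k + τ • Finsupp.single (t - s).toNat 1) := by
        rw [lagSum_add, lagSum_smul, lagSum_single, Int.toNat_of_nonneg (by omega), sub_sub_cancel]
      rw [h2, hn]
      refine hle _ ?_
      have h3 : (t - s).toNat ≠ 0 := by omega
      simp [hu0, h3]
    have h2 := him i t s
    rw [← inner_conj_symm] at h2
    rw [Complex.conj_im, neg_eq_zero] at h2
    exact Complex.ext h1 h2
  · intro i s t
    refine Complex.ext ?_ (by simpa using him i s t)
    have h1 := hre i s t
    have h2 := hre i0 0 (t - s)
    rw [sub_zero] at h2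
    exact tendsto_nhds_unique h1 h2

/-- The closed linear span of the values of a sequence up to time `n`. -/
def closedPast (a : ℤ → H) (n : ℤ) : Submodule ℂ H :=
  (Submodule.span ℂ {f | ∃ t ≤ n, f = a t}).topologicalClosure

theorem isClosed_closedPast (a : ℤ → H) (n : ℤ) : IsClosed (closedPast a n : Set H) :=
  Submodule.isClosed_topologicalClosure _

theorem mem_closedPast (a : ℤ → H) {t n : ℤ} (h : t ≤ n) : a t ∈ closedPast a n :=
  Submodule.le_topologicalClosure _ (Submodule.subset_span ⟨t, h, rfl⟩)

theorem closedPast_le {a : ℤ → H} {n : ℤ} {M : Submodule ℂ H} (hM : IsClosed (M : Set H))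
    (h : ∀ t ≤ n, a t ∈ M) : closedPast a n ≤ M := by
  refine Submodule.topologicalClosure_minimal _ (Submodule.span_le.2 ?_) hM
  rintro f ⟨t, ht, rfl⟩
  exact h t ht

theorem closedPast_mono (a : ℤ → H) {n n' : ℤ} (h : n ≤ n') : closedPast a n ≤ closedPast a n' :=
  closedPast_le (isClosed_closedPast a n') fun _ ht => mem_closedPast a (ht.trans h)

theorem isClosed_orthogonal_singleton (z : H) : IsClosed ((ℂ ∙ z)ᗮ : Set H) :=
  Submodule.isClosed_orthogonal _

theorem inner_eq_zero_of_mem_closedPast {a : ℤ → H} {n : ℤ} {z : H}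
    (h : ∀ t ≤ n, ⟪a t, z⟫_ℂ = 0) {f : H} (hf : f ∈ closedPast a n) : ⟪f, z⟫_ℂ = 0 := by
  have := closedPast_le (M := (ℂ ∙ z)ᗮ) (isClosed_orthogonal_singleton z)
    (fun t ht => (Submodule.mem_orthogonal_singleton_iff_inner_left).2 (h t ht)) hf
  exact (Submodule.mem_orthogonal_singleton_iff_inner_left).1 this

theorem lagSum_mem_closedPast (a : ℤ → H) (t : ℤ) (u : ℕ →₀ ℝ) : lagSum a t u ∈ closedPast a t :=
  Submodule.sum_mem _ fun j _ => Submodule.smul_mem _ _ (mem_closedPast a (by omega))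

theorem sub_lagSum_mem_closedPast (a : ℤ → H) (t : ℤ) {u : ℕ →₀ ℝ} (hu : u 0 = 1) :
    a t - lagSum a t u ∈ closedPast a (t - 1) := by
  have h : lagSum a t u = (u.erase 0).sum (fun j c => (c : ℂ) • a (t - j)) + a t := by
    conv_lhs => rw [← Finsupp.erase_add_single 0 u]
    rw [lagSum_add, hu, lagSum_single]
    simp [lagSum]
  rw [h, sub_add_cancel_right]
  refine Submodule.neg_mem _ (Submodule.sum_mem _ fun j hj => Submodule.smul_mem _ _
    (mem_closedPast a ?_))
  have : j ≠ 0 := by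
    rintro rfl
    simp at hj
  omega

/-- The innovations of a single sequence. -/
structure IsInnovationOf (a Z : ℤ → H) (σ2 : ℝ) : Prop where
  mem : ∀ t, Z t ∈ closedPast a t
  sub_mem : ∀ t, a t - Z t ∈ closedPast a (t - 1)
  orthogonal : ∀ s t, s < t → ⟪a s, Z t⟫_ℂ = 0
  norm_sq : ∀ t, ‖Z t‖ ^ 2 = σ2

theorem IsInnovation.of {ι : Type*} {a : ι → ℤ → H} {u : ℕ → ℕ →₀ ℝ} {Z : ι → ℤ → H} {σ2 : ℝ}
    {ρ : ℤ → ℝ} (h : IsInnovation a u Z σ2 ρ) (i : ι) : IsInnovationOf (a i) (Z i) σ2 where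
  mem t := (isClosed_closedPast _ _).mem_of_tendsto (h.tendsto i t)
    (Eventually.of_forall fun _ => lagSum_mem_closedPast _ _ _)
  sub_mem t := (isClosed_closedPast _ _).mem_of_tendsto (tendsto_const_nhds.sub (h.tendsto i t))
    (Eventually.of_forall fun k => sub_lagSum_mem_closedPast _ _ (h.weight_zero k))
  orthogonal := h.orthogonal i
  norm_sq := h.norm_sq i

namespace IsInnovationOf

variable {a Z : ℤ → H} {σ2 : ℝ}

theorem inner_eq_zero (h : IsInnovationOf a Z σ2) {t : ℤ} {f : H}
    (hf : f ∈ closedPast a (t - 1)) : ⟪f, Z t⟫_ℂ = 0 :=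
  inner_eq_zero_of_mem_closedPast (fun s hs => h.orthogonal s t (by omega)) hf

theorem inner_eq_zero' (h : IsInnovationOf a Z σ2) {t : ℤ} {f : H}
    (hf : f ∈ closedPast a (t - 1)) : ⟪Z t, f⟫_ℂ = 0 := by
  rw [← inner_conj_symm, h.inner_eq_zero hf, map_zero]

theorem inner_of_ne (h : IsInnovationOf a Z σ2) {s t : ℤ} (hst : s ≠ t) : ⟪Z s, Z t⟫_ℂ = 0 := by
  rcases lt_or_gt_of_ne hst with hlt | hlt
  · exact h.inner_eq_zero (closedPast_mono a (by omega) (h.mem s))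
  · exact h.inner_eq_zero' (closedPast_mono a (by omega) (h.mem t))

theorem inner_self (h : IsInnovationOf a Z σ2) (t : ℤ) : ⟪Z t, Z t⟫_ℂ = (σ2 : ℂ) := by
  rw [inner_self_eq_norm_sq_to_K, ← h.norm_sq t]
  norm_cast

theorem inner_current (h : IsInnovationOf a Z σ2) (t : ℤ) : ⟪Z t, a t⟫_ℂ = (σ2 : ℂ) := by
  have h1 := h.inner_eq_zero' (h.sub_mem t)
  rw [inner_sub_right, sub_eq_zero] at h1
  rw [h1, h.inner_self]

/-- Subtracting the component along `Z n` is a continuous linear map, so generators suffice: `a n`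
goes to `a n - Z n`, which lies in the strict past, and earlier values are orthogonal to `Z n` and
stay fixed. -/
theorem step (h : IsInnovationOf a Z σ2) (hσ : σ2 ≠ 0) {n : ℤ} {v : H}
    (hv : v ∈ closedPast a n) : v - (⟪Z n, v⟫_ℂ / σ2) • Z n ∈ closedPast a (n - 1) := by
  let Φ : H →L[ℂ] H := ContinuousLinearMap.id ℂ H -
    (((σ2 : ℂ)⁻¹ • innerSL ℂ (Z n)).smulRight (Z n))
  have hΦ : ∀ v, Φ v = v - (⟪Z n, v⟫_ℂ / σ2) • Z n := fun v => by
    simp [Φ, div_eq_inv_mul]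
  rw [← hΦ]
  have hcl : IsClosed (((closedPast a (n - 1)).comap (Φ : H →ₗ[ℂ] H) : Submodule ℂ H) : Set H) :=
    (isClosed_closedPast a (n - 1)).preimage Φ.continuous
  refine closedPast_le hcl (fun t ht => ?_) hv
  change Φ (a t) ∈ closedPast a (n - 1)
  rw [hΦ]
  rcases eq_or_lt_of_le ht with rfl | hlt
  · rw [h.inner_current, div_self (by exact_mod_cast hσ), one_smul]
    exact h.sub_mem t
  · rw [← inner_conj_symm, h.orthogonal t n hlt]
    simpa using mem_closedPast a (by omega)

theorem residual_mem (h : IsInnovationOf a Z σ2) (hσ : σ2 ≠ 0) (t : ℤ) (J : ℕ) :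
    a t - ∑ j ∈ Finset.range J, (⟪Z (t - j), a t⟫_ℂ / σ2) • Z (t - j) ∈ closedPast a (t - J) := by
  induction J with
  | zero => simpa using mem_closedPast a le_rfl
  | succ J ih =>
    have h1 := h.step hσ ih
    have h2 : ⟪Z (t - J), a t - ∑ j ∈ Finset.range J, (⟪Z (t - j), a t⟫_ℂ / σ2) • Z (t - j)⟫_ℂ =
        ⟪Z (t - J), a t⟫_ℂ := by
      rw [inner_sub_right, inner_sum, Finset.sum_eq_zero, sub_zero]
      intro j hj
      rw [inner_smul_right, h.inner_of_ne, mul_zero]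
      have := Finset.mem_range.1 hj
      omega
    rw [h2] at h1
    rw [Finset.sum_range_succ, ← sub_sub]
    convert h1 using 1
    push_cast
    congr 1
    ring

theorem norm_residual_sq (h : IsInnovationOf a Z σ2) {t : ℤ} {ψ : ℕ → ℝ}
    (hψ : ∀ j : ℕ, ⟪Z (t - j), a t⟫_ℂ = ((ψ j * σ2 : ℝ) : ℂ)) (J : ℕ) :
    ‖a t - ∑ j ∈ Finset.range J, (ψ j : ℂ) • Z (t - j)‖ ^ 2 =
      ‖a t‖ ^ 2 - σ2 * ∑ j ∈ Finset.range J, ψ j ^ 2 := by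
  induction J with
  | zero => simp
  | succ J ih =>
    rw [Finset.sum_range_succ, Finset.sum_range_succ, ← sub_sub]
    set v := a t - ∑ j ∈ Finset.range J, (ψ j : ℂ) • Z (t - j) with hv
    have h2 : ⟪Z (t - J), v⟫_ℂ = ((ψ J * σ2 : ℝ) : ℂ) := by
      rw [hv, inner_sub_right, inner_sum, Finset.sum_eq_zero, sub_zero, hψ]
      intro j hj
      rw [inner_smul_right, h.inner_of_ne, mul_zero]
      have := Finset.mem_range.1 hj
      omega
    rw [norm_sub_sq (𝕜 := ℂ), ih, norm_smul, mul_pow, h.norm_sq, inner_smul_right,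
      ← inner_conj_symm, h2, Complex.conj_ofReal, Complex.norm_real, Real.norm_eq_abs, sq_abs,
      ← Complex.ofReal_mul]
    change _ - 2 * (ψ J * (ψ J * σ2)) + _ = _
    ring

/-- The residual after `J` steps lies in the past at `t - J`. By Pythagoras the norms decrease and
the residuals are Cauchy; their limit lies in every past, hence is zero. -/
theorem tendsto_wold [CompleteSpace H] (h : IsInnovationOf a Z σ2) (hσ : σ2 ≠ 0)
    (hpure : ⨅ n, closedPast a n = ⊥) (t : ℤ) :
    Tendsto (fun J => ∑ j ∈ Finset.range J, (⟪Z (t - j), a t⟫_ℂ / σ2) • Z (t - j)) atTop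
      (𝓝 (a t)) := by
  set v : ℕ → H := fun J =>
    a t - ∑ j ∈ Finset.range J, (⟪Z (t - j), a t⟫_ℂ / σ2) • Z (t - j) with hv
  have hmem : ∀ J : ℕ, v J ∈ closedPast a (t - J) := h.residual_mem hσ t
  have hpyth : ∀ J K, J ≤ K → ‖v J - v K‖ ^ 2 = ‖v J‖ ^ 2 - ‖v K‖ ^ 2 := by
    intro J K hJK
    -- The difference combines innovations at times after `t - K`, and `v K` lies in the past at `t
    -- - K`.
    have h1 : ⟪v K, v J - v K⟫_ℂ = 0 := by
      have h2 : v J - v K = ∑ j ∈ Finset.Ico J K, (⟪Z (t - j), a t⟫_ℂ / σ2) • Z (t - j) := by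
        rw [hv, Finset.sum_Ico_eq_sub _ hJK]
        simp only
        abel
      rw [h2, inner_sum, Finset.sum_eq_zero]
      intro j hj
      rw [inner_smul_right, h.inner_eq_zero (t := t - j)
        (closedPast_mono a (by have := Finset.mem_Ico.1 hj; omega) (hmem K)), mul_zero]
    have h3 := norm_add_sq (𝕜 := ℂ) (v K) (v J - v K)
    rw [h1, add_sub_cancel] at h3
    simp at h3
    linarith
  have hanti : Antitone fun J => ‖v J‖ ^ 2 := fun J K hJK => by
    have := hpyth J K hJK
    have : 0 ≤ ‖v J - v K‖ ^ 2 := by positivity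
    simp only
    linarith
  have hbdd : BddBelow (Set.range fun J => ‖v J‖ ^ 2) := ⟨0, by
    rintro _ ⟨J, rfl⟩
    positivity⟩
  have hlim := tendsto_atTop_ciInf hanti hbdd
  have hcau : CauchySeq v := by
    refine Metric.cauchySeq_iff'.2 fun ε hε => ?_
    have h1 : ∀ᶠ J in atTop, ‖v J‖ ^ 2 < (⨅ J, ‖v J‖ ^ 2) + ε ^ 2 :=
      hlim.eventually_lt_const (by have : 0 < ε ^ 2 := by positivity
                                   linarith)
    obtain ⟨N, hN⟩ := h1.exists
    refine ⟨N, fun J hJ => ?_⟩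
    rw [dist_comm, dist_eq_norm]
    refine lt_of_pow_lt_pow_left₀ 2 hε.le ?_
    rw [hpyth N J hJ]
    have := ciInf_le hbdd J
    linarith
  obtain ⟨w, hw⟩ := cauchySeq_tendsto_of_complete hcau
  have hw0 : w = 0 := by
    have : w ∈ ⨅ n, closedPast a n := by
      rw [Submodule.mem_iInf]
      intro n
      refine (isClosed_closedPast a n).mem_of_tendsto hw
        (eventually_atTop.2 ⟨(t - n).toNat, fun J hJ => closedPast_mono a ?_ (hmem J)⟩)
      omega
    rw [hpure] at this
    simpa using this
  rw [hw0] at hw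
  have := (tendsto_const_nhds (x := a t)).sub hw
  simpa [hv] using this

/-- Since `ψ 0 = 1` and the `W` are orthogonal, `W t` differs from `a t` by an element of the strict
past and is orthogonal to that past. So `W t - Z t` lies in the strict past, is orthogonal to both
of its terms, and vanishes. -/
theorem unique (h : IsInnovationOf a Z σ2) {W : ℤ → H} {ψ : ℕ → ℝ} (hmem : ∀ t, W t ∈ closedPast a t)
    (horth : ∀ s t, s ≠ t → ⟪W s, W t⟫_ℂ = 0) (hψ : ψ 0 = 1)
    (hlim : ∀ t, Tendsto (fun J => ∑ j ∈ Finset.range (J + 1), (ψ j : ℂ) • W (t - j)) atTop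
      (𝓝 (a t))) : W = Z := by
  ext t
  have h1 : ∀ t, a t - W t ∈ closedPast a (t - 1) := by
    intro t
    refine (isClosed_closedPast _ _).mem_of_tendsto ((hlim t).sub tendsto_const_nhds)
      (Eventually.of_forall fun J => ?_)
    rw [Finset.sum_range_succ']
    simp only [hψ, Nat.cast_zero, sub_zero, Complex.ofReal_one, one_smul, add_sub_cancel_right]
    refine Submodule.sum_mem _ fun j _ => Submodule.smul_mem _ _ (closedPast_mono a ?_ (hmem _))
    push_cast
    omega
  have h2 : ∀ s t, s < t → ⟪a s, W t⟫_ℂ = 0 := by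
    intro s t hst
    refine tendsto_nhds_unique ((hlim s).inner (𝕜 := ℂ) (tendsto_const_nhds (x := W t)))
      (tendsto_const_nhds.congr fun J => ?_)
    rw [sum_inner, Finset.sum_eq_zero]
    intro j _
    rw [inner_smul_left, horth _ _ (by omega), mul_zero]
  have hd : W t - Z t ∈ closedPast a (t - 1) := by
    have := Submodule.sub_mem _ (h.sub_mem t) (h1 t)
    simpa using this
  have h3 := h.inner_eq_zero hd
  have h4 := inner_eq_zero_of_mem_closedPast (z := W t) (fun s hs => h2 s t (by omega)) hd
  have h5 : ⟪W t - Z t, W t - Z t⟫_ℂ = 0 := by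
    rw [inner_sub_right, h3, h4, sub_zero]
  exact sub_eq_zero.1 (inner_self_eq_zero.1 h5)

theorem norm_sq_le (h : IsInnovationOf a Z σ2) (n : ℤ) {f : H} (hf : f ∈ closedPast a n) :
    σ2 ≤ ‖a (n + 1) - f‖ ^ 2 := by
  have h1 : a (n + 1) - Z (n + 1) - f ∈ closedPast a (n + 1 - 1) := by
    refine Submodule.sub_mem _ (h.sub_mem (n + 1)) ?_
    simpa using hf
  have h2 := norm_add_sq (𝕜 := ℂ) (a (n + 1) - Z (n + 1) - f) (Z (n + 1))
  rw [h.inner_eq_zero h1, h.norm_sq, show a (n + 1) - Z (n + 1) - f + Z (n + 1) = a (n + 1) - f by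
    abel] at h2
  rw [h2]
  simp

/-- The infimum is attained at `a (n + 1) - Z (n + 1)`. Minimising over finite real weights
therefore loses nothing against prediction from the whole complex past. -/
theorem iInf_norm_sq (h : IsInnovationOf a Z σ2) (n : ℤ) :
    ⨅ f : closedPast a n, ‖a (n + 1) - f‖ ^ 2 = σ2 := by
  refine le_antisymm ?_ (le_ciInf fun f => h.norm_sq_le n f.2)
  have h1 : a (n + 1) - Z (n + 1) ∈ closedPast a n := by simpa using h.sub_mem (n + 1)
  refine (ciInf_le ⟨0, ?_⟩ ⟨_, h1⟩).trans ?_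
  · rintro _ ⟨f, rfl⟩
    positivity
  · simp [h.norm_sq]

end IsInnovationOf

end Abstract

end SphereTime

/-! ### Square integrable functions and random harmonic coefficients -/

namespace SphereTime

open scoped ComplexConjugate InnerProductSpace

section L2

variable {α : Type*} [MeasurableSpace α] {μ : Measure α}

open Classical in
/-- The class of a square integrable function in `L²`, and `0` for other functions. -/
def toL2 (μ : Measure α) (f : α → ℂ) : Lp ℂ 2 μ := if h : MemLp f 2 μ then h.toLp f else 0

theorem coeFn_toL2 {f : α → ℂ} (hf : MemLp f 2 μ) : (toL2 μ f : α → ℂ) =ᵐ[μ] f := by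
  rw [toL2, dif_pos hf]
  exact hf.coeFn_toLp

theorem toL2_coe (f : Lp ℂ 2 μ) : toL2 μ (f : α → ℂ) = f := by
  rw [toL2, dif_pos (Lp.memLp f), Lp.toLp_coeFn]

theorem toL2_congr {f g : α → ℂ} (h : f =ᵐ[μ] g) : toL2 μ f = toL2 μ g := by
  by_cases hf : MemLp f 2 μ
  · rw [toL2, toL2, dif_pos hf, dif_pos (hf.ae_eq h)]
    exact MemLp.toLp_congr _ _ h
  · rw [toL2, toL2, dif_neg hf, dif_neg fun hg => hf (hg.ae_eq h.symm)]

theorem eq_toL2_iff {f : α → ℂ} (hf : MemLp f 2 μ) (g : Lp ℂ 2 μ) :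
    g = toL2 μ f ↔ (g : α → ℂ) =ᵐ[μ] f := by
  constructor
  · rintro rfl
    exact coeFn_toL2 hf
  · intro h
    rw [← toL2_coe g, toL2_congr h]

theorem toL2_add {f g : α → ℂ} (hf : MemLp f 2 μ) (hg : MemLp g 2 μ) :
    toL2 μ (fun a => f a + g a) = toL2 μ f + toL2 μ g := by
  symm
  refine (eq_toL2_iff (hf.add hg) _).2 ?_
  filter_upwards [Lp.coeFn_add (toL2 μ f) (toL2 μ g), coeFn_toL2 hf, coeFn_toL2 hg] with a h1 h2 h3
  rw [h1, Pi.add_apply, h2, h3, Pi.add_apply]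

theorem toL2_sub {f g : α → ℂ} (hf : MemLp f 2 μ) (hg : MemLp g 2 μ) :
    toL2 μ (fun a => f a - g a) = toL2 μ f - toL2 μ g := by
  symm
  refine (eq_toL2_iff (hf.sub hg) _).2 ?_
  filter_upwards [Lp.coeFn_sub (toL2 μ f) (toL2 μ g), coeFn_toL2 hf, coeFn_toL2 hg] with a h1 h2 h3
  rw [h1, Pi.sub_apply, h2, h3, Pi.sub_apply]

theorem toL2_const_mul (c : ℂ) {f : α → ℂ} (hf : MemLp f 2 μ) :
    toL2 μ (fun a => c * f a) = c • toL2 μ f := by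
  symm
  rw [eq_toL2_iff (hf.const_mul c)]
  filter_upwards [Lp.coeFn_smul c (toL2 μ f), coeFn_toL2 hf] with a h1 h2
  rw [h1, Pi.smul_apply, h2, smul_eq_mul]

theorem toL2_sum {ι : Type*} (s : Finset ι) {f : ι → α → ℂ} (hf : ∀ i ∈ s, MemLp (f i) 2 μ) :
    toL2 μ (fun a => ∑ i ∈ s, f i a) = ∑ i ∈ s, toL2 μ (f i) := by
  classical
  induction s using Finset.induction_on with
  | empty =>
    simp only [Finset.sum_empty]
    symm
    rw [eq_toL2_iff MemLp.zero']
    exact Lp.coeFn_zero ℂ 2 μ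
  | insert i s hi ih =>
    simp only [Finset.sum_insert hi]
    rw [toL2_add (hf i (by simp)) (memLp_finsetSum s fun j hj => hf j (by simp [hj])),
      ih fun j hj => hf j (by simp [hj])]

theorem inner_toL2 {f g : α → ℂ} (hf : MemLp f 2 μ) (hg : MemLp g 2 μ) :
    ⟪toL2 μ f, toL2 μ g⟫_ℂ = ∫ a, g a * conj (f a) ∂μ := by
  rw [L2.inner_def]
  refine integral_congr_ae ?_
  filter_upwards [coeFn_toL2 hf, coeFn_toL2 hg] with a h1 h2
  rw [h1, h2, RCLike.inner_apply]

theorem ofReal_norm_toL2_sq {f : α → ℂ} (hf : MemLp f 2 μ) :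
    ENNReal.ofReal (‖toL2 μ f‖ ^ 2) = meanSq μ f := by
  rw [ENNReal.ofReal_pow (norm_nonneg _), ofReal_norm, toL2, dif_pos hf, Lp.enorm_toLp,
    meanSq_eq_eLpNorm_sq]

theorem norm_sq_eq_integral (f : Lp ℂ 2 μ) : ‖f‖ ^ 2 = ∫ a, ‖f a‖ ^ 2 ∂μ := by
  rw [← inner_self_eq_norm_sq (𝕜 := ℂ), L2.inner_def, ← integral_re (L2.integrable_inner f f)]
  refine integral_congr_ae (Eventually.of_forall fun a => ?_)
  exact inner_self_eq_norm_sq (𝕜 := ℂ) (f a)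

theorem meanSq_lt_top {f : α → ℂ} (hf : MemLp f 2 μ) : meanSq μ f < ⊤ := by
  rw [← ofReal_norm_toL2_sq hf]
  exact ENNReal.ofReal_lt_top

theorem memLp_of_meanSq_lt_top {f : α → ℂ} (hf : AEStronglyMeasurable f μ)
    (h : meanSq μ f < ⊤) : MemLp f 2 μ := by
  refine ⟨hf, ?_⟩
  rw [meanSq_eq_eLpNorm_sq] at h
  by_contra hcon
  rw [not_lt, top_le_iff] at hcon
  rw [hcon] at h
  simp at h

theorem meanSq_congr {f g : α → ℂ} (h : f =ᵐ[μ] g) : meanSq μ f = meanSq μ g :=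
  lintegral_congr_ae (h.mono fun a ha => by simp only [ha])

theorem tendsto_toL2 {f : ℕ → α → ℂ} {g : α → ℂ} (hf : ∀ n, MemLp (f n) 2 μ) (hg : MemLp g 2 μ)
    (h : Tendsto (fun n => meanSq μ fun a => f n a - g a) atTop (𝓝 0)) :
    Tendsto (fun n => toL2 μ (f n)) atTop (𝓝 (toL2 μ g)) := by
  rw [tendsto_iff_norm_sub_tendsto_zero]
  have h1 : ∀ n, meanSq μ (fun a => f n a - g a) =
      ENNReal.ofReal (‖toL2 μ (f n) - toL2 μ g‖ ^ 2) := fun n => by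
    rw [← toL2_sub (hf n) hg]
    exact (ofReal_norm_toL2_sq ((hf n).sub hg)).symm
  simp_rw [h1] at h
  have h2 := (ENNReal.tendsto_toReal ENNReal.zero_ne_top).comp h
  simp only [Function.comp_def, ENNReal.toReal_zero] at h2
  have h3 := h2.congr fun n => ENNReal.toReal_ofReal (by positivity)
  have h4 := h3.sqrt
  simpa using h4

end L2

/-- The harmonic coefficients of a complex field on the sphere. -/
def harmonicCoeff {Ω : Type*} (F : S2 → Ω → ℂ) (l : ℕ) (m : ℤ) (ω : Ω) : ℂ :=
  ∫ x, F x ω * conj (sphericalHarmonic l m x) ∂surface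

theorem coeff_eq_harmonicCoeff {Ω : Type*} (X : S2 → ℤ → Ω → ℝ) (l : ℕ) (m t : ℤ) :
    coeff X l m t = harmonicCoeff (fun x ω => (X x t ω : ℂ)) l m := rfl

section Coefficients

variable {Ω : Type*} [MeasurableSpace Ω] {P : Measure Ω} [IsProbabilityMeasure P]

theorem measurable_harmonicCoeff {F : S2 → Ω → ℂ} (hF : Measurable fun z : S2 × Ω => F z.1 z.2)
    (l : ℕ) (m : ℤ) : Measurable (harmonicCoeff F l m) := by
  refine (StronglyMeasurable.integral_prod_left' (μ := surface)
    (f := fun z : S2 × Ω => F z.1 z.2 * conj (sphericalHarmonic l m z.1)) ?_).measurable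
  exact (hF.mul ((Complex.continuous_conj.comp
    (continuous_sphericalHarmonic l m)).measurable.comp measurable_fst)).stronglyMeasurable

/-- Parseval's identity on almost every slice, integrated over `Ω`; nonnegativity allows all
interchanges. -/
theorem tsum_meanSq_harmonicCoeff {F : S2 → Ω → ℂ}
    (hF : Measurable fun z : S2 × Ω => F z.1 z.2)
    (hF2 : MemLp (fun z : S2 × Ω => F z.1 z.2) 2 (surface.prod P)) :
    (∀ᵐ ω ∂P, MemLp (fun x => F x ω) 2 surface) ∧
    ∑' l, ∑ m ∈ orders l, meanSq P (harmonicCoeff F l m) =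
      meanSq (surface.prod P) fun z => F z.1 z.2 := by
  have hm : Measurable fun z : S2 × Ω => ‖F z.1 z.2‖ₑ ^ 2 := hF.enorm.pow_const 2
  have hsl : ∀ ω, Measurable fun x => F x ω := fun ω =>
    hF.comp (measurable_id.prodMk measurable_const)
  have h1 : meanSq (surface.prod P) (fun z => F z.1 z.2) =
      ∫⁻ ω, meanSq surface (fun x => F x ω) ∂P :=
    lintegral_prod_symm _ hm.aemeasurable
  have h2 : ∀ᵐ ω ∂P, MemLp (fun x => F x ω) 2 surface := by
    have h3 : ∫⁻ ω, meanSq surface (fun x => F x ω) ∂P ≠ ⊤ := by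
      rw [← h1]
      exact (meanSq_lt_top hF2).ne
    filter_upwards [ae_lt_top hm.lintegral_prod_left' h3] with ω hω
    exact memLp_of_meanSq_lt_top (hsl ω).aestronglyMeasurable hω
  refine ⟨h2, ?_⟩
  have h4 : ∫⁻ ω, meanSq surface (fun x => F x ω) ∂P =
      ∫⁻ ω, ∑' l, ∑ m ∈ orders l, ‖harmonicCoeff F l m ω‖ₑ ^ 2 ∂P :=
    lintegral_congr_ae (h2.mono fun ω hω => (parseval_sphericalHarmonic hω).symm)
  rw [h1, h4, lintegral_tsum]
  · refine tsum_congr fun l => ?_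
    rw [lintegral_finsetSum _ fun m _ => (measurable_harmonicCoeff hF l m).enorm.pow_const 2]
    rfl
  · exact fun l => (Finset.measurable_sum _ fun m _ =>
      (measurable_harmonicCoeff hF l m).enorm.pow_const 2).aemeasurable

/-- This makes the passage to coefficients continuous for mean square convergence on the product
space. -/
theorem meanSq_harmonicCoeff_le {F : S2 → Ω → ℂ} (hF : Measurable fun z : S2 × Ω => F z.1 z.2)
    {l : ℕ} {m : ℤ} (hm : m ∈ orders l) :
    meanSq P (harmonicCoeff F l m) ≤ meanSq (surface.prod P) fun z => F z.1 z.2 := by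
  rcases eq_top_or_lt_top (meanSq (surface.prod P) fun z => F z.1 z.2) with h | h
  · rw [h]; exact le_top
  · have h1 := tsum_meanSq_harmonicCoeff hF (memLp_of_meanSq_lt_top hF.aestronglyMeasurable h)
    rw [← h1.2]
    refine le_trans ?_ (ENNReal.le_tsum l)
    exact Finset.single_le_sum (f := fun m => meanSq P (harmonicCoeff F l m))
      (fun _ _ => bot_le) hm

theorem memLp_harmonicCoeff {F : S2 → Ω → ℂ} (hF : Measurable fun z : S2 × Ω => F z.1 z.2)
    (hF2 : MemLp (fun z : S2 × Ω => F z.1 z.2) 2 (surface.prod P)) {l : ℕ} {m : ℤ}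
    (hm : m ∈ orders l) : MemLp (harmonicCoeff F l m) 2 P :=
  memLp_of_meanSq_lt_top (measurable_harmonicCoeff hF l m).aestronglyMeasurable
    ((meanSq_harmonicCoeff_le hF hm).trans_lt (meanSq_lt_top hF2))

/-- Slices are square integrable only almost surely, which is why the linearity of the coefficients
below holds almost everywhere. -/
theorem ae_integrable_slice {F : S2 → Ω → ℂ} (hF : Measurable fun z : S2 × Ω => F z.1 z.2)
    (hF2 : MemLp (fun z : S2 × Ω => F z.1 z.2) 2 (surface.prod P)) (l : ℕ) (m : ℤ) :
    ∀ᵐ ω ∂P, Integrable (fun x => F x ω * conj (sphericalHarmonic l m x)) surface := by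
  filter_upwards [(tsum_meanSq_harmonicCoeff hF hF2).1] with ω hω
  have hY : MemLp (fun x => conj (sphericalHarmonic l m x)) 2 surface :=
    (Complex.continuous_conj.comp (continuous_sphericalHarmonic l m)).memLp_of_hasCompactSupport
      (HasCompactSupport.of_compactSpace _)
  exact hω.integrable_mul hY

theorem harmonicCoeff_add_ae {F G : S2 → Ω → ℂ} (hF : Measurable fun z : S2 × Ω => F z.1 z.2)
    (hF2 : MemLp (fun z : S2 × Ω => F z.1 z.2) 2 (surface.prod P))
    (hG : Measurable fun z : S2 × Ω => G z.1 z.2)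
    (hG2 : MemLp (fun z : S2 × Ω => G z.1 z.2) 2 (surface.prod P)) (l : ℕ) (m : ℤ) :
    harmonicCoeff (fun x ω => F x ω + G x ω) l m =ᵐ[P]
      fun ω => harmonicCoeff F l m ω + harmonicCoeff G l m ω := by
  filter_upwards [ae_integrable_slice hF hF2 l m, ae_integrable_slice hG hG2 l m] with ω h1 h2
  simp only [harmonicCoeff, add_mul]
  exact integral_add h1 h2

theorem harmonicCoeff_sub_ae {F G : S2 → Ω → ℂ} (hF : Measurable fun z : S2 × Ω => F z.1 z.2)
    (hF2 : MemLp (fun z : S2 × Ω => F z.1 z.2) 2 (surface.prod P))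
    (hG : Measurable fun z : S2 × Ω => G z.1 z.2)
    (hG2 : MemLp (fun z : S2 × Ω => G z.1 z.2) 2 (surface.prod P)) (l : ℕ) (m : ℤ) :
    harmonicCoeff (fun x ω => F x ω - G x ω) l m =ᵐ[P]
      fun ω => harmonicCoeff F l m ω - harmonicCoeff G l m ω := by
  filter_upwards [ae_integrable_slice hF hF2 l m, ae_integrable_slice hG hG2 l m] with ω h1 h2
  simp only [harmonicCoeff, sub_mul]
  exact integral_sub h1 h2

theorem harmonicCoeff_sum_ae {ι : Type*} (s : Finset ι) {F : ι → S2 → Ω → ℂ}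
    (hF : ∀ i, Measurable fun z : S2 × Ω => F i z.1 z.2)
    (hF2 : ∀ i, MemLp (fun z : S2 × Ω => F i z.1 z.2) 2 (surface.prod P)) (l : ℕ) (m : ℤ) :
    harmonicCoeff (fun x ω => ∑ i ∈ s, F i x ω) l m =ᵐ[P]
      fun ω => ∑ i ∈ s, harmonicCoeff (F i) l m ω := by
  have h := (Finset.eventually_all s).2 fun i _ => ae_integrable_slice (hF i) (hF2 i) l m
  filter_upwards [h] with ω h1
  simp only [harmonicCoeff, Finset.sum_mul]
  exact integral_finsetSum _ h1

/-- Expectation and spherical integration commute. -/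
theorem integral_mul_harmonicCoeff {F : S2 → Ω → ℂ}
    (hF2 : MemLp (fun z : S2 × Ω => F z.1 z.2) 2 (surface.prod P)) {g : Ω → ℂ} (hg : MemLp g 2 P)
    (l : ℕ) (m : ℤ) :
    ∫ ω, g ω * harmonicCoeff F l m ω ∂P =
      ∫ x, (∫ ω, g ω * F x ω ∂P) * conj (sphericalHarmonic l m x) ∂surface := by
  have hY : Continuous fun x => conj (sphericalHarmonic l m x) :=
    Complex.continuous_conj.comp (continuous_sphericalHarmonic l m)
  obtain ⟨C, hC⟩ := (isCompact_univ (X := S2)).exists_bound_of_continuousOn hY.continuousOn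
  have hint : Integrable (Function.uncurry fun (x : S2) (ω : Ω) =>
      g ω * F x ω * conj (sphericalHarmonic l m x)) (surface.prod P) := by
    have h1 : Integrable (fun z : S2 × Ω => g z.2 * F z.1 z.2) (surface.prod P) :=
      (hg.comp_snd surface).integrable_mul hF2
    exact h1.mul_bdd (c := C) (hY.measurable.comp measurable_fst).aestronglyMeasurable
      (Eventually.of_forall fun z => hC _ (Set.mem_univ _))
  have h := integral_integral_swap hint
  simp_rw [harmonicCoeff, ← integral_const_mul, ← integral_mul_const]
  rw [h]
  congr 1
  ext ω
  congr 1
  ext x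
  ring

end Coefficients

end SphereTime

/-! ### Harmonic series with orthogonal coefficients and isotropic fields -/

namespace SphereTime

open scoped ComplexConjugate InnerProductSpace

/-- The weight `(2ℓ+1)/(4π)` of a degree in the addition formula. -/
def areaWeight (l : ℕ) : ℝ := (2 * (l : ℝ) + 1) / (4 * Real.pi)

theorem areaWeight_pos (l : ℕ) : 0 < areaWeight l := by
  have := Real.pi_pos
  unfold areaWeight
  positivity

theorem inner_self_sphere (x : S2) :
    inner ℝ (x : EuclideanSpace ℝ (Fin 3)) (x : EuclideanSpace ℝ (Fin 3)) = (1 : ℝ) := by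
  rw [real_inner_self_eq_norm_sq, mem_sphere_zero_iff_norm.1 x.2]
  norm_num

theorem sum_conj_mul_sphericalHarmonic (l : ℕ) (x : S2) :
    ∑ m ∈ orders l, conj (sphericalHarmonic l m x) * sphericalHarmonic l m x =
      (areaWeight l : ℂ) := by
  have h := addition_formula l x x
  rw [inner_self_sphere, legendre_eval_one, mul_one] at h
  rw [areaWeight, ← h]
  exact Finset.sum_congr rfl fun m _ => mul_comm _ _

theorem sum_norm_sphericalHarmonic_sq (l : ℕ) (x : S2) :
    ∑ m ∈ orders l, ‖sphericalHarmonic l m x‖ ^ 2 = areaWeight l := by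
  have h := sum_conj_mul_sphericalHarmonic l x
  simp_rw [← Complex.normSq_eq_conj_mul_self, Complex.normSq_eq_norm_sq] at h
  exact_mod_cast h

/-- The addition formula writes the kernel as the inner product of two vectors of squared length
`areaWeight l`; `ab ≤ (a² + b²) / 2` then suffices. -/
theorem abs_areaWeight_mul_legendre_le (l : ℕ) (x y : S2) :
    |areaWeight l * (legendre l).eval
        (inner ℝ (x : EuclideanSpace ℝ (Fin 3)) (y : EuclideanSpace ℝ (Fin 3)))| ≤
      areaWeight l := by
  have h := addition_formula l x y
  rw [← Real.norm_eq_abs, ← Complex.norm_real, areaWeight, ← h]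
  refine (norm_sum_le _ _).trans ?_
  have h1 := sum_norm_sphericalHarmonic_sq l x
  have h2 := sum_norm_sphericalHarmonic_sq l y
  have h3 : ∑ m ∈ orders l, ‖sphericalHarmonic l m x * conj (sphericalHarmonic l m y)‖ ≤
      ∑ m ∈ orders l, (‖sphericalHarmonic l m x‖ ^ 2 + ‖sphericalHarmonic l m y‖ ^ 2) / 2 := by
    refine Finset.sum_le_sum fun m _ => ?_
    rw [norm_mul, RCLike.norm_conj]
    nlinarith [sq_nonneg (‖sphericalHarmonic l m x‖ - ‖sphericalHarmonic l m y‖)]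
  rw [← Finset.sum_div, Finset.sum_add_distrib, h1, h2] at h3
  rw [areaWeight] at h3
  linarith

section HarmonicSum

variable {H : Type*} [NormedAddCommGroup H] [InnerProductSpace ℂ H]

/-- The harmonic sum with coefficients in a Hilbert space over the degrees in a finite set. -/
def harmonicSum (A : Finset ℕ) (b : ℕ → ℤ → H) (x : S2) : H :=
  ∑ l ∈ A, ∑ m ∈ orders l, sphericalHarmonic l m x • b l m

/-- Coefficients of different degree or order are orthogonal. -/
def OrthogonalCoeffs (b b' : ℕ → ℤ → H) : Prop :=
  ∀ l l' : ℕ, ∀ m ∈ orders l, ∀ m' ∈ orders l', ¬(l = l' ∧ m = m') → ⟪b l m, b' l' m'⟫_ℂ = 0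

theorem inner_harmonicSum {b b' : ℕ → ℤ → H} (h : OrthogonalCoeffs b b') (A : Finset ℕ)
    (x y : S2) :
    ⟪harmonicSum A b x, harmonicSum A b' y⟫_ℂ = ∑ l ∈ A, ∑ m ∈ orders l,
      conj (sphericalHarmonic l m x) * sphericalHarmonic l m y * ⟪b l m, b' l m⟫_ℂ := by
  simp only [harmonicSum, sum_inner]
  refine Finset.sum_congr rfl fun l hl => Finset.sum_congr rfl fun m hm => ?_
  rw [inner_sum, Finset.sum_eq_single_of_mem l hl, inner_sum, Finset.sum_eq_single_of_mem m hm]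
  · rw [inner_smul_left, inner_smul_right]
    ring
  · intro m' hm' hne
    rw [inner_smul_left, inner_smul_right, h l l m hm m' hm' fun e => hne e.2.symm]
    simp
  · intro l' _ hne
    rw [inner_sum, Finset.sum_eq_zero]
    intro m' hm'
    rw [inner_smul_left, inner_smul_right, h l l' m hm m' hm' fun e => hne e.1.symm]
    simp

/-- By orthogonality the square is the sum of `‖Y‖ ^ 2 * ‖b l m‖ ^ 2`, and `‖Y‖ ^ 2` sums to
`areaWeight l` over one degree at every point. All uniformity in space comes from here. -/
theorem norm_harmonicSum_sq_le {b : ℕ → ℤ → H} (h : OrthogonalCoeffs b b) {B : ℕ → ℝ}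
    (hB : ∀ l, ∀ m ∈ orders l, ‖b l m‖ ^ 2 ≤ B l) (A : Finset ℕ) (x : S2) :
    ‖harmonicSum A b x‖ ^ 2 ≤ ∑ l ∈ A, areaWeight l * B l := by
  have h1 : ‖harmonicSum A b x‖ ^ 2 =
      ∑ l ∈ A, ∑ m ∈ orders l, ‖sphericalHarmonic l m x‖ ^ 2 * ‖b l m‖ ^ 2 := by
    rw [← inner_self_eq_norm_sq (𝕜 := ℂ), inner_harmonicSum h]
    simp only [map_sum]
    refine Finset.sum_congr rfl fun l _ => Finset.sum_congr rfl fun m _ => ?_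
    rw [← Complex.normSq_eq_conj_mul_self, Complex.normSq_eq_norm_sq,
      ← inner_self_eq_norm_sq (𝕜 := ℂ) (b l m)]
    exact Complex.re_ofReal_mul _ _
  rw [h1]
  refine Finset.sum_le_sum fun l _ => ?_
  rw [← sum_norm_sphericalHarmonic_sq l x, Finset.sum_mul]
  exact Finset.sum_le_sum fun m hm => mul_le_mul_of_nonneg_left (hB l m hm) (by positivity)

theorem harmonicSum_sub (A : Finset ℕ) (b b' : ℕ → ℤ → H) (x : S2) :
    harmonicSum A (fun l m => b l m - b' l m) x = harmonicSum A b x - harmonicSum A b' x := by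
  simp [harmonicSum, smul_sub, Finset.sum_sub_distrib]

theorem harmonicSum_sum {ι : Type*} (s : Finset ι) (A : Finset ℕ) (b : ι → ℕ → ℤ → H) (x : S2) :
    harmonicSum A (fun l m => ∑ i ∈ s, b i l m) x = ∑ i ∈ s, harmonicSum A (b i) x := by
  simp only [harmonicSum, Finset.smul_sum]
  rw [Finset.sum_comm (s := s)]
  exact Finset.sum_congr rfl fun l _ => Finset.sum_comm

theorem harmonicSum_range_sub (b : ℕ → ℤ → H) (x : S2) {L N : ℕ} (h : L ≤ N) :
    harmonicSum (Finset.range N) b x - harmonicSum (Finset.range L) b x =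
      harmonicSum (Finset.Ico L N) b x := by
  simp only [harmonicSum]
  rw [Finset.sum_Ico_eq_sub _ h]

variable {b : ℕ → ℤ → H} {B : ℕ → ℝ}

theorem norm_harmonicSum_range_sub_sq_le (h : OrthogonalCoeffs b b)
    (hB : ∀ l, ∀ m ∈ orders l, ‖b l m‖ ^ 2 ≤ B l) (hsum : Summable fun l => areaWeight l * B l)
    (hB0 : ∀ l, 0 ≤ B l) (x : S2) {L N : ℕ} (hLN : L ≤ N) :
    ‖harmonicSum (Finset.range N) b x - harmonicSum (Finset.range L) b x‖ ^ 2 ≤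
      ∑' l, areaWeight (l + L) * B (l + L) := by
  rw [harmonicSum_range_sub b x hLN]
  refine (norm_harmonicSum_sq_le h hB _ x).trans ?_
  rw [Finset.sum_Ico_eq_sum_range]
  simp_rw [add_comm L]
  exact ((summable_nat_add_iff L).2 hsum).sum_le_tsum _
    fun l _ => mul_nonneg (areaWeight_pos _).le (hB0 _)

theorem coeffBound_nonneg {E : Type*} [NormedAddCommGroup E] {b : ℕ → ℤ → E}
    (hB : ∀ l, ∀ m ∈ orders l, ‖b l m‖ ^ 2 ≤ B l) (l : ℕ) : 0 ≤ B l :=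
  le_trans (by positivity) (hB l 0 (zero_mem_orders l))

theorem exists_tendsto_harmonicSum [CompleteSpace H] (h : OrthogonalCoeffs b b)
    (hB : ∀ l, ∀ m ∈ orders l, ‖b l m‖ ^ 2 ≤ B l) (hsum : Summable fun l => areaWeight l * B l)
    (x : S2) :
    ∃ v, Tendsto (fun L => harmonicSum (Finset.range L) b x) atTop (𝓝 v) := by
  refine cauchySeq_tendsto_of_complete (Metric.cauchySeq_iff'.2 fun ε hε => ?_)
  have ht := tendsto_sum_nat_add (fun l => areaWeight l * B l)
  obtain ⟨N, hN⟩ := (ht.eventually_lt_const (show 0 < ε ^ 2 by positivity)).exists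
  refine ⟨N, fun n hn => ?_⟩
  rw [dist_eq_norm]
  exact lt_of_pow_lt_pow_left₀ 2 hε.le ((norm_harmonicSum_range_sub_sq_le h hB hsum
    (coeffBound_nonneg hB) x hn).trans_lt hN)

theorem norm_harmonicSum_sub_limit_sq_le (h : OrthogonalCoeffs b b)
    (hB : ∀ l, ∀ m ∈ orders l, ‖b l m‖ ^ 2 ≤ B l) (hsum : Summable fun l => areaWeight l * B l)
    {x : S2} {v : H}
    (hv : Tendsto (fun L => harmonicSum (Finset.range L) b x) atTop (𝓝 v)) (L : ℕ) :
    ‖harmonicSum (Finset.range L) b x - v‖ ^ 2 ≤ ∑' l, areaWeight (l + L) * B (l + L) := by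
  rw [norm_sub_rev]
  refine le_of_tendsto (((hv.sub tendsto_const_nhds).norm).pow 2)
    (eventually_atTop.2 ⟨L, fun N hN => norm_harmonicSum_range_sub_sq_le h hB hsum
      (coeffBound_nonneg hB) x hN⟩)

theorem norm_limit_sq_le (h : OrthogonalCoeffs b b)
    (hB : ∀ l, ∀ m ∈ orders l, ‖b l m‖ ^ 2 ≤ B l) (hsum : Summable fun l => areaWeight l * B l)
    {x : S2} {v : H}
    (hv : Tendsto (fun L => harmonicSum (Finset.range L) b x) atTop (𝓝 v)) :
    ‖v‖ ^ 2 ≤ ∑' l, areaWeight l * B l := by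
  have := norm_harmonicSum_sub_limit_sq_le h hB hsum hv 0
  simpa [harmonicSum] using this

end HarmonicSum

section Slices

variable {Ω : Type*} [MeasurableSpace Ω] {P : Measure Ω}

theorem meanSq_prod_le [IsProbabilityMeasure P]
    {F : S2 → Ω → ℂ} (hF : Measurable fun z : S2 × Ω => F z.1 z.2) {C : ℝ}
    (hC : ∀ x, meanSq P (F x) ≤ ENNReal.ofReal C) :
    meanSq (surface.prod P) (fun z => F z.1 z.2) ≤ ENNReal.ofReal C * surface Set.univ := by
  have h1 : meanSq (surface.prod P) (fun z => F z.1 z.2) = ∫⁻ x, meanSq P (F x) ∂surface :=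
    lintegral_prod _ (hF.enorm.pow_const 2).aemeasurable
  rw [h1, ← lintegral_const]
  exact lintegral_mono hC

theorem memLp_prod [IsProbabilityMeasure P]
    {F : S2 → Ω → ℂ} (hF : Measurable fun z : S2 × Ω => F z.1 z.2) {C : ℝ}
    (hC : ∀ x, meanSq P (F x) ≤ ENNReal.ofReal C) :
    MemLp (fun z : S2 × Ω => F z.1 z.2) 2 (surface.prod P) :=
  memLp_of_meanSq_lt_top hF.aestronglyMeasurable ((meanSq_prod_le hF hC).trans_lt
    (ENNReal.mul_lt_top ENNReal.ofReal_lt_top (measure_lt_top _ _)))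

theorem meanSq_ofReal {f : Ω → ℝ} (hf : MemLp f 2 P) :
    meanSq P (fun ω => (f ω : ℂ)) = ENNReal.ofReal (∫ ω, f ω * f ω ∂P) := by
  have hi : Integrable (fun ω => f ω * f ω) P := hf.integrable_mul hf
  rw [ofReal_integral_eq_lintegral_ofReal hi
    (Eventually.of_forall fun ω => mul_self_nonneg (f ω)), meanSq]
  refine lintegral_congr fun ω => ?_
  rw [← ofReal_norm, Complex.norm_real, ← ENNReal.ofReal_pow (norm_nonneg _), Real.norm_eq_abs,
    sq_abs, sq]

theorem surface_real_univ : surface.real Set.univ = 4 * Real.pi := by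
  have h := integral_height_pow 0
  simp at h
  rw [h]
  ring

/-- Two real fields on the sphere with jointly rotation invariant cross covariance. -/
structure IsJointlyIsotropic (P : Measure Ω) (X X' : S2 → Ω → ℝ) (C : ℝ) : Prop where
  measurable : Measurable fun z : S2 × Ω => X z.1 z.2
  measurable' : Measurable fun z : S2 × Ω => X' z.1 z.2
  memLp : ∀ x, MemLp (X x) 2 P
  memLp' : ∀ x, MemLp (X' x) 2 P
  bound : ∀ x, ∫ ω, X x ω * X x ω ∂P ≤ C
  bound' : ∀ x, ∫ ω, X' x ω * X' x ω ∂P ≤ C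
  invariant : ∀ (g : Matrix.specialOrthogonalGroup (Fin 3) ℝ) (x y : S2),
    ∫ ω, X (rotate g x) ω * X' (rotate g y) ω ∂P = ∫ ω, X x ω * X' y ω ∂P

/-- The class of a real field at a point. -/
def fieldL2 (P : Measure Ω) (X : S2 → Ω → ℝ) (x : S2) : Lp ℂ 2 P := toL2 P fun ω => (X x ω : ℂ)

/-- The classes of the harmonic coefficients of a real field. -/
def coeffL2 (P : Measure Ω) (X : S2 → Ω → ℝ) (l : ℕ) (m : ℤ) : Lp ℂ 2 P :=
  toL2 P (harmonicCoeff (fun x ω => (X x ω : ℂ)) l m)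

namespace IsJointlyIsotropic

variable {X X' : S2 → Ω → ℝ} {C : ℝ}

theorem symm (h : IsJointlyIsotropic P X X' C) : IsJointlyIsotropic P X' X C where
  measurable := h.measurable'
  measurable' := h.measurable
  memLp := h.memLp'
  memLp' := h.memLp
  bound := h.bound'
  bound' := h.bound
  invariant g x y := by
    have := h.invariant g y x
    simpa [mul_comm] using this

theorem measurable_complex (h : IsJointlyIsotropic P X X' C) :
    Measurable fun z : S2 × Ω => (X z.1 z.2 : ℂ) := Complex.measurable_ofReal.comp h.measurable

theorem memLp_complex [IsProbabilityMeasure P] (h : IsJointlyIsotropic P X X' C) :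
    MemLp (fun z : S2 × Ω => (X z.1 z.2 : ℂ)) 2 (surface.prod P) :=
  memLp_prod (F := fun x ω => (X x ω : ℂ)) h.measurable_complex fun x => by
    rw [meanSq_ofReal (h.memLp x)]
    exact ENNReal.ofReal_le_ofReal (h.bound x)

theorem memLp_ofReal (h : IsJointlyIsotropic P X X' C) (x : S2) :
    MemLp (fun ω => (X x ω : ℂ)) 2 P := (h.memLp x).ofReal

theorem memLp_coeff [IsProbabilityMeasure P]
    (h : IsJointlyIsotropic P X X' C) {l : ℕ} {m : ℤ} (hm : m ∈ orders l) :
    MemLp (harmonicCoeff (fun x ω => (X x ω : ℂ)) l m) 2 P :=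
  memLp_harmonicCoeff h.measurable_complex h.memLp_complex hm

/-- The cross covariance is a measurable, bounded, invariant kernel. Two fields are allowed so that
one field at two times is covered. -/
theorem exists_eigenvalue [IsProbabilityMeasure P] (h : IsJointlyIsotropic P X X' C) (l : ℕ) :
    ∃ lam : ℝ, ∀ m ∈ orders l, ∀ x,
      ∫ y, ((∫ ω, X x ω * X' y ω ∂P : ℝ) : ℂ) * conj (sphericalHarmonic l m y) ∂surface =
        lam * conj (sphericalHarmonic l m x) := by
  refine exists_eigenvalue_of_invariant_kernel (K := fun x y => ∫ ω, X x ω * X' y ω ∂P) (C := C)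
    (fun x => ?_) (fun x y => ?_) h.invariant l
  · refine (StronglyMeasurable.integral_prod_right' (ν := P)
      (f := fun z : S2 × Ω => X x z.2 * X' z.1 z.2) ?_).measurable
    exact ((h.measurable.comp (measurable_const.prodMk measurable_snd)).mul
      h.measurable').stronglyMeasurable
  · have h1 : Integrable (fun ω => X x ω * X x ω) P := (h.memLp x).integrable_mul (h.memLp x)
    have h2 : Integrable (fun ω => X' y ω * X' y ω) P := (h.memLp' y).integrable_mul (h.memLp' y)
    have h3 : |∫ ω, X x ω * X' y ω ∂P| ≤
        ∫ ω, (X x ω * X x ω + X' y ω * X' y ω) / 2 ∂P := by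
      refine (abs_integral_le_integral_abs).trans (integral_mono_of_nonneg
        (Eventually.of_forall fun ω => abs_nonneg _) ((h1.add h2).div_const 2)
        (Eventually.of_forall fun ω => ?_))
      simp only
      rw [abs_le]
      constructor <;> nlinarith [sq_nonneg (X x ω + X' y ω), sq_nonneg (X x ω - X' y ω)]
    rw [integral_div, integral_add h1 h2] at h3
    have := h.bound x
    have := h.bound' y
    linarith

theorem inner_field_coeff [IsProbabilityMeasure P]
    (h : IsJointlyIsotropic P X X' C) {l : ℕ} {lam : ℝ}
    (hlam : ∀ m ∈ orders l, ∀ x,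
      ∫ y, ((∫ ω, X x ω * X' y ω ∂P : ℝ) : ℂ) * conj (sphericalHarmonic l m y) ∂surface =
        lam * conj (sphericalHarmonic l m x)) {m : ℤ} (hm : m ∈ orders l) (x : S2) :
    ⟪fieldL2 P X x, coeffL2 P X' l m⟫_ℂ = lam * conj (sphericalHarmonic l m x) := by
  rw [fieldL2, coeffL2, inner_toL2 (h.memLp_ofReal x) (h.symm.memLp_coeff hm), ← hlam m hm x]
  simp_rw [Complex.conj_ofReal, mul_comm _ (X x _ : ℂ)]
  rw [integral_mul_harmonicCoeff (F := fun x ω => (X' x ω : ℂ)) h.symm.memLp_complex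
    (h.memLp_ofReal x)]
  simp_rw [← integral_complex_ofReal]
  push_cast
  rfl

/-- Integrating out one variable yields the eigenvalue times a harmonic; the other integration pairs
two harmonics and is evaluated by orthonormality. -/
theorem inner_coeff_coeff [IsProbabilityMeasure P]
    (h : IsJointlyIsotropic P X X' C) {l : ℕ} {lam : ℝ}
    (hlam : ∀ m ∈ orders l, ∀ x,
      ∫ y, ((∫ ω, X x ω * X' y ω ∂P : ℝ) : ℂ) * conj (sphericalHarmonic l m y) ∂surface =
        lam * conj (sphericalHarmonic l m x)) {m : ℤ} (hm : m ∈ orders l) {l' : ℕ} {m' : ℤ}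
    (hm' : m' ∈ orders l') :
    ⟪coeffL2 P X l' m', coeffL2 P X' l m⟫_ℂ = if l = l' ∧ m = m' then (lam : ℂ) else 0 := by
  have h1 : ∀ x, ∫ ω, conj (harmonicCoeff (fun x ω => (X' x ω : ℂ)) l m ω) * (X x ω : ℂ) ∂P =
      lam * sphericalHarmonic l m x := by
    intro x
    have h2 := congrArg conj (h.inner_field_coeff hlam hm x)
    rw [fieldL2, coeffL2, inner_toL2 (h.memLp_ofReal x) (h.symm.memLp_coeff hm),
      ← integral_conj] at h2
    simpa using h2
  have h3 : conj ⟪coeffL2 P X l' m', coeffL2 P X' l m⟫_ℂ =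
      if l = l' ∧ m = m' then (lam : ℂ) else 0 := by
    rw [coeffL2, coeffL2, inner_toL2 (h.memLp_coeff hm') (h.symm.memLp_coeff hm), ← integral_conj]
    have h5 : MemLp (fun ω => conj (harmonicCoeff (fun x ω => (X' x ω : ℂ)) l m ω)) 2 P :=
      (h.symm.memLp_coeff hm).star
    simp_rw [map_mul, Complex.conj_conj]
    rw [integral_mul_harmonicCoeff (F := fun x ω => (X x ω : ℂ)) h.memLp_complex h5]
    have h4 : ∀ x, (∫ ω, conj (harmonicCoeff (fun x ω => (X' x ω : ℂ)) l m ω) * (X x ω : ℂ) ∂P) *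
        conj (sphericalHarmonic l' m' x) =
        lam * (sphericalHarmonic l m x * conj (sphericalHarmonic l' m' x)) := fun x => by
      rw [← mul_assoc, ← h1 x]
    simp_rw [h4]
    rw [integral_const_mul, integral_sphericalHarmonic_mul_conj hm]
    split_ifs <;> simp
  rw [← Complex.conj_conj ⟪coeffL2 P X l' m', coeffL2 P X' l m⟫_ℂ, h3]
  split_ifs <;> simp

end IsJointlyIsotropic

theorem norm_fieldL2_sq {X : S2 → Ω → ℝ} {x : S2} (h : MemLp (X x) 2 P) :
    ‖fieldL2 P X x‖ ^ 2 = ∫ ω, X x ω * X x ω ∂P := by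
  have hx : MemLp (fun ω => (X x ω : ℂ)) 2 P := h.ofReal
  rw [← inner_self_eq_norm_sq (𝕜 := ℂ), fieldL2, inner_toL2 hx hx]
  simp_rw [Complex.conj_ofReal, ← Complex.ofReal_mul]
  rw [integral_complex_ofReal]
  rfl

theorem card_orders (l : ℕ) : (orders l).card = 2 * l + 1 := by
  rw [orders, Int.card_Icc]; omega

/-- A measurable isotropic field with finite second moments is the sum of its harmonic expansion
in mean square at every point. -/
theorem tendsto_harmonicSum_of_isotropic [IsProbabilityMeasure P] {X : S2 → Ω → ℝ}
    (hmeas : Measurable fun z : S2 × Ω => X z.1 z.2) (hL2 : ∀ x, MemLp (X x) 2 P)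
    (hinv : ∀ (g : Matrix.specialOrthogonalGroup (Fin 3) ℝ) (x y : S2),
      ∫ ω, X (rotate g x) ω * X (rotate g y) ω ∂P = ∫ ω, X x ω * X y ω ∂P) :
    ∃ (C : ℝ) (γ : ℕ → ℝ), IsJointlyIsotropic P X X C ∧
      (∀ l l' : ℕ, ∀ m ∈ orders l, ∀ m' ∈ orders l', ⟪coeffL2 P X l' m', coeffL2 P X l m⟫_ℂ =
        if l = l' ∧ m = m' then (γ l : ℂ) else 0) ∧
      Summable (fun l => areaWeight l * γ l) ∧
      ∀ x, Tendsto (fun L => harmonicSum (Finset.range L) (coeffL2 P X) x) atTop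
        (𝓝 (fieldL2 P X x)) := by
  set C := ∫ ω, X northPole ω * X northPole ω ∂P with hC
  have hconst : ∀ x, ∫ ω, X x ω * X x ω ∂P = C := by
    intro x
    obtain ⟨g, hg⟩ := exists_rotate_eq_northPole x
    rw [← hinv g, hg]
  have hiso : IsJointlyIsotropic P X X C :=
    ⟨hmeas, hmeas, hL2, hL2, fun x => (hconst x).le, fun x => (hconst x).le, hinv⟩
  choose γ hγ using fun l => hiso.exists_eigenvalue l
  have hgram : ∀ l l' : ℕ, ∀ m ∈ orders l, ∀ m' ∈ orders l',
      ⟪coeffL2 P X l' m', coeffL2 P X l m⟫_ℂ = if l = l' ∧ m = m' then (γ l : ℂ) else 0 :=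
    fun l l' m hm m' hm' => hiso.inner_coeff_coeff (hγ l) hm hm'
  have horth : OrthogonalCoeffs (coeffL2 P X) (coeffL2 P X) := fun l l' m hm m' hm' hne => by
    rw [hgram l' l m' hm' m hm, if_neg fun e => hne ⟨e.1.symm, e.2.symm⟩]
  have hnorm : ∀ l, ∀ m ∈ orders l, ‖coeffL2 P X l m‖ ^ 2 = γ l := fun l m hm => by
    rw [← inner_self_eq_norm_sq (𝕜 := ℂ), hgram l l m hm m hm]
    simp
  have hCn : 0 ≤ C := by
    exact hC ▸ integral_nonneg fun ω => mul_self_nonneg _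
  -- The variance is the constant `C`, so the energy on the product space is `4πC`; Parseval's
  -- identity splits it into `(2l + 1) γ l` over the degrees.
  have hsum : HasSum (fun l => areaWeight l * γ l) C := by
    have h1 := (tsum_meanSq_harmonicCoeff (P := P) (F := fun x ω => (X x ω : ℂ)) hiso.measurable_complex
      hiso.memLp_complex).2
    have h2 : meanSq (surface.prod P) (fun z : S2 × Ω => (X z.1 z.2 : ℂ)) =
        ENNReal.ofReal (C * (4 * Real.pi)) := by
      have h3 : meanSq (surface.prod P) (fun z : S2 × Ω => (X z.1 z.2 : ℂ)) =
          ∫⁻ x, meanSq P (fun ω => (X x ω : ℂ)) ∂surface :=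
        lintegral_prod _ (hiso.measurable_complex.enorm.pow_const 2).aemeasurable
      simp_rw [h3, meanSq_ofReal (hL2 _), hconst]
      rw [lintegral_const, ENNReal.ofReal_mul hCn, ← surface_real_univ, Measure.real,
        ENNReal.ofReal_toReal (measure_ne_top _ _)]
    have h4 : ∀ l, ∑ m ∈ orders l, meanSq P (harmonicCoeff (fun x ω => (X x ω : ℂ)) l m) =
        ENNReal.ofReal ((2 * l + 1) * γ l) := by
      intro l
      rw [Finset.sum_congr rfl fun m hm => (ofReal_norm_toL2_sq (hiso.memLp_coeff hm)).symm]
      rw [← ENNReal.ofReal_sum_of_nonneg fun m _ => by positivity]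
      have h5 : ∑ m ∈ orders l, ‖toL2 P (harmonicCoeff (fun x ω => (X x ω : ℂ)) l m)‖ ^ 2 =
          ∑ m ∈ orders l, γ l := Finset.sum_congr rfl (hnorm l)
      rw [h5, Finset.sum_const, card_orders]
      simp
    simp_rw [h4] at h1
    rw [h2] at h1
    have h5 := ENNReal.hasSum_toReal (f := fun l : ℕ => ENNReal.ofReal ((2 * l + 1) * γ l))
      (by rw [h1]; exact ENNReal.ofReal_ne_top)
    rw [← ENNReal.tsum_toReal_eq (fun _ => ENNReal.ofReal_ne_top), h1,
      ENNReal.toReal_ofReal (by have := Real.pi_pos; positivity)] at h5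
    have hγ0 : ∀ l, 0 ≤ γ l := fun l => by
      rw [← hnorm l 0 (zero_mem_orders l)]
      positivity
    have h6 := h5.div_const (4 * Real.pi)
    rw [mul_div_cancel_right₀ _ (by have := Real.pi_pos; positivity)] at h6
    refine h6.congr_fun fun l => ?_
    rw [ENNReal.toReal_ofReal (mul_nonneg (by positivity) (hγ0 l)), areaWeight]
    ring
  refine ⟨C, γ, hiso, hgram, hsum.summable, fun x => ?_⟩
  have hinner : ∀ A : Finset ℕ, ⟪fieldL2 P X x, harmonicSum A (coeffL2 P X) x⟫_ℂ =
      ((∑ l ∈ A, areaWeight l * γ l : ℝ) : ℂ) := by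
    intro A
    push_cast
    rw [harmonicSum, inner_sum]
    refine Finset.sum_congr rfl fun l _ => ?_
    rw [inner_sum, ← sum_conj_mul_sphericalHarmonic l x, Finset.sum_mul]
    refine Finset.sum_congr rfl fun m hm => ?_
    rw [inner_smul_right, hiso.inner_field_coeff (hγ l) hm]
    ring
  have hself : ∀ A : Finset ℕ, ‖harmonicSum A (coeffL2 P X) x‖ ^ 2 =
      ∑ l ∈ A, areaWeight l * γ l := by
    intro A
    have h1 : ⟪harmonicSum A (coeffL2 P X) x, harmonicSum A (coeffL2 P X) x⟫_ℂ =
        ((∑ l ∈ A, areaWeight l * γ l : ℝ) : ℂ) := by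
      rw [inner_harmonicSum horth]
      push_cast
      refine Finset.sum_congr rfl fun l _ => ?_
      rw [← sum_conj_mul_sphericalHarmonic l x, Finset.sum_mul]
      refine Finset.sum_congr rfl fun m hm => ?_
      rw [hgram l l m hm m hm, if_pos ⟨rfl, rfl⟩]
    rw [← inner_self_eq_norm_sq (𝕜 := ℂ), h1]
    rfl
  rw [tendsto_iff_norm_sub_tendsto_zero]
  -- The inner product of the field with a partial sum equals the squared norm of the partial sum,
  -- so the squared error is the same at every point, a tail of the series `hsum`.
  have hdist : ∀ L, ‖harmonicSum (Finset.range L) (coeffL2 P X) x - fieldL2 P X x‖ ^ 2 =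
      C - ∑ l ∈ Finset.range L, areaWeight l * γ l := by
    intro L
    rw [norm_sub_rev, norm_sub_sq (𝕜 := ℂ), hself, norm_fieldL2_sq (hL2 x), hconst, hinner]
    change C - 2 * (∑ l ∈ Finset.range L, areaWeight l * γ l) + _ = _
    ring
  have hlim := (tendsto_const_nhds (x := C)).sub hsum.tendsto_sum_nat
  rw [sub_self] at hlim
  have h2 := (hlim.congr fun L => (hdist L).symm).sqrt
  simpa using h2

end Slices

end SphereTime

/-! ### Measurable fields with prescribed harmonic coefficients -/

namespace SphereTime

open scoped ComplexConjugate InnerProductSpace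

/-- Orthogonal coefficients whose harmonic series converges uniformly. -/
structure HarmonicBound {H : Type*} [NormedAddCommGroup H] [InnerProductSpace ℂ H]
    (b : ℕ → ℤ → H) (B : ℕ → ℝ) : Prop where
  orthogonal : OrthogonalCoeffs b b
  norm_sq_le : ∀ l, ∀ m ∈ orders l, ‖b l m‖ ^ 2 ≤ B l
  summable : Summable fun l => areaWeight l * B l

/-- Conjugation exchanges the terms of orders `m` and `-m`. -/
theorem conj_harmonicSum {β : ℕ → ℤ → ℂ} {A : Finset ℕ}
    (hβ : ∀ l ∈ A, ∀ m ∈ orders l, β l (-m) = (-1) ^ m.natAbs * conj (β l m)) (x : S2) :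
    conj (harmonicSum A β x) = harmonicSum A β x := by
  simp only [harmonicSum, map_sum, smul_eq_mul, map_mul]
  refine Finset.sum_congr rfl fun l hl => ?_
  refine Finset.sum_nbij' (fun m => -m) (fun m => -m) (fun m hm => neg_mem_orders hm)
    (fun m hm => neg_mem_orders hm) (fun m _ => neg_neg m) (fun m _ => neg_neg m) fun m hm => ?_
  rw [conj_sphericalHarmonic, hβ l hl m hm]
  ring

theorem harmonicCoeff_harmonicSum {Ω : Type*} {β : ℕ → ℤ → Ω → ℂ} (A : Finset ℕ) {l : ℕ} {m : ℤ}
    (hm : m ∈ orders l) (hl : l ∈ A) :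
    harmonicCoeff (fun x ω => harmonicSum A (fun l m => β l m ω) x) l m = β l m := by
  have hY : ∀ l m l' m', Continuous fun x =>
      sphericalHarmonic l m x * conj (sphericalHarmonic l' m' x) := fun l m l' m' =>
    (continuous_sphericalHarmonic l m).mul
      (Complex.continuous_conj.comp (continuous_sphericalHarmonic l' m'))
  ext ω
  have h1 : harmonicCoeff (fun x ω => harmonicSum A (fun l m => β l m ω) x) l m ω =
      ∫ x, ∑ l' ∈ A, ∑ m' ∈ orders l', β l' m' ω *
        (sphericalHarmonic l' m' x * conj (sphericalHarmonic l m x)) ∂surface := by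
    rw [harmonicCoeff]
    congr 1
    ext x
    simp only [harmonicSum, Finset.sum_mul, smul_eq_mul]
    exact Finset.sum_congr rfl fun _ _ => Finset.sum_congr rfl fun _ _ => by ring
  rw [h1, integral_finsetSum _ fun l' _ => integrable_finsetSum _ fun m' _ =>
    (integrable_of_continuous (hY _ _ _ _)).const_mul _, Finset.sum_eq_single_of_mem l hl]
  · rw [integral_finsetSum _ fun m' _ => (integrable_of_continuous (hY _ _ _ _)).const_mul _,
      Finset.sum_eq_single_of_mem m hm]
    · rw [integral_const_mul, integral_sphericalHarmonic_mul_conj hm, if_pos ⟨rfl, rfl⟩, mul_one]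
    · intro m' hm' hne
      rw [integral_const_mul, integral_sphericalHarmonic_mul_conj hm', if_neg, mul_zero]
      exact fun e => hne e.2
  · intro l' _ hne
    rw [integral_finsetSum _ fun m' _ => (integrable_of_continuous (hY _ _ _ _)).const_mul _]
    refine Finset.sum_eq_zero fun m' hm' => ?_
    rw [integral_const_mul, integral_sphericalHarmonic_mul_conj hm', if_neg, mul_zero]
    exact fun e => hne e.1

section Fields

variable {Ω : Type*} [MeasurableSpace Ω] {P : Measure Ω}

theorem memLp_harmonicSum {β : ℕ → ℤ → Ω → ℂ} {A : Finset ℕ}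
    (hβ : ∀ l ∈ A, ∀ m ∈ orders l, MemLp (β l m) 2 P) (x : S2) :
    MemLp (fun ω => harmonicSum A (fun l m => β l m ω) x) 2 P :=
  memLp_finsetSum A fun l hl => memLp_finsetSum (orders l) fun m hm =>
    (hβ l hl m hm).const_mul (sphericalHarmonic l m x)

theorem toL2_harmonicSum {β : ℕ → ℤ → Ω → ℂ} {A : Finset ℕ}
    (hβ : ∀ l ∈ A, ∀ m ∈ orders l, MemLp (β l m) 2 P) (x : S2) :
    toL2 P (fun ω => harmonicSum A (fun l m => β l m ω) x) =
      harmonicSum A (fun l m => toL2 P (β l m)) x := by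
  simp only [harmonicSum, smul_eq_mul]
  rw [toL2_sum A fun l hl => memLp_finsetSum (orders l) fun m hm =>
    (hβ l hl m hm).const_mul (sphericalHarmonic l m x)]
  refine Finset.sum_congr rfl fun l hl => ?_
  rw [toL2_sum _ fun m hm => (hβ l hl m hm).const_mul (sphericalHarmonic l m x)]
  exact Finset.sum_congr rfl fun m hm => toL2_const_mul _ (hβ l hl m hm)

theorem measurable_harmonicSum {β : ℕ → ℤ → Ω → ℂ} {A : Finset ℕ}
    (hβ : ∀ l ∈ A, ∀ m ∈ orders l, Measurable (β l m)) :
    Measurable fun z : S2 × Ω => harmonicSum A (fun l m => β l m z.2) z.1 :=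
  Finset.measurable_sum _ fun l hl => Finset.measurable_sum _ fun m hm =>
    ((continuous_sphericalHarmonic l m).measurable.comp measurable_fst).mul
      ((hβ l hl m hm).comp measurable_snd)

/-- The sum of a harmonic series with orthogonal coefficients has a jointly measurable version. -/
theorem exists_measurable_field {b : ℕ → ℤ → Lp ℂ 2 P} {B : ℕ → ℝ} (hb : HarmonicBound b B) :
    ∃ F : S2 → Ω → ℂ, Measurable (fun z : S2 × Ω => F z.1 z.2) ∧ (∀ x, MemLp (F x) 2 P) ∧
      (∀ x, Tendsto (fun L => harmonicSum (Finset.range L) b x) atTop (𝓝 (toL2 P (F x)))) ∧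
      ((∀ l, ∀ m ∈ orders l,
        (b l (-m) : Ω → ℂ) =ᵐ[P] fun ω => (-1) ^ m.natAbs * conj (b l m ω)) →
        ∀ x, ∀ᵐ ω ∂P, conj (F x ω) = F x ω) := by
  choose v hv using exists_tendsto_harmonicSum hb.orthogonal hb.norm_sq_le hb.summable
  have htail := tendsto_sum_nat_add fun l => areaWeight l * B l
  -- Truncation levels with error below `2 ^ (-k)` at all points at once. These errors are summable,
  -- so along one sequence of levels, common to all `x`, the partial sums converge almost surely at
  -- each `x`; a common sequence is what joint measurability needs.
  have hex : ∀ k : ℕ, ∃ N, ∑' l, areaWeight (l + N) * B (l + N) < ((1 / 2 : ℝ) ^ k) ^ 2 :=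
    fun k => (htail.eventually_lt_const (by positivity)).exists
  choose N hN using hex
  have hbm : ∀ A : Finset ℕ, ∀ l ∈ A, ∀ m ∈ orders l, MemLp (b l m) 2 P := fun _ l _ m _ =>
    Lp.memLp (b l m)
  set S : ℕ → S2 → Ω → ℂ := fun k x ω => harmonicSum (Finset.range (N k)) (fun l m => b l m ω) x
    with hS
  have hSm : ∀ k, Measurable fun z : S2 × Ω => S k z.1 z.2 := fun k =>
    measurable_harmonicSum fun l _ m _ => (Lp.stronglyMeasurable (b l m)).measurable
  have hSL : ∀ k x, MemLp (S k x) 2 P := fun k x => memLp_harmonicSum (hbm _) x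
  have hST : ∀ k x, toL2 P (S k x) = harmonicSum (Finset.range (N k)) b x := fun k x => by
    rw [hS]
    simp only
    rw [toL2_harmonicSum (hbm _) x]
    simp_rw [toL2_coe]
  have hSv : ∀ k x, ‖toL2 P (S k x) - v x‖ < (1 / 2 : ℝ) ^ k := fun k x => by
    rw [hST]
    exact lt_of_pow_lt_pow_left₀ 2 (by positivity) ((norm_harmonicSum_sub_limit_sq_le
      hb.orthogonal hb.norm_sq_le hb.summable (hv x) (N k)).trans_lt (hN k))
  have hae : ∀ x, ∀ᵐ ω ∂P, ∃ c : ℂ, Tendsto (fun k => S k x ω) atTop (𝓝 c) := by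
    intro x
    refine Lp.ae_tendsto_of_cauchy_eLpNorm (p := 2) (fun k => (hSL k x).1) (by norm_num)
      (B := fun k => ENNReal.ofReal (2 * (1 / 2 : ℝ) ^ k)) ?_ fun K n m hn hm => ?_
    · rw [← ENNReal.ofReal_tsum_of_nonneg (fun k => by positivity)
        ((summable_geometric_of_lt_one (by norm_num) (by norm_num)).mul_left 2)]
      exact ENNReal.ofReal_ne_top
    · have h1 : eLpNorm (S n x - S m x) 2 P =
          ENNReal.ofReal ‖toL2 P (S n x) - toL2 P (S m x)‖ := by
        have h2 : MemLp (fun a => S n x a - S m x a) 2 P := (hSL n x).sub (hSL m x)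
        rw [← toL2_sub (hSL n x) (hSL m x), ofReal_norm, toL2, dif_pos h2, Lp.enorm_toLp]
        rfl
      rw [h1, ENNReal.ofReal_lt_ofReal_iff (by positivity)]
      have h2 := norm_sub_le_norm_sub_add_norm_sub (toL2 P (S n x)) (v x) (toL2 P (S m x))
      have h3 := hSv n x
      have h4 := hSv m x
      rw [norm_sub_rev] at h4
      have h5 : (1 / 2 : ℝ) ^ n ≤ (1 / 2 : ℝ) ^ K :=
        pow_le_pow_of_le_one (by norm_num) (by norm_num) hn
      have h6 : (1 / 2 : ℝ) ^ m ≤ (1 / 2 : ℝ) ^ K :=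
        pow_le_pow_of_le_one (by norm_num) (by norm_num) hm
      linarith
  -- `limUnder` keeps joint measurability, and its arbitrary value where no limit exists only
  -- concerns a null set for each `x`.
  set F : S2 → Ω → ℂ := fun x ω => limUnder atTop fun k => S k x ω with hF
  have hlim : ∀ x, ∀ᵐ ω ∂P, Tendsto (fun k => S k x ω) atTop (𝓝 (F x ω)) := fun x =>
    (hae x).mono fun ω h => tendsto_nhds_limUnder h
  have hFv : ∀ x, (v x : Ω → ℂ) =ᵐ[P] F x := by
    intro x
    have h1 : Tendsto (fun k => toL2 P (S k x)) atTop (𝓝 (v x)) :=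
      tendsto_iff_norm_sub_tendsto_zero.2 (squeeze_zero (fun _ => norm_nonneg _)
        (fun k => (hSv k x).le) (tendsto_pow_atTop_nhds_zero_of_lt_one (by norm_num)
          (by norm_num)))
    obtain ⟨ns, hns, h2⟩ := (tendstoInMeasure_of_tendsto_Lp h1).exists_seq_tendsto_ae
    have h3 : ∀ᵐ ω ∂P, ∀ k, (toL2 P (S k x) : Ω → ℂ) ω = S k x ω :=
      ae_all_iff.2 fun k => coeFn_toL2 (hSL k x)
    filter_upwards [h2, h3, hlim x] with ω h2 h3 h4
    simp_rw [h3] at h2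
    exact tendsto_nhds_unique h2 (h4.comp hns.tendsto_atTop)
  have hFL : ∀ x, MemLp (F x) 2 P := fun x => (Lp.memLp (v x)).ae_eq (hFv x)
  refine ⟨F, (StronglyMeasurable.limUnder fun k => (hSm k).stronglyMeasurable).measurable, hFL,
    fun x => ?_, fun hreal x => ?_⟩
  · rw [← (eq_toL2_iff (hFL x) (v x)).2 (hFv x)]
    exact hv x
  · have h1 : ∀ᵐ ω ∂P, ∀ l, ∀ m ∈ orders l, b l (-m) ω = (-1) ^ m.natAbs * conj (b l m ω) := by
      rw [ae_all_iff]
      exact fun l => (Finset.eventually_all _).2 (hreal l)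
    filter_upwards [h1, hlim x] with ω h1 h2
    refine tendsto_nhds_unique (((Complex.continuous_conj.tendsto _).comp h2).congr fun k => ?_) h2
    exact conj_harmonicSum (fun l _ m hm => h1 l m hm) x

/-- The sphere has mass `4π`: `c` bounds the pointwise error and `4πc` the integrated one, and `1 +
4π` covers both. -/
theorem boundedBy_of_norm_sq_le [IsProbabilityMeasure P] {E : S2 → ℤ → Ω → ℂ}
    (hE : ∀ t, Measurable fun z : S2 × Ω => E z.1 t z.2) (hL : ∀ x t, MemLp (E x t) 2 P) {c : ℝ}
    (hc : ∀ x t, ‖toL2 P (E x t)‖ ^ 2 ≤ c) : BoundedBy P (c * (1 + 4 * Real.pi)) E := by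
  have hpi := Real.pi_pos
  have hc0 : 0 ≤ c := le_trans (by positivity) (hc northPole 0)
  have h1 : ∀ x t, meanSq P (E x t) ≤ ENNReal.ofReal c := fun x t => by
    rw [← ofReal_norm_toL2_sq (hL x t)]
    exact ENNReal.ofReal_le_ofReal (hc x t)
  refine ⟨fun x t => (h1 x t).trans (ENNReal.ofReal_le_ofReal (by nlinarith)), fun t => ?_⟩
  refine (meanSq_prod_le (F := fun x ω => E x t ω) (hE t) fun x => h1 x t).trans ?_
  rw [← ENNReal.ofReal_toReal (measure_ne_top surface Set.univ), ← Measure.real,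
    surface_real_univ, ← ENNReal.ofReal_mul hc0]
  exact ENNReal.ofReal_le_ofReal (by nlinarith)

theorem convergesTo_of_boundedBy {S : ℕ → S2 → ℤ → Ω → ℂ} {F : S2 → ℤ → Ω → ℂ} {e : ℕ → ℝ}
    (h : ∀ n, BoundedBy P (e n) fun x t ω => S n x t ω - F x t ω)
    (he : Tendsto e atTop (𝓝 0)) : ConvergesTo P S F := by
  have h0 : Tendsto (fun n => ENNReal.ofReal (e n)) atTop (𝓝 0) := by
    simpa using ENNReal.tendsto_ofReal he
  exact ⟨fun x t => tendsto_of_tendsto_of_tendsto_of_le_of_le tendsto_const_nhds h0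
    (fun _ => zero_le) fun n => (h n).1 x t, fun t =>
    tendsto_of_tendsto_of_tendsto_of_le_of_le tendsto_const_nhds h0
    (fun _ => zero_le) fun n => (h n).2 t⟩

theorem memLp_of_tendsto_meanSq {α : Type*} [MeasurableSpace α] {μ : Measure α} {S : ℕ → α → ℂ}
    {F : α → ℂ} (hS : ∀ n, MemLp (S n) 2 μ) (hF : AEStronglyMeasurable F μ)
    (h : Tendsto (fun n => meanSq μ fun a => S n a - F a) atTop (𝓝 0)) : MemLp F 2 μ := by
  obtain ⟨n, hn⟩ := (h.eventually_lt_const (show (0 : ENNReal) < 1 by norm_num)).exists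
  have h1 : MemLp (fun a => S n a - F a) 2 μ :=
    memLp_of_meanSq_lt_top ((hS n).1.sub hF) (hn.trans ENNReal.one_lt_top)
  have h2 := (hS n).sub h1
  refine h2.ae_eq (Eventually.of_forall fun a => ?_)
  simp

/-- Harmonic coefficients are continuous for mean square convergence on the product space. -/
theorem tendsto_harmonicCoeff [IsProbabilityMeasure P] {S : ℕ → S2 → Ω → ℂ} {F : S2 → Ω → ℂ}
    (hSm : ∀ n, Measurable fun z : S2 × Ω => S n z.1 z.2)
    (hS : ∀ n, MemLp (fun z : S2 × Ω => S n z.1 z.2) 2 (surface.prod P))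
    (hF : Measurable fun z : S2 × Ω => F z.1 z.2)
    (h : Tendsto (fun n => meanSq (surface.prod P) fun z => S n z.1 z.2 - F z.1 z.2) atTop (𝓝 0))
    {l : ℕ} {m : ℤ} (hm : m ∈ orders l) :
    Tendsto (fun n => toL2 P (harmonicCoeff (S n) l m)) atTop
      (𝓝 (toL2 P (harmonicCoeff F l m))) := by
  have hF2 := memLp_of_tendsto_meanSq hS hF.aestronglyMeasurable h
  refine tendsto_toL2 (fun n => memLp_harmonicCoeff (hSm n) (hS n) hm)
    (memLp_harmonicCoeff hF hF2 hm) ?_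
  refine tendsto_of_tendsto_of_tendsto_of_le_of_le tendsto_const_nhds h (fun _ => zero_le)
    fun n => ?_
  have h1 := meanSq_congr (harmonicCoeff_sub_ae (P := P) (hSm n) (hS n) hF hF2 l m)
  rw [← h1]
  exact meanSq_harmonicCoeff_le (F := fun x ω => S n x ω - F x ω) ((hSm n).sub hF) hm

theorem memLp_prod_harmonicSum [IsProbabilityMeasure P] {β : ℕ → ℤ → Ω → ℂ} {A : Finset ℕ}
    (hβ : ∀ l ∈ A, ∀ m ∈ orders l, MemLp (β l m) 2 P) :
    MemLp (fun z : S2 × Ω => harmonicSum A (fun l m => β l m z.2) z.1) 2 (surface.prod P) := by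
  refine memLp_finsetSum _ fun l hl => memLp_finsetSum _ fun m hm => ?_
  have h1 : MemLp (sphericalHarmonic l m) ⊤ surface :=
    (continuous_sphericalHarmonic l m).memLp_of_hasCompactSupport
      (HasCompactSupport.of_compactSpace _)
  exact ((hβ l hl m hm).comp_snd surface).mul (h1.comp_fst P)

/-- The harmonic coefficients of the sum of a harmonic series. -/
theorem toL2_harmonicCoeff_of_tendsto [IsProbabilityMeasure P] {β : ℕ → ℤ → Ω → ℂ} {F : S2 → Ω → ℂ}
    (hβm : ∀ l, ∀ m ∈ orders l, Measurable (β l m))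
    (hβ : ∀ l, ∀ m ∈ orders l, MemLp (β l m) 2 P)
    (hF : Measurable fun z : S2 × Ω => F z.1 z.2)
    (h : Tendsto (fun L => meanSq (surface.prod P) fun z =>
      harmonicSum (Finset.range (L + 1)) (fun l m => β l m z.2) z.1 - F z.1 z.2) atTop (𝓝 0))
    {l : ℕ} {m : ℤ} (hm : m ∈ orders l) :
    toL2 P (harmonicCoeff F l m) = toL2 P (β l m) := by
  -- As soon as `L ≥ l`, the coefficient of the partial sum is exactly `β l m`.
  refine tendsto_nhds_unique (tendsto_harmonicCoeff
    (S := fun L x ω => harmonicSum (Finset.range (L + 1)) (fun l m => β l m ω) x)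
    (fun L => measurable_harmonicSum fun l _ => hβm l)
    (fun L => memLp_prod_harmonicSum fun l _ => hβ l) hF h hm)
    (tendsto_const_nhds.congr' (eventually_atTop.2 ⟨l, fun L hL => ?_⟩))
  simp only
  rw [harmonicCoeff_harmonicSum _ hm (Finset.mem_range.2 (by omega))]

end Fields

end SphereTime

/-! ### Space-time fields as harmonic series, with uniform mean square bounds -/

namespace SphereTime

open scoped ComplexConjugate InnerProductSpace

theorem harmonicSum_congr {H : Type*} [NormedAddCommGroup H] [InnerProductSpace ℂ H]
    {b b' : ℕ → ℤ → H} {A : Finset ℕ} (h : ∀ l ∈ A, ∀ m ∈ orders l, b l m = b' l m) (x : S2) :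
    harmonicSum A b x = harmonicSum A b' x :=
  Finset.sum_congr rfl fun l hl => Finset.sum_congr rfl fun m hm => by rw [h l hl m hm]

theorem harmonicSum_ite_le {H : Type*} [NormedAddCommGroup H] [InnerProductSpace ℂ H]
    (b : ℕ → ℤ → H) {L N : ℕ} (h : L + 1 ≤ N) (x : S2) :
    harmonicSum (Finset.range N) (fun l m => if l ≤ L then b l m else 0) x =
      harmonicSum (Finset.range (L + 1)) b x := by
  simp only [harmonicSum]
  rw [← Finset.sum_subset (Finset.range_subset_range.2 h)]
  · refine Finset.sum_congr rfl fun l hl => Finset.sum_congr rfl fun m hm => ?_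
    rw [if_pos (Nat.lt_succ_iff.1 (Finset.mem_range.1 hl))]
  · intro l _ hl
    refine Finset.sum_eq_zero fun m _ => ?_
    rw [if_neg fun h => hl (Finset.mem_range.2 (Nat.lt_succ_iff.2 h)), smul_zero]

theorem bandLimited_eq_harmonicSum {Ω : Type*} (c : ℕ → ℝ) (X : S2 → ℤ → Ω → ℝ) (L : ℕ) (x : S2)
    (t : ℤ) (ω : Ω) : bandLimited c X L x t ω =
      harmonicSum (Finset.range (L + 1)) (fun l m => (c l : ℂ) * coeff X l m t ω) x := by
  simp only [bandLimited, harmonicSum, smul_eq_mul]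
  exact Finset.sum_congr rfl fun _ _ => Finset.sum_congr rfl fun _ _ => mul_comm _ _

variable {Ω : Type*} [MeasurableSpace Ω] {P : Measure Ω}

/-- Measurability and integrability of the coefficients of a field. -/
structure HasCoeffs (P : Measure Ω) (X : S2 → ℤ → Ω → ℝ) (a : ℕ → ℤ → ℤ → Lp ℂ 2 P) : Prop where
  measurable : ∀ l m t, Measurable (coeff X l m t)
  ae_eq : ∀ l, ∀ m ∈ orders l, ∀ t, (a l m t : Ω → ℂ) =ᵐ[P] coeff X l m t

namespace HasCoeffs

variable {X : S2 → ℤ → Ω → ℝ} {a : ℕ → ℤ → ℤ → Lp ℂ 2 P}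

theorem memLp (h : HasCoeffs P X a) {l : ℕ} {m : ℤ} (hm : m ∈ orders l) (t : ℤ) :
    MemLp (coeff X l m t) 2 P := (Lp.memLp (a l m t)).ae_eq (h.ae_eq l m hm t)

theorem toL2_eq (h : HasCoeffs P X a) {l : ℕ} {m : ℤ} (hm : m ∈ orders l) (t : ℤ) :
    toL2 P (coeff X l m t) = a l m t :=
  ((eq_toL2_iff (h.memLp hm t) _).2 (h.ae_eq l m hm t)).symm

theorem integral_coeff_mul_conj {X' : S2 → ℤ → Ω → ℝ} {a' : ℕ → ℤ → ℤ → Lp ℂ 2 P}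
    (h : HasCoeffs P X a) (h' : HasCoeffs P X' a') {l l' : ℕ} {m m' : ℤ} (hm : m ∈ orders l)
    (hm' : m' ∈ orders l') (t s : ℤ) :
    ∫ ω, coeff X l m t ω * conj (coeff X' l' m' s ω) ∂P = ⟪a' l' m' s, a l m t⟫_ℂ := by
  rw [← h.toL2_eq hm, ← h'.toL2_eq hm', inner_toL2 (h'.memLp hm' s) (h.memLp hm t)]

theorem past_eq (h : HasCoeffs P X a) {l : ℕ} {m : ℤ} (hm : m ∈ orders l) (n : ℤ) :
    past P X l m n = closedPast (a l m) n := by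
  rw [past, closedPast]
  congr 3
  ext f
  refine exists_congr fun t => and_congr_right fun _ => ?_
  rw [← eq_toL2_iff (h.memLp hm t), h.toL2_eq hm]

theorem remotePast_eq (h : HasCoeffs P X a) {l : ℕ} {m : ℤ} (hm : m ∈ orders l) :
    remotePast P X l m = ⨅ n, closedPast (a l m) n := iInf_congr (h.past_eq hm)

theorem predictionError_eq (h : HasCoeffs P X a) {l : ℕ} {m : ℤ} (hm : m ∈ orders l) (n : ℤ) :
    predictionError P X l m n = ⨅ f : closedPast (a l m) n, ‖a l m (n + 1) - f‖ ^ 2 := by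
  have h1 : predictionError P X l m n = ⨅ f : past P X l m n, ‖a l m (n + 1) - f‖ ^ 2 := by
    refine iInf_congr fun f => ?_
    rw [norm_sq_eq_integral]
    refine integral_congr_ae ?_
    filter_upwards [Lp.coeFn_sub (a l m (n + 1)) f, h.ae_eq l m hm (n + 1)] with ω h1 h2
    rw [h1, Pi.sub_apply, h2]
  rw [h1, h.past_eq hm]

end HasCoeffs

/-- A jointly measurable field that is pointwise the sum of a harmonic series. -/
structure HasExpansion (P : Measure Ω) (F : S2 → ℤ → Ω → ℂ) (b : ℕ → ℤ → ℤ → Lp ℂ 2 P) :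
    Prop where
  measurable : ∀ t, Measurable fun z : S2 × Ω => F z.1 t z.2
  memLp : ∀ x t, MemLp (F x t) 2 P
  tendsto : ∀ x t, Tendsto (fun L => harmonicSum (Finset.range L) (fun l m => b l m t) x) atTop
    (𝓝 (toL2 P (F x t)))

namespace HasExpansion

variable {F G : S2 → ℤ → Ω → ℂ} {b c : ℕ → ℤ → ℤ → Lp ℂ 2 P}

theorem sub (hF : HasExpansion P F b) (hG : HasExpansion P G c) :
    HasExpansion P (fun x t ω => F x t ω - G x t ω) fun l m t => b l m t - c l m t where
  measurable t := (hF.measurable t).sub (hG.measurable t)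
  memLp x t := (hF.memLp x t).sub (hG.memLp x t)
  tendsto x t := by
    simp_rw [toL2_sub (hF.memLp x t) (hG.memLp x t), harmonicSum_sub]
    exact (hF.tendsto x t).sub (hG.tendsto x t)

theorem sum {ι : Type*} (s : Finset ι) {F : ι → S2 → ℤ → Ω → ℂ} {b : ι → ℕ → ℤ → ℤ → Lp ℂ 2 P}
    (h : ∀ i, HasExpansion P (F i) (b i)) :
    HasExpansion P (fun x t ω => ∑ i ∈ s, F i x t ω) fun l m t => ∑ i ∈ s, b i l m t where
  measurable t := Finset.measurable_sum _ fun i _ => (h i).measurable t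
  memLp x t := memLp_finsetSum s fun i _ => (h i).memLp x t
  tendsto x t := by
    simp_rw [toL2_sum s fun i _ => (h i).memLp x t, harmonicSum_sum]
    exact tendsto_finsetSum s fun i _ => (h i).tendsto x t

theorem lag (h : HasExpansion P F b) (j : ℤ) :
    HasExpansion P (fun x t ω => F x (t - j) ω) fun l m t => b l m (t - j) where
  measurable t := h.measurable (t - j)
  memLp x t := h.memLp x (t - j)
  tendsto x t := h.tendsto x (t - j)

theorem harmonicSum {β : ℕ → ℤ → ℤ → Ω → ℂ} (hβm : ∀ l m t, Measurable (β l m t))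
    (hβ : ∀ l, ∀ m ∈ orders l, ∀ t, MemLp (β l m t) 2 P) (L : ℕ) :
    HasExpansion P (fun x t ω => SphereTime.harmonicSum (Finset.range (L + 1))
      (fun l m => β l m t ω) x) fun l m t => if l ≤ L then toL2 P (β l m t) else 0 where
  measurable t := measurable_harmonicSum (β := fun l m => β l m t) fun l _ m _ => hβm l m t
  memLp x t := memLp_harmonicSum (β := fun l m => β l m t) (fun l _ m hm => hβ l m hm t) x
  tendsto x t := by
    refine tendsto_const_nhds.congr' (eventually_atTop.2 ⟨L + 1, fun N hN => ?_⟩)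
    rw [toL2_harmonicSum (β := fun l m => β l m t) (fun l _ m hm => hβ l m hm t) x]
    exact (harmonicSum_ite_le _ hN x).symm

theorem bandLimited {X : S2 → ℤ → Ω → ℝ} (hX : HasCoeffs P X b) (w : ℕ → ℝ) (L : ℕ) :
    HasExpansion P (fun x t ω => bandLimited w X L x t ω)
      fun l m t => if l ≤ L then (w l : ℂ) • b l m t else 0 := by
  have h := HasExpansion.harmonicSum (P := P) (β := fun l m t ω => (w l : ℂ) * coeff X l m t ω)
    (fun l m t => (hX.measurable l m t).const_mul _)
    (fun l m hm t => (hX.memLp hm t).const_mul _) L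
  have h2 : (fun x t ω => SphereTime.bandLimited w X L x t ω) = fun x t ω =>
      SphereTime.harmonicSum (Finset.range (L + 1))
        (fun l m => (w l : ℂ) * coeff X l m t ω) x := by
    ext x t ω
    exact bandLimited_eq_harmonicSum w X L x t ω
  rw [h2]
  refine ⟨h.measurable, h.memLp, fun x t => (h.tendsto x t).congr fun N => ?_⟩
  refine harmonicSum_congr (fun l _ m hm => ?_) x
  rw [toL2_const_mul _ (hX.memLp hm t), hX.toL2_eq hm]

variable [IsProbabilityMeasure P]

theorem boundedBy (h : HasExpansion P F b) {B : ℕ → ℝ}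
    (hb : ∀ t, HarmonicBound (fun l m => b l m t) B) :
    BoundedBy P ((∑' l, areaWeight l * B l) * (1 + 4 * Real.pi)) F :=
  boundedBy_of_norm_sq_le h.measurable h.memLp fun x t =>
    norm_limit_sq_le (hb t).orthogonal (hb t).norm_sq_le (hb t).summable (h.tendsto x t)

end HasExpansion

/-- Dominated convergence for series over the degrees; the factor `1 + 4π` is the one of
`boundedBy_of_norm_sq_le`. -/
theorem tendsto_tsum_weighted {g : ℕ → ℝ} (hg : Summable fun l => areaWeight l * g l)
    {f : ℕ → ℕ → ℝ} (hf0 : ∀ n l, 0 ≤ f n l) (hfg : ∀ n l, f n l ≤ g l)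
    (hf : ∀ l, Tendsto (fun n => f n l) atTop (𝓝 0)) :
    (∀ n, Summable fun l => areaWeight l * f n l) ∧
    Tendsto (fun n => (∑' l, areaWeight l * f n l) * (1 + 4 * Real.pi)) atTop (𝓝 0) := by
  have hle : ∀ n l, areaWeight l * f n l ≤ areaWeight l * g l := fun n l =>
    mul_le_mul_of_nonneg_left (hfg n l) (areaWeight_pos l).le
  have h0 : ∀ n l, 0 ≤ areaWeight l * f n l := fun n l =>
    mul_nonneg (areaWeight_pos l).le (hf0 n l)
  refine ⟨fun n => hg.of_nonneg_of_le (h0 n) (hle n), ?_⟩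
  have h1 := tendsto_tsum_of_dominated_convergence (𝓕 := atTop) (f := fun n l => areaWeight l * f n l)
    (g := fun _ => (0 : ℝ)) hg (fun l => by simpa using (hf l).const_mul (areaWeight l))
    (Eventually.of_forall fun n l => by
      rw [Real.norm_of_nonneg (h0 n l)]
      exact hle n l)
  simpa using h1.mul_const (1 + 4 * Real.pi)

namespace HasExpansion

variable {F : S2 → ℤ → Ω → ℂ} {b : ℕ → ℤ → ℤ → Lp ℂ 2 P} [IsProbabilityMeasure P]

/-- The partial sums of the harmonic series converge uniformly in mean square. -/
theorem convergesTo (h : HasExpansion P F b) {B : ℕ → ℝ}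
    (hb : ∀ t, HarmonicBound (fun l m => b l m t) B) {S : ℕ → S2 → ℤ → Ω → ℂ}
    (hS : ∀ L, HasExpansion P (S L) fun l m t => if l ≤ L then b l m t else 0) :
    ConvergesTo P S F := by
  have hB0 : ∀ l, 0 ≤ B l := coeffBound_nonneg (hb 0).norm_sq_le
  -- The error of truncation at `L` has no coefficients up to degree `L` and the full ones beyond.
  obtain ⟨h1, h2⟩ := tendsto_tsum_weighted (hb 0).summable
    (f := fun L l => if l ≤ L then 0 else B l) (fun L l => by split_ifs <;> simp [hB0])
    (fun L l => by split_ifs <;> simp [hB0]) fun l =>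
      tendsto_const_nhds.congr' (eventually_atTop.2 ⟨l, fun L hL => by simp [hL]⟩)
  refine convergesTo_of_boundedBy (fun L => ((hS L).sub h).boundedBy fun t => ⟨?_, ?_, h1 L⟩) h2
  · intro l l' m hm m' hm' hne
    have h3 := (hb t).orthogonal l l' m hm m' hm' hne
    simp only
    split_ifs <;> simp [h3]
  · intro l m hm
    have h3 := (hb t).norm_sq_le l m hm
    split_ifs <;> simp [h3]

theorem toL2_harmonicCoeff (h : HasExpansion P F b) {B : ℕ → ℝ}
    (hb : ∀ t, HarmonicBound (fun l m => b l m t) B) {l : ℕ} {m : ℤ} (hm : m ∈ orders l) (t : ℤ) :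
    toL2 P (harmonicCoeff (fun x ω => F x t ω) l m) = b l m t := by
  have hm2 : ∀ l, ∀ m ∈ orders l, Measurable (b l m t : Ω → ℂ) := fun l m _ =>
    (Lp.stronglyMeasurable (b l m t)).measurable
  have hS : ∀ L : ℕ, HasExpansion P (fun x s ω => SphereTime.harmonicSum (Finset.range (L + 1))
      (fun l m => b l m s ω) x) fun l m t => if l ≤ L then b l m t else 0 := fun L => by
    simpa only [toL2_coe] using HasExpansion.harmonicSum (P := P)
      (β := fun l m t => (b l m t : Ω → ℂ))
      (fun l m t => (Lp.stronglyMeasurable (b l m t)).measurable)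
      (fun l m _ t => Lp.memLp (b l m t)) L
  have h1 := toL2_harmonicCoeff_of_tendsto (F := fun x ω => F x t ω)
    (β := fun l m => (b l m t : Ω → ℂ)) hm2 (fun l m _ => Lp.memLp (b l m t)) (h.measurable t)
    ((h.convergesTo hb hS).2 t) hm
  rw [h1, toL2_coe]

theorem memLp_prod (h : HasExpansion P F b) {B : ℕ → ℝ}
    (hb : ∀ t, HarmonicBound (fun l m => b l m t) B) (t : ℤ) :
    MemLp (fun z : S2 × Ω => F z.1 t z.2) 2 (surface.prod P) :=
  memLp_of_meanSq_lt_top (h.measurable t).aestronglyMeasurable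
    (((h.boundedBy hb).2 t).trans_lt ENNReal.ofReal_lt_top)

end HasExpansion

end SphereTime

/-! ### Innovations indexed by degree and order -/

namespace SphereTime

open scoped ComplexConjugate InnerProductSpace

variable {H : Type*} [NormedAddCommGroup H] [InnerProductSpace ℂ H]

/-- Uncorrelated sequences indexed by degree and order, with variances `γ`, innovations `z` of
variances `σ2`, Wold coefficients `ψ`, and approximations of the innovations by moving averages
with weights `u`; these weights and the Wold coefficients depend only on the degree. -/
structure InnovationSystem (a z : ℕ → ℤ → ℤ → H) (γ σ2 : ℕ → ℝ) (ψ : ℕ → ℕ → ℝ)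
    (u : ℕ → ℕ → ℕ →₀ ℝ) : Prop where
  orthogonal : ∀ l l' : ℕ, ∀ m ∈ orders l, ∀ m' ∈ orders l', ¬(l = l' ∧ m = m') →
    ∀ s t, ⟪a l m s, a l' m' t⟫_ℂ = 0
  norm_sq : ∀ l, ∀ m ∈ orders l, ∀ t, ‖a l m t‖ ^ 2 = γ l
  summable : Summable fun l => areaWeight l * γ l
  innovation : ∀ l, ∀ m ∈ orders l, IsInnovationOf (a l m) (z l m) (σ2 l)
  pos : ∀ l, 0 < σ2 l
  inner_eq : ∀ l, ∀ m ∈ orders l, ∀ (t : ℤ) (j : ℕ),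
    ⟪z l m (t - j), a l m t⟫_ℂ = ((ψ l j * σ2 l : ℝ) : ℂ)
  pure : ∀ l, ∀ m ∈ orders l, ⨅ n, closedPast (a l m) n = ⊥
  weight_zero : ∀ l k, u l k 0 = 1
  tendsto : ∀ l, ∀ m ∈ orders l, ∀ t,
    Tendsto (fun k => lagSum (a l m) t (u l k)) atTop (𝓝 (z l m t))
  uniform : ∀ l, ∀ ε : ℝ, 0 < ε →
    ∃ k, ∀ m ∈ orders l, ∀ t, ‖lagSum (a l m) t (u l k) - z l m t‖ ≤ ε

namespace InnovationSystem

variable {a z : ℕ → ℤ → ℤ → H} {γ σ2 : ℕ → ℝ} {ψ : ℕ → ℕ → ℝ} {u : ℕ → ℕ → ℕ →₀ ℝ}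

/-- Orthogonality of different sequences at all times passes to their closed pasts, hence to
innovations, residuals and prediction errors alike. -/
theorem orthogonalCoeffs (h : InnovationSystem a z γ σ2 ψ u) {b b' : ℕ → ℤ → H} {t t' : ℤ}
    (hb : ∀ l, ∀ m ∈ orders l, b l m ∈ closedPast (a l m) t)
    (hb' : ∀ l, ∀ m ∈ orders l, b' l m ∈ closedPast (a l m) t') : OrthogonalCoeffs b b' :=
  fun l l' m hm m' hm' hne => by
    refine inner_eq_zero_of_mem_closedPast (fun s _ => ?_) (hb l m hm)
    rw [← inner_conj_symm, inner_eq_zero_of_mem_closedPast (fun s' _ => ?_) (hb' l' m' hm'),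
      map_zero]
    exact h.orthogonal l' l m' hm' m hm (fun e => hne ⟨e.1.symm, e.2.symm⟩) s' s

theorem innovation_mem (h : InnovationSystem a z γ σ2 ψ u) {l : ℕ} {m : ℤ} (hm : m ∈ orders l)
    (t : ℤ) (j : ℕ) : z l m (t - j) ∈ closedPast (a l m) t :=
  closedPast_mono _ (by omega) ((h.innovation l m hm).mem _)

theorem inner_innovation (h : InnovationSystem a z γ σ2 ψ u) {l l' : ℕ} {m m' : ℤ}
    (hm : m ∈ orders l) (hm' : m' ∈ orders l') {s t : ℤ} (hst : s ≠ t) :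
    ⟪z l m s, z l' m' t⟫_ℂ = 0 := by
  by_cases he : l = l' ∧ m = m'
  · obtain ⟨rfl, rfl⟩ := he
    exact (h.innovation l m hm).inner_of_ne hst
  · exact h.orthogonalCoeffs (fun l m hm => (h.innovation l m hm).mem s)
      (fun l m hm => (h.innovation l m hm).mem t) l l' m hm m' hm' he

theorem psi_zero (h : InnovationSystem a z γ σ2 ψ u) (l : ℕ) : ψ l 0 = 1 := by
  have h1 := h.inner_eq l 0 (zero_mem_orders l) 0 0
  rw [Nat.cast_zero, sub_zero, (h.innovation l 0 (zero_mem_orders l)).inner_current] at h1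
  have h2 : σ2 l = ψ l 0 * σ2 l := by exact_mod_cast h1
  exact mul_right_cancel₀ (h.pos l).ne' (by linarith)

/-- The mean squared error of the truncated Wold decomposition. -/
theorem norm_residual_sq (h : InnovationSystem a z γ σ2 ψ u) {l : ℕ} {m : ℤ} (hm : m ∈ orders l)
    (t : ℤ) (J : ℕ) : ‖a l m t - ∑ j ∈ Finset.range J, (ψ l j : ℂ) • z l m (t - j)‖ ^ 2 =
      γ l - σ2 l * ∑ j ∈ Finset.range J, ψ l j ^ 2 := by
  rw [(h.innovation l m hm).norm_residual_sq (h.inner_eq l m hm t), h.norm_sq l m hm]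

theorem residual_nonneg (h : InnovationSystem a z γ σ2 ψ u) (l J : ℕ) :
    0 ≤ γ l - σ2 l * ∑ j ∈ Finset.range J, ψ l j ^ 2 := by
  rw [← h.norm_residual_sq (zero_mem_orders l) 0]
  positivity

theorem residual_le (h : InnovationSystem a z γ σ2 ψ u) (l J : ℕ) :
    γ l - σ2 l * ∑ j ∈ Finset.range J, ψ l j ^ 2 ≤ γ l :=
  sub_le_self _ (mul_nonneg (h.pos l).le (Finset.sum_nonneg fun _ _ => sq_nonneg _))

theorem tendsto_wold [CompleteSpace H] (h : InnovationSystem a z γ σ2 ψ u) {l : ℕ} {m : ℤ}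
    (hm : m ∈ orders l) (t : ℤ) :
    Tendsto (fun J => ∑ j ∈ Finset.range J, (ψ l j : ℂ) • z l m (t - j)) atTop
      (𝓝 (a l m t)) := by
  have h1 := (h.innovation l m hm).tendsto_wold (h.pos l).ne' (h.pure l m hm) t
  refine h1.congr fun J => Finset.sum_congr rfl fun j _ => ?_
  rw [h.inner_eq l m hm, Complex.ofReal_mul,
    mul_div_cancel_right₀ _ (by exact_mod_cast (h.pos l).ne')]

/-- The Wold expansion converges, so its error vanishes; the error does not depend on order or time,
and order `0` at time `0` suffices. -/
theorem tendsto_residual [CompleteSpace H] (h : InnovationSystem a z γ σ2 ψ u) (l : ℕ) :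
    Tendsto (fun J => γ l - σ2 l * ∑ j ∈ Finset.range J, ψ l j ^ 2) atTop (𝓝 0) := by
  have h1 := (((tendsto_const_nhds (x := a l 0 0)).sub (h.tendsto_wold (zero_mem_orders l) 0)).norm).pow 2
  rw [sub_self, norm_zero, zero_pow two_ne_zero] at h1
  exact h1.congr fun J => h.norm_residual_sq (zero_mem_orders l) 0 J

theorem psi_sq_mul_le (h : InnovationSystem a z γ σ2 ψ u) (l j : ℕ) :
    ψ l j ^ 2 * σ2 l ≤ γ l := by
  have h1 := h.residual_nonneg l (j + 1)
  have h2 := mul_le_mul_of_nonneg_left (Finset.single_le_sum (f := fun j => ψ l j ^ 2)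
    (fun _ _ => sq_nonneg _) (Finset.self_mem_range_succ j)) (h.pos l).le
  linarith

theorem variance_le (h : InnovationSystem a z γ σ2 ψ u) (l : ℕ) : σ2 l ≤ γ l := by
  simpa [h.psi_zero] using h.psi_sq_mul_le l 0

theorem summable_psi_sq (h : InnovationSystem a z γ σ2 ψ u) (l : ℕ) :
    Summable fun j => ψ l j ^ 2 := by
  refine summable_of_sum_range_le (c := γ l / σ2 l) (fun j => sq_nonneg _) fun J => ?_
  rw [le_div_iff₀ (h.pos l), mul_comm]
  linarith [h.residual_nonneg l J]

theorem summable_variance (h : InnovationSystem a z γ σ2 ψ u) :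
    Summable fun l => areaWeight l * σ2 l :=
  h.summable.of_nonneg_of_le (fun l => mul_nonneg (areaWeight_pos l).le (h.pos l).le)
    fun l => mul_le_mul_of_nonneg_left (h.variance_le l) (areaWeight_pos l).le

/-- Coefficients in the past of the sequences form a convergent harmonic series. -/
theorem harmonicBound (h : InnovationSystem a z γ σ2 ψ u) {b : ℕ → ℤ → H} {B : ℕ → ℝ} {t : ℤ}
    (hb : ∀ l, ∀ m ∈ orders l, b l m ∈ closedPast (a l m) t)
    (hB : ∀ l, ∀ m ∈ orders l, ‖b l m‖ ^ 2 ≤ B l) (hsum : Summable fun l => areaWeight l * B l) :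
    HarmonicBound b B := ⟨h.orthogonalCoeffs hb hb, hB, hsum⟩

theorem harmonicBound_innovation (h : InnovationSystem a z γ σ2 ψ u) (t : ℤ) :
    HarmonicBound (fun l m => z l m t) σ2 :=
  h.harmonicBound (fun l m hm => (h.innovation l m hm).mem t)
    (fun l m hm => ((h.innovation l m hm).norm_sq t).le) h.summable_variance

/-- A representation as a moving average of orthogonal elements of the past is the Wold
decomposition. -/
theorem unique [CompleteSpace H] (h : InnovationSystem a z γ σ2 ψ u) {l : ℕ} {m : ℤ}
    (hm : m ∈ orders l) {W : ℤ → H} {ψ' : ℕ → ℝ} (hmem : ∀ t, W t ∈ closedPast (a l m) t)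
    (horth : ∀ s t, s ≠ t → ⟪W s, W t⟫_ℂ = 0) (hψ : ψ' 0 = 1)
    (hlim : ∀ t, Tendsto (fun J => ∑ j ∈ Finset.range (J + 1), (ψ' j : ℂ) • W (t - j)) atTop
      (𝓝 (a l m t))) : W = z l m ∧ ψ' = ψ l := by
  have h1 := (h.innovation l m hm).unique hmem horth hψ hlim
  refine ⟨h1, funext fun j => ?_⟩
  subst h1
  -- Pairing with the innovation at lag `j` recovers the coefficient; the pairing with partial sums
  -- is constant once `J ≥ j`.
  have h2 := (tendsto_const_nhds (x := z l m (0 - j))).inner (𝕜 := ℂ) (hlim 0)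
  have h3 : Tendsto (fun _ : ℕ => ((ψ' j * σ2 l : ℝ) : ℂ)) atTop
      (𝓝 ⟪z l m (0 - j), a l m 0⟫_ℂ) := by
    refine h2.congr' (eventually_atTop.2 ⟨j, fun J hJ => ?_⟩)
    rw [inner_sum, Finset.sum_eq_single_of_mem j (Finset.mem_range.2 (by omega))]
    · rw [inner_smul_right, (h.innovation l m hm).inner_self]
      push_cast
      rfl
    · intro i _ hi
      rw [inner_smul_right, (h.innovation l m hm).inner_of_ne (by omega), mul_zero]
  have h4 := tendsto_nhds_unique tendsto_const_nhds h3
  rw [h.inner_eq l m hm] at h4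
  exact mul_right_cancel₀ (h.pos l).ne' (Complex.ofReal_injective h4)

end InnovationSystem

end SphereTime

/-! ### Real fields and the innovation system of an isotropic stationary field -/

namespace SphereTime

open scoped ComplexConjugate InnerProductSpace

theorem harmonicCoeff_neg {Ω : Type*} (X : S2 → Ω → ℝ) (l : ℕ) (m : ℤ) (ω : Ω) :
    harmonicCoeff (fun x ω => (X x ω : ℂ)) l (-m) ω =
      (-1) ^ m.natAbs * conj (harmonicCoeff (fun x ω => (X x ω : ℂ)) l m ω) := by
  rw [harmonicCoeff, harmonicCoeff, ← integral_conj, ← integral_const_mul]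
  congr 1
  ext x
  rw [map_mul, Complex.conj_ofReal, Complex.conj_conj, conj_sphericalHarmonic, neg_neg,
    Int.natAbs_neg]
  ring

section Conj

variable {Ω : Type*} [MeasurableSpace Ω] {P : Measure Ω}

/-- Complex conjugation on `L²`, as a real linear map. -/
def conjLp (P : Measure Ω) : Lp ℂ 2 P →L[ℝ] Lp ℂ 2 P :=
  (Complex.conjCLE : ℂ →L[ℝ] ℂ).compLpL 2 P

theorem coeFn_conjLp (f : Lp ℂ 2 P) : (conjLp P f : Ω → ℂ) =ᵐ[P] fun ω => conj (f ω) :=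
  (Complex.conjCLE : ℂ →L[ℝ] ℂ).coeFn_compLpL f

theorem conjLp_ofReal_smul (c : ℝ) (f : Lp ℂ 2 P) :
    conjLp P ((c : ℂ) • f) = (c : ℂ) • conjLp P f := by
  rw [Complex.coe_smul, Complex.coe_smul]
  exact map_smul (conjLp P) c f

theorem conjLp_lagSum (a : ℤ → Lp ℂ 2 P) (t : ℤ) (u : ℕ →₀ ℝ) :
    conjLp P (lagSum a t u) = lagSum (fun s => conjLp P (a s)) t u := by
  simp only [lagSum, Finsupp.sum, map_sum, conjLp_ofReal_smul]

/-- The coefficients of a real field. -/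
def RealCoeffs (b : ℕ → ℤ → Lp ℂ 2 P) : Prop :=
  ∀ l, ∀ m ∈ orders l, b l (-m) = (((-1) ^ m.natAbs : ℝ) : ℂ) • conjLp P (b l m)

theorem RealCoeffs.ae_eq {b : ℕ → ℤ → Lp ℂ 2 P} (h : RealCoeffs b) {l : ℕ} {m : ℤ}
    (hm : m ∈ orders l) :
    (b l (-m) : Ω → ℂ) =ᵐ[P] fun ω => (-1) ^ m.natAbs * conj (b l m ω) := by
  rw [h l m hm]
  filter_upwards [Lp.coeFn_smul (((-1) ^ m.natAbs : ℝ) : ℂ) (conjLp P (b l m)),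
    coeFn_conjLp (b l m)] with ω h1 h2
  rw [h1, Pi.smul_apply, h2, smul_eq_mul]
  push_cast
  rfl

theorem realCoeffs_coeffL2 {X : S2 → Ω → ℝ}
    (h : ∀ l, ∀ m ∈ orders l, MemLp (harmonicCoeff (fun x ω => (X x ω : ℂ)) l m) 2 P) :
    RealCoeffs (coeffL2 P X) := by
  intro l m hm
  symm
  refine (eq_toL2_iff (h l (-m) (neg_mem_orders hm)) _).2 ?_
  filter_upwards [Lp.coeFn_smul (((-1) ^ m.natAbs : ℝ) : ℂ) (conjLp P (coeffL2 P X l m)),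
    coeFn_conjLp (coeffL2 P X l m), coeFn_toL2 (h l m hm)] with ω h1 h2 h3
  rw [h1, Pi.smul_apply, h2, harmonicCoeff_neg, coeffL2, h3, smul_eq_mul]
  push_cast
  rfl

/-- The approximating weights are real and common to the orders `m` and `-m`, so the moving averages
keep the symmetry and their limits inherit it. -/
theorem InnovationSystem.realCoeffs {a z : ℕ → ℤ → ℤ → Lp ℂ 2 P} {γ σ2 : ℕ → ℝ} {ψ : ℕ → ℕ → ℝ}
    {u : ℕ → ℕ → ℕ →₀ ℝ} (h : InnovationSystem a z γ σ2 ψ u)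
    (ha : ∀ t, RealCoeffs fun l m => a l m t) (t : ℤ) : RealCoeffs fun l m => z l m t := by
  intro l m hm
  have h1 := ((((conjLp P).continuous.tendsto _).comp (h.tendsto l m hm t)).const_smul
    (((-1) ^ m.natAbs : ℝ) : ℂ))
  refine tendsto_nhds_unique (h.tendsto l (-m) (neg_mem_orders hm) t) (h1.congr fun k => ?_)
  rw [Function.comp_apply, conjLp_lagSum, lagSum, lagSum, Finsupp.smul_sum]
  refine Finsupp.sum_congr fun j _ => ?_
  have h2 : a l (-m) (t - j) = _ := ha (t - j) l m hm
  rw [h2, smul_comm]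

/-- A convergent harmonic series with the symmetry of a real field is the expansion of a jointly
measurable real field. -/
theorem exists_real_field {b : ℕ → ℤ → Lp ℂ 2 P} {B : ℕ → ℝ}
    (hb : HarmonicBound b B) (hr : RealCoeffs b) :
    ∃ X : S2 → Ω → ℝ, Measurable (fun z : S2 × Ω => X z.1 z.2) ∧ (∀ x, MemLp (X x) 2 P) ∧
      ∀ x, Tendsto (fun L => harmonicSum (Finset.range L) b x) atTop (𝓝 (fieldL2 P X x)) := by
  obtain ⟨F, hF, hL, hlim, hconj⟩ := exists_measurable_field hb
  refine ⟨fun x ω => (F x ω).re, Complex.measurable_re.comp hF, fun x => (hL x).re, fun x => ?_⟩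
  have h1 : F x =ᵐ[P] fun ω => ((F x ω).re : ℂ) := by
    filter_upwards [hconj (fun l m hm => hr.ae_eq hm) x] with ω hω
    exact (Complex.conj_eq_iff_re.1 hω).symm
  rw [fieldL2, ← toL2_congr h1]
  exact hlim x

end Conj

section Isotropic

variable {Ω : Type*} [MeasurableSpace Ω] {P : Measure Ω}

/-- Fields that are isotropic at every time have pointwise convergent harmonic expansions. -/
theorem IsSecondOrderField.hasExpansion [IsProbabilityMeasure P]
    {X : S2 → ℤ → Ω → ℝ} (hX : IsSecondOrderField P X)
    (hinv : ∀ (g : Matrix.specialOrthogonalGroup (Fin 3) ℝ) (x y : S2) (t : ℤ),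
      ∫ ω, X x t ω * X y t ω ∂P = ∫ ω, X (rotate g x) t ω * X (rotate g y) t ω ∂P) :
    HasCoeffs P X (fun l m t => coeffL2 P (fun x => X x t) l m) ∧
    HasExpansion P (fun x t ω => (X x t ω : ℂ)) (fun l m t => coeffL2 P (fun x => X x t) l m) ∧
    ∀ t, ∃ γ : ℕ → ℝ, (∀ l, ∀ m ∈ orders l, ‖coeffL2 P (fun x => X x t) l m‖ ^ 2 = γ l) ∧
      Summable fun l => areaWeight l * γ l := by
  have h := fun t => tendsto_harmonicSum_of_isotropic (X := fun x => X x t) (hX.measurable t)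
    (fun x => hX.memLp x t) fun g x y => (hinv g x y t).symm
  choose C γ hiso hgram hsum hlim using h
  refine ⟨⟨fun l m t => measurable_harmonicCoeff (F := fun x ω => (X x t ω : ℂ))
      (hiso t).measurable_complex l m, fun l m hm t => coeFn_toL2 ((hiso t).memLp_coeff hm)⟩,
    ⟨fun t => (hiso t).measurable_complex, fun x t => (hX.memLp x t).ofReal,
      fun x t => hlim t x⟩, fun t => ⟨γ t, fun l m hm => ?_, hsum t⟩⟩
  rw [← inner_self_eq_norm_sq (𝕜 := ℂ), hgram t l l m hm m hm]
  simp

variable {T : S2 → ℤ → Ω → ℝ}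

theorem IsIsotropicStationary.isotropic (hT : IsIsotropicStationary P T)
    (g : Matrix.specialOrthogonalGroup (Fin 3) ℝ) (x y : S2) (t : ℤ) :
    ∫ ω, T x t ω * T y t ω ∂P = ∫ ω, T (rotate g x) t ω * T (rotate g y) t ω ∂P := by
  simpa using hT.invariant g x y t t 0

theorem IsIsotropicStationary.isJointlyIsotropic (hT : IsIsotropicStationary P T) (s t : ℤ) :
    IsJointlyIsotropic P (fun x => T x s) (fun x => T x t)
      (∫ ω, T northPole 0 ω * T northPole 0 ω ∂P) := by
  have hc : ∀ x t, ∫ ω, T x t ω * T x t ω ∂P = ∫ ω, T northPole 0 ω * T northPole 0 ω ∂P := by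
    intro x t
    obtain ⟨g, hg⟩ := exists_rotate_eq_northPole x
    have := hT.invariant g x x t t (-t)
    rwa [hg, add_neg_cancel] at this
  exact ⟨hT.measurable s, hT.measurable t, fun x => hT.memLp x s, fun x => hT.memLp x t,
    fun x => (hc x s).le, fun x => (hc x t).le, fun g x y => by
      simpa using (hT.invariant g x y s t 0).symm⟩

/-- The harmonic coefficients of an isotropic stationary field are uncorrelated across degrees
and orders, with a covariance depending on the degree and the time lag only. -/
theorem IsIsotropicStationary.exists_gram [IsProbabilityMeasure P]
    (hT : IsIsotropicStationary P T) :
    ∃ γ : ℕ → ℤ → ℝ, ∀ l l' : ℕ, ∀ m ∈ orders l, ∀ m' ∈ orders l', ∀ s t,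
      ⟪coeffL2 P (fun x => T x s) l' m', coeffL2 P (fun x => T x t) l m⟫_ℂ =
        if l = l' ∧ m = m' then (γ l (t - s) : ℂ) else 0 := by
  choose γ hγ using fun (l : ℕ) (h : ℤ) => (hT.isJointlyIsotropic 0 h).exists_eigenvalue l
  refine ⟨γ, fun l l' m hm m' hm' s t =>
    (hT.isJointlyIsotropic s t).inner_coeff_coeff (fun m hm x => ?_) hm hm'⟩
  rw [← hγ l (t - s) m hm x]
  congr 1
  ext y
  -- A pure time shift reduces the kernel to times `0` and `t - s`, the one that defines `γ l (t -
  -- s)`.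
  have h1 := hT.invariant 1 x y s t (-s)
  rw [rotate_one, rotate_one, add_neg_cancel, ← sub_eq_add_neg] at h1
  rw [h1]

/-- All orders of a degree share the covariance `γ l`, so `exists_isInnovation` gives them common
weights and correlations `ρ`. Its variance is the prediction error by `iInf_norm_sq`, and positivity
permits `ψ = ρ / σ²`. -/
theorem IsIsotropicStationary.exists_innovationSystem [IsProbabilityMeasure P]
    (hT : IsIsotropicStationary P T)
    (hpos : ∀ l, 0 < innovationVariance P T l)
    (hpure : ∀ l, ∀ m ∈ orders l, remotePast P T l m = ⊥) :
    ∃ z γ ψ u, InnovationSystem (fun l m t => coeffL2 P (fun x => T x t) l m) z γ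
      (innovationVariance P T) ψ u := by
  obtain ⟨hcoef, -, hsum⟩ := hT.toIsSecondOrderField.hasExpansion hT.isotropic
  obtain ⟨γ, hγ⟩ := hT.exists_gram
  set a : ℕ → ℤ → ℤ → Lp ℂ 2 P := fun l m t => coeffL2 P (fun x => T x t) l m with ha
  have hnorm : ∀ l, ∀ m ∈ orders l, ∀ t, ‖a l m t‖ ^ 2 = γ l 0 := fun l m hm t => by
    rw [← inner_self_eq_norm_sq (𝕜 := ℂ), hγ l l m hm m hm]
    simp
  have hex : ∀ l, ∃ u Z σ2 ρ, IsInnovation (fun m : {m // m ∈ orders l} => a l m) u Z σ2 ρ :=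
    fun l => by
      have : Nonempty {m // m ∈ orders l} := ⟨⟨0, zero_mem_orders l⟩⟩
      refine exists_isInnovation _ (γ l) fun m s t => ?_
      rw [hγ l l m m.2 m m.2, if_pos ⟨rfl, rfl⟩]
  choose u Z σ2 ρ hinn using hex
  have hσ : σ2 = innovationVariance P T := by
    ext l
    rw [innovationVariance, hcoef.predictionError_eq (zero_mem_orders l),
      ((hinn l).of ⟨0, zero_mem_orders l⟩).iInf_norm_sq]
  subst hσ
  classical
  -- The value zero outside `orders l` is a default; no field of the system looks at it.
  let z : ℕ → ℤ → ℤ → Lp ℂ 2 P := fun l m t => if hm : m ∈ orders l then Z l ⟨m, hm⟩ t else 0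
  have hz : ∀ l m (hm : m ∈ orders l), z l m = Z l ⟨m, hm⟩ := fun l m hm => by
    ext1 t
    exact dif_pos hm
  refine ⟨z, fun l => γ l 0, fun l j => ρ l j / innovationVariance P T l, u, ?_⟩
  refine ⟨fun l l' m hm m' hm' hne s t => ?_, hnorm, ?_, fun l m hm => ?_, hpos,
    fun l m hm t j => ?_, fun l m hm => ?_, fun l => (hinn l).weight_zero, fun l m hm t => ?_,
    fun l ε hε => ?_⟩
  · rw [hγ l' l m' hm' m hm, if_neg fun e => hne ⟨e.1.symm, e.2.symm⟩]
  · obtain ⟨γ', h1, h2⟩ := hsum 0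
    refine h2.congr fun l => ?_
    rw [← h1 l 0 (zero_mem_orders l)]
    exact congrArg _ (hnorm l 0 (zero_mem_orders l) 0)
  · rw [hz l m hm]
    exact (hinn l).of ⟨m, hm⟩
  · rw [hz l m hm, (hinn l).inner_eq ⟨m, hm⟩, div_mul_cancel₀ _ (hpos l).ne', sub_sub_cancel]
  · rw [← hcoef.remotePast_eq hm, hpure l m hm]
  · rw [hz l m hm]
    exact (hinn l).tendsto ⟨m, hm⟩ t
  · obtain ⟨K, hK⟩ := (hinn l).uniform ε hε
    refine ⟨K, fun m hm t => ?_⟩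
    rw [hz l m hm]
    exact hK K le_rfl ⟨m, hm⟩ t

end Isotropic

end SphereTime

/-! ### Uniqueness of the decomposition and the two approximations -/

namespace SphereTime

open scoped ComplexConjugate InnerProductSpace

variable {Ω : Type*} [MeasurableSpace Ω] {P : Measure Ω}

theorem HasExpansion.congr {F : S2 → ℤ → Ω → ℂ} {b b' : ℕ → ℤ → ℤ → Lp ℂ 2 P}
    (h : HasExpansion P F b) (hb : ∀ l, ∀ m ∈ orders l, ∀ t, b l m t = b' l m t) :
    HasExpansion P F b' where
  measurable := h.measurable
  memLp := h.memLp
  tendsto x t := (h.tendsto x t).congr fun _ =>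
    harmonicSum_congr (fun l _ m hm => hb l m hm t) x

variable [IsProbabilityMeasure P]

/-- A mean square limit of the sums `∑ w_ℓ a_{ℓ,m;X}(t) Y_{ℓ,m}` has coefficients
`w_ℓ a_{ℓ,m;X}(t)`. -/
theorem HasCoeffs.toL2_harmonicCoeff_limit {X : S2 → ℤ → Ω → ℝ} {a : ℕ → ℤ → ℤ → Lp ℂ 2 P}
    (hX : HasCoeffs P X a) {w : ℕ → ℝ} {F : S2 → ℤ → Ω → ℂ}
    (hF : ∀ t, Measurable fun z : S2 × Ω => F z.1 t z.2)
    (h : ConvergesTo P (fun L x t ω => bandLimited w X L x t ω) F) (t : ℤ) :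
    MemLp (fun z : S2 × Ω => F z.1 t z.2) 2 (surface.prod P) ∧
    ∀ l, ∀ m ∈ orders l,
      toL2 P (harmonicCoeff (fun x ω => F x t ω) l m) = (w l : ℂ) • a l m t := by
  have h1 := h.2 t
  simp_rw [bandLimited_eq_harmonicSum] at h1
  have hβ : ∀ l, ∀ m ∈ orders l, MemLp (fun ω => (w l : ℂ) * coeff X l m t ω) 2 P :=
    fun l m hm => (hX.memLp hm t).const_mul _
  refine ⟨memLp_of_tendsto_meanSq (fun L => memLp_prod_harmonicSum
    (β := fun l m ω => (w l : ℂ) * coeff X l m t ω) fun l _ => hβ l)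
    (hF t).aestronglyMeasurable h1, fun l m hm => ?_⟩
  rw [toL2_harmonicCoeff_of_tendsto (F := fun x ω => F x t ω)
    (β := fun l m ω => (w l : ℂ) * coeff X l m t ω)
    (fun l m _ => (hX.measurable l m t).const_mul _) hβ (hF t) h1 hm,
    toL2_const_mul _ (hX.memLp hm t), hX.toL2_eq hm]

variable {T Z V : S2 → ℤ → Ω → ℝ} {psi : ℕ → ℕ → ℝ} {a z : ℕ → ℤ → ℤ → Lp ℂ 2 P} {γ σ2 : ℕ → ℝ}
  {ψ : ℕ → ℕ → ℝ} {u : ℕ → ℕ → ℕ →₀ ℝ}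

/-- Every Wold decomposition consists of the innovations and the Wold coefficients. -/
theorem IsWoldDecomposition.eq_innovation (hW : IsWoldDecomposition P T psi Z V)
    (hTm : ∀ t, Measurable fun z : S2 × Ω => T z.1 t z.2) (hT : HasCoeffs P T a)
    (h : InnovationSystem a z γ σ2 ψ u) :
    psi = ψ ∧ HasCoeffs P Z z ∧ HasExpansion P (fun x t ω => (Z x t ω : ℂ)) z := by
  obtain ⟨hZc, hZe, -⟩ := hW.noise.toIsSecondOrderField.hasExpansion hW.noise.isotropic
  set aZ : ℕ → ℤ → ℤ → Lp ℂ 2 P := fun l m t => coeffL2 P (fun x => Z x t) l m with haZ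
  have hVm : ∀ t, Measurable fun z : S2 × Ω => (V z.1 t z.2 : ℂ) := fun t =>
    Complex.measurable_ofReal.comp (hW.remainder.measurable t)
  -- The coefficients of `V` lie in the remote past, which is zero.
  have hVc : HasCoeffs P V fun _ _ _ => 0 :=
    ⟨fun l m t => measurable_harmonicCoeff (F := fun x ω => (V x t ω : ℂ)) (hVm t) l m,
      fun l m hm t => by
        obtain ⟨f, hf, hfe⟩ := hW.remainder_mem l m hm t
        rw [hT.remotePast_eq hm, h.pure l m hm, Submodule.mem_bot] at hf
        rwa [hf] at hfe⟩
  have hV := hVc.toL2_harmonicCoeff_limit (F := fun x t ω => (V x t ω : ℂ)) hVm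
    hW.remainder_expansion
  obtain ⟨PsiZ, hΨm, hΨ, hlim⟩ := hW.expansion
  have hΨc := fun j => hZc.toL2_harmonicCoeff_limit (hΨm j) (hΨ j)
  -- Coefficients are continuous for convergence on the product space, so the field expansion
  -- becomes a moving average for each `(l, m)`, to which `InnovationSystem.unique` applies.
  have hsum : ∀ l, ∀ m ∈ orders l, ∀ t, Tendsto
      (fun J => ∑ j ∈ Finset.range (J + 1), (psi l j : ℂ) • aZ l m (t - j)) atTop
      (𝓝 (a l m t)) := by
    intro l m hm t
    have hSm : ∀ J : ℕ, Measurable fun z : S2 × Ω =>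
        ∑ j ∈ Finset.range (J + 1), PsiZ j z.1 (t - j) z.2 := fun J =>
      Finset.measurable_sum _ fun j _ => hΨm j (t - j)
    have hS2 : ∀ J : ℕ, MemLp (fun z : S2 × Ω =>
        ∑ j ∈ Finset.range (J + 1), PsiZ j z.1 (t - j) z.2) 2 (surface.prod P) := fun J =>
      memLp_finsetSum _ fun j _ => (hΨc j (t - j)).1
    have h1 := tendsto_harmonicCoeff
      (S := fun J x ω => (∑ j ∈ Finset.range (J + 1), PsiZ j x (t - j) ω) + (V x t ω : ℂ))
      (F := fun x ω => (T x t ω : ℂ)) (fun J => (hSm J).add (hVm t))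
      (fun J => (hS2 J).add (hV t).1) (Complex.measurable_ofReal.comp (hTm t)) (hlim.2 t) hm
    have h2 : toL2 P (harmonicCoeff (fun x ω => (T x t ω : ℂ)) l m) = a l m t := hT.toL2_eq hm t
    rw [h2] at h1
    refine h1.congr fun J => ?_
    have hL : ∀ j : ℕ, MemLp (harmonicCoeff (fun x ω => PsiZ j x (t - j) ω) l m) 2 P := fun j =>
      memLp_harmonicCoeff (hΨm j (t - j)) (hΨc j (t - j)).1 hm
    have h3 := harmonicCoeff_add_ae
      (F := fun x ω => ∑ j ∈ Finset.range (J + 1), PsiZ j x (t - j) ω)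
      (G := fun x ω => (V x t ω : ℂ)) (hSm J) (hS2 J) (hVm t) (hV t).1 l m
    have h4 := harmonicCoeff_sum_ae (Finset.range (J + 1))
      (F := fun (j : ℕ) x ω => PsiZ j x (t - j) ω) (fun j => hΨm j (t - j))
      (fun j => (hΨc j (t - j)).1) l m
    have h5 : harmonicCoeff (fun x ω =>
        (∑ j ∈ Finset.range (J + 1), PsiZ j x (t - j) ω) + (V x t ω : ℂ)) l m =ᵐ[P] fun ω =>
        (∑ j ∈ Finset.range (J + 1), harmonicCoeff (fun x ω => PsiZ j x (t - j) ω) l m ω) +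
          harmonicCoeff (fun x ω => (V x t ω : ℂ)) l m ω := by
      filter_upwards [h3, h4] with ω h3 h4
      rw [h3, h4]
    rw [toL2_congr h5, toL2_add (memLp_finsetSum _ fun j _ => hL j)
      (memLp_harmonicCoeff (F := fun x ω => (V x t ω : ℂ)) (hVm t) (hV t).1 hm), (hV t).2 l m hm,
      smul_zero, add_zero, toL2_sum _ fun j _ => hL j]
    exact Finset.sum_congr rfl fun j _ => (hΨc j (t - j)).2 l m hm
  have huniq : ∀ l, ∀ m ∈ orders l, aZ l m = z l m ∧ psi l = ψ l := fun l m hm => by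
    refine h.unique hm (fun t => ?_) (fun s t hst => ?_) (hW.psi_zero l) (hsum l m hm)
    · obtain ⟨f, hf, hfe⟩ := hW.noise_mem l m hm t
      rw [hT.past_eq hm] at hf
      rw [← hZc.toL2_eq hm, ← (eq_toL2_iff (hZc.memLp hm t) f).2 hfe]
      exact hf
    · rw [← hZc.integral_coeff_mul_conj hZc hm hm t s]
      exact hW.noise.uncorrelated t s hst.symm l l m hm m hm
  refine ⟨funext fun l => (huniq l 0 (zero_mem_orders l)).2, ⟨hZc.measurable, fun l m hm t => ?_⟩,
    hZe.congr fun l m hm t => congrFun (huniq l m hm).1 t⟩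
  rw [← congrFun (huniq l m hm).1 t]
  exact hZc.ae_eq l m hm t

/-- The dominated errors of a sequence of approximations are eventually small. -/
theorem exists_boundedBy {E : ℕ → S2 → ℤ → Ω → ℂ} {b : ℕ → ℕ → ℤ → ℤ → Lp ℂ 2 P}
    (hE : ∀ n, HasExpansion P (E n) (b n)) (h : InnovationSystem a z γ σ2 ψ u)
    (hb : ∀ n l, ∀ m ∈ orders l, ∀ t, b n l m t ∈ closedPast (a l m) t) {f : ℕ → ℕ → ℝ}
    (hbf : ∀ n l, ∀ m ∈ orders l, ∀ t, ‖b n l m t‖ ^ 2 ≤ f n l) (hf : ∀ n l, f n l ≤ γ l)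
    (hlim : ∀ l, Tendsto (fun n => f n l) atTop (𝓝 0)) {ε : ℝ} (hε : 0 < ε) :
    ∃ n, BoundedBy P ε (E n) := by
  have hf0 : ∀ n l, 0 ≤ f n l := fun n l =>
    le_trans (by positivity) (hbf n l 0 (zero_mem_orders l) 0)
  obtain ⟨h1, h2⟩ := tendsto_tsum_weighted h.summable hf0 hf hlim
  obtain ⟨n, hn⟩ := (h2.eventually_lt_const hε).exists
  have h3 := (hE n).boundedBy fun t => h.harmonicBound (fun l m hm => hb n l m hm t)
    (fun l m hm => hbf n l m hm t) (h1 n)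
  exact ⟨n, fun x t => (h3.1 x t).trans (ENNReal.ofReal_le_ofReal hn.le),
    fun t => (h3.2 t).trans (ENNReal.ofReal_le_ofReal hn.le)⟩

/-- Approximation by moving averages of finite order of finitely many degrees. -/
theorem InnovationSystem.exists_movingAverage (h : InnovationSystem a z γ σ2 ψ u)
    (hTe : HasExpansion P (fun x t ω => (T x t ω : ℂ)) a) (hZ : HasCoeffs P Z z)
    (hZe : HasExpansion P (fun x t ω => (Z x t ω : ℂ)) z) {ε : ℝ} (hε : 0 < ε) :
    ∃ n, BoundedBy P ε (fun x t ω => (T x t ω : ℂ) - (Z x t ω : ℂ) -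
      ∑ j ∈ Finset.Icc 1 n, bandLimited (fun l => ψ l j) Z n x (t - (j : ℤ)) ω) := by
  -- One `n` truncates degrees and lags. Up to degree `n` the error is the Wold residual with `n +
  -- 1` terms, the term `j = 0` being `Z`; beyond, it is `a - z`. Both have squared norm at most `γ
  -- l`.
  refine exists_boundedBy (h := h) (f := fun n l => if l ≤ n then
    γ l - σ2 l * ∑ j ∈ Finset.range (n + 1), ψ l j ^ 2 else γ l)
    (fun n => (hTe.sub hZe).sub (HasExpansion.sum (Finset.Icc 1 n) fun j : ℕ =>
      (HasExpansion.bandLimited hZ (fun l => ψ l j) n).lag j)) ?_ ?_ ?_ ?_ hε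
  · intro n l m hm t
    refine Submodule.sub_mem _ (Submodule.sub_mem _ (mem_closedPast _ le_rfl)
      ((h.innovation l m hm).mem t)) (Submodule.sum_mem _ fun j _ => ?_)
    split_ifs
    · exact Submodule.smul_mem _ _ (h.innovation_mem hm t j)
    · exact Submodule.zero_mem _
  · intro n l m hm t
    have hsplit : ∀ f : ℕ → Lp ℂ 2 P, ∑ j ∈ Finset.range (n + 1), f j =
        f 0 + ∑ j ∈ Finset.Icc 1 n, f j := fun f => by
      rw [Finset.sum_range_eq_add_Ico _ (Nat.succ_pos n)]
      rfl
    split_ifs with hl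
    · rw [← h.norm_residual_sq hm t (n + 1), hsplit, h.psi_zero]
      simp only [Nat.cast_zero, sub_zero, Complex.ofReal_one, one_smul, sub_sub]
      exact le_rfl
    · have h1 := h.norm_residual_sq hm t 1
      have h2 := h.residual_le l 1
      simp only [Finset.range_one, Finset.sum_singleton, Nat.cast_zero, sub_zero, h.psi_zero,
        Complex.ofReal_one, one_smul] at h1 h2
      simp only [Finset.sum_const_zero, sub_zero]
      rw [h1]
      exact h2
  · intro n l
    split_ifs
    · exact h.residual_le l _
    · exact le_rfl
  · intro l
    refine ((h.tendsto_residual l).comp (tendsto_add_atTop_nat 1)).congr'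
      (eventually_atTop.2 ⟨l, fun n hn => ?_⟩)
    simp [hn]

/-- Approximation by autoregressions of finite order of finitely many degrees. -/
theorem InnovationSystem.exists_autoregression (h : InnovationSystem a z γ σ2 ψ u)
    (hT : HasCoeffs P T a) (hTe : HasExpansion P (fun x t ω => (T x t ω : ℂ)) a)
    (hZe : HasExpansion P (fun x t ω => (Z x t ω : ℂ)) z) {ε : ℝ} (hε : 0 < ε) :
    ∃ (L p : ℕ) (phi : ℕ → ℕ → ℝ), (∀ l : ℕ, Summable (fun j => phi l j ^ 2)) ∧
      BoundedBy P ε (fun x t ω => (T x t ω : ℂ) -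
        ∑ j ∈ Finset.Icc 1 p, bandLimited (fun l => phi l j) T L x (t - (j : ℤ)) ω -
          (Z x t ω : ℂ)) := by
  -- The squared error allowed, `σ2 l / (n + 1)`, tends to zero in each degree and stays below `γ
  -- l`, as domination requires.
  have hδ : ∀ n l : ℕ, 0 < Real.sqrt (σ2 l / (n + 1)) := fun n l =>
    Real.sqrt_pos.2 (div_pos (h.pos l) (by positivity))
  choose k hk using fun n l => h.uniform l _ (hδ n l)
  -- The largest lag used by the weights of the degrees up to `n`.
  set p : ℕ → ℕ := fun n =>
    (Finset.range (n + 1)).sup fun l => (u l (k n l)).support.sup id with hp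
  have hsupp : ∀ n l, l ≤ n → (u l (k n l)).support ⊆ Finset.range (p n + 1) := by
    intro n l hl j hj
    have h1 : j ≤ (u l (k n l)).support.sup id := Finset.le_sup (f := id) hj
    have h2 : (u l (k n l)).support.sup id ≤ p n :=
      Finset.le_sup (f := fun l => (u l (k n l)).support.sup id)
        (Finset.mem_range.2 (Nat.lt_succ_iff.2 hl))
    exact Finset.mem_range.2 (Nat.lt_succ_iff.2 (h1.trans h2))
  -- Since the weight at `0` is one, negated weights at positive lags are autoregressive
  -- coefficients: the prediction error is exactly the moving average close to `z`.
  have hlag : ∀ n l, l ≤ n → ∀ m t, a l m t - ∑ j ∈ Finset.Icc 1 (p n),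
      ((-(u l (k n l) j) : ℝ) : ℂ) • a l m (t - j) = lagSum (a l m) t (u l (k n l)) := by
    intro n l hl m t
    rw [lagSum, Finsupp.sum_of_support_subset _ (hsupp n l hl) _ (by simp),
      Finset.sum_range_eq_add_Ico _ (Nat.succ_pos _), h.weight_zero]
    simp only [Nat.cast_zero, sub_zero, Complex.ofReal_one, one_smul, Complex.ofReal_neg, neg_smul,
      Finset.sum_neg_distrib, sub_neg_eq_add]
    rfl
  suffices hex : ∃ n, BoundedBy P ε (fun x t ω => (T x t ω : ℂ) -
      ∑ j ∈ Finset.Icc 1 (p n), bandLimited (fun l => -(u l (k n l) j)) T n x (t - (j : ℤ)) ω -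
        (Z x t ω : ℂ)) by
    obtain ⟨n, hn⟩ := hex
    refine ⟨n, p n, fun l j => -(u l (k n l) j), fun l => ?_, hn⟩
    refine summable_of_ne_finset_zero (s := (u l (k n l)).support) fun j hj => ?_
    simp [Finsupp.notMem_support_iff.1 hj]
  -- Degrees above `n` are not predicted; there the error is again `a - z`.
  refine exists_boundedBy (h := h) (f := fun n l => if l ≤ n then σ2 l / (n + 1) else γ l)
    (fun n => (hTe.sub (HasExpansion.sum (Finset.Icc 1 (p n)) fun j : ℕ =>
      (HasExpansion.bandLimited hT (fun l => -(u l (k n l) j)) n).lag j)).sub hZe) ?_ ?_ ?_ ?_ hε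
  · intro n l m hm t
    refine Submodule.sub_mem _ (Submodule.sub_mem _ (mem_closedPast _ le_rfl)
      (Submodule.sum_mem _ fun j _ => ?_)) ((h.innovation l m hm).mem t)
    split_ifs
    · exact Submodule.smul_mem _ _ (mem_closedPast _ (by omega))
    · exact Submodule.zero_mem _
  · intro n l m hm t
    split_ifs with hl
    · rw [hlag n l hl, ← Real.sq_sqrt (div_pos (h.pos l) (show (0 : ℝ) < n + 1 by positivity)).le]
      exact pow_le_pow_left₀ (norm_nonneg _) (hk n l m hm t) 2
    · have h1 := h.norm_residual_sq hm t 1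
      have h2 := h.residual_le l 1
      simp only [Finset.range_one, Finset.sum_singleton, Nat.cast_zero, sub_zero, h.psi_zero,
        Complex.ofReal_one, one_smul] at h1 h2
      simp only [Finset.sum_const_zero, sub_zero]
      rw [h1]
      exact h2
  · intro n l
    split_ifs
    · refine (div_le_self (h.pos l).le ?_).trans (h.variance_le l)
      have : (0 : ℝ) ≤ n := Nat.cast_nonneg n
      linarith
    · exact le_rfl
  · intro l
    refine ((tendsto_const_div_atTop_nhds_zero_nat (σ2 l)).comp (tendsto_add_atTop_nat 1)).congr'
      (eventually_atTop.2 ⟨l, fun n hn => ?_⟩)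
    simp [hn]

end SphereTime

/-! ### Existence of the Wold decomposition -/

namespace SphereTime

open scoped ComplexConjugate InnerProductSpace

theorem coeff_zero {Ω : Type*} (l : ℕ) (m t : ℤ) : coeff (fun _ _ (_ : Ω) => 0) l m t = 0 := by
  ext ω
  simp [coeff]

variable {Ω : Type*} [MeasurableSpace Ω] {P : Measure Ω}
  {T Z : S2 → ℤ → Ω → ℝ} {psi : ℕ → ℕ → ℝ} {a z : ℕ → ℤ → ℤ → Lp ℂ 2 P} {γ σ2 : ℕ → ℝ}
  {ψ : ℕ → ℕ → ℝ} {u : ℕ → ℕ → ℕ →₀ ℝ}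

/-- As an inner product with the constant `1`, the mean is continuous and linear, so its vanishing
passes from the coefficients of `T` to closed pasts, innovations and harmonic series. -/
theorem integral_ofReal_eq_inner [IsProbabilityMeasure P] {f : Ω → ℝ} (hf : MemLp f 2 P) :
    ((∫ ω, f ω ∂P : ℝ) : ℂ) = ⟪toL2 P (fun _ => 1), toL2 P fun ω => (f ω : ℂ)⟫_ℂ := by
  have h1 : MemLp (fun ω => (f ω : ℂ)) 2 P := hf.ofReal
  rw [inner_toL2 (memLp_const 1) h1, ← integral_complex_ofReal]
  simp

/-- The innovations are coefficients of zero-mean fields. -/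
theorem InnovationSystem.integral_eq_zero [IsProbabilityMeasure P]
    (h : InnovationSystem a z γ σ2 ψ u)
    (hTf : IsSecondOrderField P T) (hT : HasCoeffs P T a)
    (hT2 : ∀ t, MemLp (fun z : S2 × Ω => (T z.1 t z.2 : ℂ)) 2 (surface.prod P))
    (hZ2 : ∀ x t, MemLp (Z x t) 2 P) (hZe : HasExpansion P (fun x t ω => (Z x t ω : ℂ)) z) (x : S2)
    (t : ℤ) : ∫ ω, Z x t ω ∂P = 0 := by
  have ha : ∀ l, ∀ m ∈ orders l, ∀ t, ⟪toL2 P (fun _ => 1), a l m t⟫_ℂ = 0 := by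
    intro l m hm t
    rw [← hT.toL2_eq hm, inner_toL2 (memLp_const 1) (hT.memLp hm t)]
    have h1 := integral_mul_harmonicCoeff (F := fun x ω => (T x t ω : ℂ)) (hT2 t)
      (g := fun _ => (1 : ℂ)) (memLp_const 1) l m
    have h2 : ∀ x, ∫ ω, (1 : ℂ) * (T x t ω : ℂ) ∂P = 0 := fun x => by
      simp_rw [one_mul, integral_complex_ofReal, hTf.mean_zero x t, Complex.ofReal_zero]
    simp_rw [h2, zero_mul, integral_zero, one_mul] at h1
    simpa [coeff_eq_harmonicCoeff] using h1
  have hz : ∀ l, ∀ m ∈ orders l, ∀ t, ⟪toL2 P (fun _ => 1), z l m t⟫_ℂ = 0 := fun l m hm t => by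
    rw [← inner_conj_symm, inner_eq_zero_of_mem_closedPast (fun s _ => ?_)
      ((h.innovation l m hm).mem t), map_zero]
    rw [← inner_conj_symm, ha l m hm, map_zero]
  have h1 := (tendsto_const_nhds (x := toL2 P fun _ => (1 : ℂ))).inner (𝕜 := ℂ) (hZe.tendsto x t)
  have h2 : ∀ L, ⟪toL2 P (fun _ => 1), harmonicSum (Finset.range L) (fun l m => z l m t) x⟫_ℂ = 0 :=
    fun L => by
      rw [harmonicSum, inner_sum]
      refine Finset.sum_eq_zero fun l _ => ?_
      rw [inner_sum]
      refine Finset.sum_eq_zero fun m hm => ?_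
      rw [inner_smul_right, hz l m hm, mul_zero]
  simp_rw [h2] at h1
  have h3 := tendsto_nhds_unique tendsto_const_nhds h1
  rw [← integral_ofReal_eq_inner (hZ2 x t)] at h3
  exact_mod_cast h3.symm

/-- The covariance kernel of the innovation field. -/
theorem InnovationSystem.hasSum_covariance (h : InnovationSystem a z γ σ2 ψ u)
    (hZ2 : ∀ x t, MemLp (Z x t) 2 P) (hZe : HasExpansion P (fun x t ω => (Z x t ω : ℂ)) z)
    (x y : S2) (t : ℤ) :
    HasSum (fun l : ℕ => (2 * (l : ℝ) + 1) / (4 * Real.pi) * σ2 l * (legendre l).eval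
      (inner ℝ (x : EuclideanSpace ℝ (Fin 3)) (y : EuclideanSpace ℝ (Fin 3))))
      (∫ ω, Z x t ω * Z y t ω ∂P) := by
  set c : ℕ → ℝ := fun l => (2 * (l : ℝ) + 1) / (4 * Real.pi) * σ2 l * (legendre l).eval
      (inner ℝ (x : EuclideanSpace ℝ (Fin 3)) (y : EuclideanSpace ℝ (Fin 3))) with hc
  -- `HasSum` is unconditional, so absolute summability comes first; the value is then identified
  -- along the initial degrees.
  have hcs : Summable c := by
    refine Summable.of_norm_bounded h.summable_variance fun l => ?_
    have h1 := abs_areaWeight_mul_legendre_le l x y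
    have h2 : c l = (areaWeight l * (legendre l).eval (inner ℝ
        (x : EuclideanSpace ℝ (Fin 3)) (y : EuclideanSpace ℝ (Fin 3)))) * σ2 l := by
      rw [hc, areaWeight]
      ring
    rw [h2, norm_mul, Real.norm_eq_abs, Real.norm_of_nonneg (h.pos l).le]
    exact mul_le_mul_of_nonneg_right h1 (h.pos l).le
  have hx : ∀ x, MemLp (fun ω => (Z x t ω : ℂ)) 2 P := fun x => (hZ2 x t).ofReal
  have h1 := (hZe.tendsto y t).inner (𝕜 := ℂ) (hZe.tendsto x t)
  have h2 : ∀ L, ⟪harmonicSum (Finset.range L) (fun l m => z l m t) y,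
      harmonicSum (Finset.range L) (fun l m => z l m t) x⟫_ℂ =
      ((∑ l ∈ Finset.range L, c l : ℝ) : ℂ) := by
    intro L
    rw [inner_harmonicSum (h.harmonicBound_innovation t).orthogonal]
    push_cast
    refine Finset.sum_congr rfl fun l _ => ?_
    have h3 := addition_formula l x y
    have h4 : ∀ m ∈ orders l, conj (sphericalHarmonic l m y) * sphericalHarmonic l m x *
        ⟪z l m t, z l m t⟫_ℂ =
        sphericalHarmonic l m x * conj (sphericalHarmonic l m y) * (σ2 l : ℂ) := fun m hm => by
      rw [(h.innovation l m hm).inner_self]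
      ring
    rw [Finset.sum_congr rfl h4, ← Finset.sum_mul, h3, hc]
    push_cast
    ring
  simp_rw [h2] at h1
  rw [inner_toL2 (hx y) (hx x)] at h1
  simp_rw [Complex.conj_ofReal, ← Complex.ofReal_mul] at h1
  rw [integral_complex_ofReal] at h1
  have h5 := (Complex.continuous_re.tendsto _).comp h1
  have h6 := tendsto_nhds_unique h5 hcs.hasSum.tendsto_sum_nat
  rw [Complex.ofReal_re] at h6
  rw [h6]
  exact hcs.hasSum

/-- The remainder can be zero. The series of each `Ψ_j Z` converges because `ψ l j ^ 2 * σ2 l ≤ γ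
l`, and the sum over lags converges because its errors are Wold residuals, dominated by `γ`. -/
theorem InnovationSystem.isWoldDecomposition [IsProbabilityMeasure P]
    (hTf : IsSecondOrderField P T) (hT : HasCoeffs P T a)
    (hTe : HasExpansion P (fun x t ω => (T x t ω : ℂ)) a)
    (hT2 : ∀ t, MemLp (fun z : S2 × Ω => (T z.1 t z.2 : ℂ)) 2 (surface.prod P))
    (h : InnovationSystem a z γ (innovationVariance P T) ψ u)
    (hZm : ∀ t, Measurable fun z : S2 × Ω => Z z.1 t z.2)
    (hZ2 : ∀ x t, MemLp (Z x t) 2 P) (hZe : HasExpansion P (fun x t ω => (Z x t ω : ℂ)) z) :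
    IsWoldDecomposition P T ψ Z fun _ _ _ => 0 := by
  have hγ0 : ∀ l, 0 ≤ γ l := fun l => (h.pos l).le.trans (h.variance_le l)
  have hcov := h.hasSum_covariance hZ2 hZe
  have hZc : HasCoeffs P Z z := by
    refine ⟨fun l m t => measurable_harmonicCoeff (F := fun x ω => (Z x t ω : ℂ))
      (hZe.measurable t) l m, fun l m hm t => ?_⟩
    have h1 : MemLp (coeff Z l m t) 2 P := memLp_harmonicCoeff (F := fun x ω => (Z x t ω : ℂ))
      (hZe.measurable t) (hZe.memLp_prod h.harmonicBound_innovation t) hm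
    exact (eq_toL2_iff h1 _).1 (hZe.toL2_harmonicCoeff h.harmonicBound_innovation hm t).symm
  have hΨb : ∀ j t, HarmonicBound (fun l m => (ψ l j : ℂ) • z l m t) γ := fun j t => by
    refine h.harmonicBound (t := t)
      (fun l m hm => Submodule.smul_mem _ _ ((h.innovation l m hm).mem t)) (fun l m hm => ?_)
      h.summable
    rw [norm_smul, mul_pow, (h.innovation l m hm).norm_sq, Complex.norm_real, Real.norm_eq_abs,
      sq_abs]
    exact h.psi_sq_mul_le l j
  choose F hFm hF2 hFlim _ using fun j t => exists_measurable_field (hΨb j t)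
  have hFe : ∀ j, HasExpansion P (fun x t ω => F j t x ω) fun l m t => (ψ l j : ℂ) • z l m t :=
    fun j => ⟨hFm j, fun x t => hF2 j t x, fun x t => hFlim j t x⟩
  have h0 : IsSecondOrderField P (fun (_ : S2) (_ : ℤ) (_ : Ω) => (0 : ℝ)) :=
    ⟨fun _ => measurable_const, fun _ _ => MemLp.zero', fun _ _ => integral_zero _ _⟩
  refine ⟨h.psi_zero, h.summable_psi_sq, ⟨⟨hZm, hZ2, h.integral_eq_zero hTf hT hT2 hZ2 hZe⟩, ?_,
    h.summable_variance, hcov, ?_⟩, fun l m hm t => ?_, h0, ?_, fun l m hm t => ?_, ?_,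
    fun j x t ω => F j t x ω, hFm, fun j => ?_, ?_⟩
  · intro g x y t
    -- The covariance is a series in the inner product alone, so isotropy follows from uniqueness of
    -- sums.
    have h1 := hcov (rotate g x) (rotate g y) t
    simp_rw [inner_rotate] at h1
    exact (hcov x y t).unique h1
  · intro t s hts l l' m hm m' hm'
    rw [hZc.integral_coeff_mul_conj hZc hm hm']
    exact h.inner_innovation hm' hm hts.symm
  · refine ⟨z l m t, ?_, hZc.ae_eq l m hm t⟩
    rw [hT.past_eq hm]
    exact (h.innovation l m hm).mem t
  · simp [ConvergesTo, bandLimited, coeff_zero, meanSq]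
  · refine ⟨0, Submodule.zero_mem _, ?_⟩
    rw [coeff_zero]
    exact Lp.coeFn_zero ℂ 2 P
  · intro l l' m _ m' _ t s
    simp [coeff_zero]
  · exact (hFe j).convergesTo (hΨb j) fun L => HasExpansion.bandLimited hZc (fun l => ψ l j) L
  · have hr0 : ∀ J l, 0 ≤ γ l - innovationVariance P T l *
        ∑ j ∈ Finset.range (J + 1), ψ l j ^ 2 := fun J l => h.residual_nonneg l _
    obtain ⟨h1, h2⟩ := tendsto_tsum_weighted h.summable hr0 (fun J l => h.residual_le l _)
      fun l => (h.tendsto_residual l).comp (tendsto_add_atTop_nat 1)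
    have hE := fun J : ℕ => (HasExpansion.sum (Finset.range (J + 1)) fun j : ℕ =>
      (hFe j).lag j).sub hTe
    refine convergesTo_of_boundedBy (fun J => ?_) h2
    simp only [Complex.ofReal_zero, add_zero]
    refine (hE J).boundedBy fun t => h.harmonicBound (t := t) (fun l m hm => ?_)
      (fun l m hm => ?_) (h1 J)
    · exact Submodule.sub_mem _ (Submodule.sum_mem _ fun j _ => Submodule.smul_mem _ _
        (h.innovation_mem hm t j)) (mem_closedPast _ le_rfl)
    · rw [norm_sub_rev, h.norm_residual_sq hm]

end SphereTime

namespace SphereTime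

theorem exists_woldDecomposition {Ω : Type*} [MeasurableSpace Ω] {P : Measure Ω}
    [IsProbabilityMeasure P] {T : S2 → ℤ → Ω → ℝ} (hT : IsIsotropicStationary P T)
    {z : ℕ → ℤ → ℤ → Lp ℂ 2 P} {γ : ℕ → ℝ} {ψ : ℕ → ℕ → ℝ} {u : ℕ → ℕ → ℕ →₀ ℝ}
    (h : InnovationSystem (fun l m t => coeffL2 P (fun x => T x t) l m) z γ
      (innovationVariance P T) ψ u) : ∃ Z V, IsWoldDecomposition P T ψ Z V := by
  obtain ⟨hTc, hTe, -⟩ := hT.toIsSecondOrderField.hasExpansion hT.isotropic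
  have hr : ∀ t, RealCoeffs fun l m => z l m t := h.realCoeffs fun t =>
    realCoeffs_coeffL2 fun l m hm => hTc.memLp hm t
  choose X hXm hX2 hXlim using fun t => exists_real_field (h.harmonicBound_innovation t) (hr t)
  exact ⟨fun x t => X t x, fun _ _ _ => 0, h.isWoldDecomposition hT.toIsSecondOrderField hTc hTe
    (fun t => (hT.isJointlyIsotropic t t).memLp_complex) hXm (fun x t => hX2 t x)
    ⟨fun t => Complex.measurable_ofReal.comp (hXm t), fun x t => (hX2 t x).ofReal,
      fun x t => hXlim t x⟩⟩

end SphereTime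

end

theorem mainTheorem1 {Ω : Type*} [MeasurableSpace Ω] (P : MeasureTheory.Measure Ω)
    [MeasureTheory.IsProbabilityMeasure P] (T : SphereTime.S2 → ℤ → Ω → ℝ)
    (hT : SphereTime.IsIsotropicStationary P T)
    (hnondet : ∀ l : ℕ, 0 < SphereTime.innovationVariance P T l)
    (hpure : ∀ l : ℕ, ∀ m ∈ SphereTime.orders l, SphereTime.remotePast P T l m = ⊥) :
    (∃ (psi : ℕ → ℕ → ℝ) (Z V : SphereTime.S2 → ℤ → Ω → ℝ),
      SphereTime.IsWoldDecomposition P T psi Z V) ∧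
    ∀ (psi : ℕ → ℕ → ℝ) (Z V : SphereTime.S2 → ℤ → Ω → ℝ),
      SphereTime.IsWoldDecomposition P T psi Z V →
      (∀ ε : ℝ, 0 < ε → ∃ L q : ℕ,
        SphereTime.BoundedBy P ε (fun x t ω =>
          (T x t ω : ℂ) - (Z x t ω : ℂ) -
            ∑ j ∈ Finset.Icc 1 q,
              SphereTime.bandLimited (fun l => psi l j) Z L x (t - (j : ℤ)) ω)) ∧
      (∀ ε : ℝ, 0 < ε → ∃ (L p : ℕ) (phi : ℕ → ℕ → ℝ),
        (∀ l : ℕ, Summable (fun j => phi l j ^ 2)) ∧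
        SphereTime.BoundedBy P ε (fun x t ω =>
          (T x t ω : ℂ) -
            ∑ j ∈ Finset.Icc 1 p,
              SphereTime.bandLimited (fun l => phi l j) T L x (t - (j : ℤ)) ω -
            (Z x t ω : ℂ))) := by
  obtain ⟨z, γ, ψ, u, h⟩ := hT.exists_innovationSystem hnondet hpure
  obtain ⟨hTc, hTe, -⟩ := hT.toIsSecondOrderField.hasExpansion hT.isotropic
  refine ⟨⟨ψ, SphereTime.exists_woldDecomposition hT h⟩, fun psi Z V hW => ?_⟩
  -- An arbitrary decomposition has the coefficients `ψ` and a noise with coefficients `z`, so the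
  -- estimates of the innovation system apply to it.
  obtain ⟨rfl, hZc, hZe⟩ := hW.eq_innovation hT.measurable hTc h
  refine ⟨fun ε hε => ?_, fun ε hε => h.exists_autoregression hTc hTe hZe hε⟩
  obtain ⟨n, hn⟩ := h.exists_movingAverage hTe hZc hZe hε
  exact ⟨n, n, hn⟩
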